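/- Let $n\ge 0$ be an integer. A random $n\times n$ Hermitian matrix $X$ is called unitarily invariant if $UXU^*$ has the same law as $X$ for every unitary matrix $U$. For real-valued measurable functions $w_1,\dots,w_n$ on $\mathbb R$ we write $X\sim PE(w_1,\dots,w_n)$ if, for some normalization constant $Z\neq 0$, the function \[ x=(x_1,\dots,x_n)\mapsto \frac1Z\,\Delta_n(x)\,\det\left[w_k(x_j)\right]_{j,k=1}^n,\qquad \Delta_n(x)=\prod_{j<k}(x_k-x_j), \] is nonnegative almost everywhere and is the probability density on $\mathbb R^n$ of the eigenvalues of $X$ (counted with multiplicity and taken in uniformly random order). A GUE matrix is a random $n\times n$ Hermitian matrix with probability density \[ \frac{1}{2^{n/2}\pi^{n^2/2}}\,e^{-\frac12\operatorname{Tr}A^2} \] with respect to the Lebesgue measure $dA=\prod_{j}dA_{jj}\prod_{j<k}d\operatorname{Re}A_{jk}\,d\operatorname{Im}A_{jk}$ on the space of Hermitian matrices. Let $X$ be an $n\times n$ unitarily invariant random Hermitian matrix with $X\sim PE(f_1,\dots,f_n)$, and let $Y$ be an $n\times n$ GUE matrix that is independent of $X$. Then the integrals \[ g_k(y)=\int_{-\infty}^{\infty}e^{-\frac12x^2}f_k(y-x)\,dx,\qquad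 y\in\mathbb R,\quad k=1,\dots,n, \] converge absolutely, and $X+Y\sim PE(g_1,\dots,g_n)$. -/

import Mathlib

open MeasureTheory ProbabilityTheory

noncomputable section

/-- The real vector space of `n × n` complex Hermitian matrices. -/
abbrev HermitianMatrix (n : ℕ) : Type := selfAdjoint (Matrix (Fin n) (Fin n) ℂ)

/-- Hermitian matrices carry their Borel σ-algebra. -/
instance HermitianMatrix.measurableSpace (n : ℕ) : MeasurableSpace (HermitianMatrix n) :=
  borel (HermitianMatrix n)

instance HermitianMatrix.borelSpace (n : ℕ) : BorelSpace (HermitianMatrix n) := ⟨rfl⟩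

/-- Free real coordinates of a Hermitian matrix: the real diagonal entries and the complex entries
strictly above the diagonal. -/
abbrev HermitianCoords (n : ℕ) : Type :=
  (Fin n → ℝ) × ({p : Fin n × Fin n // p.1 < p.2} → ℂ)

/-- The Hermitian matrix with given diagonal entries and given entries above the diagonal. -/
def HermitianMatrix.ofCoords {n : ℕ} (c : HermitianCoords n) : HermitianMatrix n :=
  ⟨Matrix.of fun i j =>
      if h : i < j then c.2 ⟨(i, j), h⟩
      else if h' : j < i then star (c.2 ⟨(j, i), h'⟩)
      else ((c.1 i : ℝ) : ℂ), by
    rw [selfAdjoint.mem_iff]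
    ext i j
    rw [Matrix.star_apply]
    rcases lt_trichotomy i j with h | h | h
    · simp [h, h.not_gt]
    · subst h; simp
    · simp [h, h.not_gt]⟩

/-- The flat Lebesgue measure `∏ dX_jj ∏_{j<k} d(Re X_jk) d(Im X_jk)` on Hermitian matrices
(`volume` on `ℂ` is the area measure `d(Re) d(Im)`). -/
def HermitianMatrix.lebesgue (n : ℕ) : Measure (HermitianMatrix n) :=
  (volume : Measure (HermitianCoords n)).map HermitianMatrix.ofCoords

/-- The density `exp(-Tr A² / 2) / (2^(n/2) π^(n²/2))` of the Gaussian Unitary Ensemble. -/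
def gueDensity (n : ℕ) (A : HermitianMatrix n) : ℝ :=
  ((2 : ℝ) ^ ((n : ℝ) / 2) * Real.pi ^ ((n : ℝ) ^ 2 / 2))⁻¹ *
    Real.exp (-(1 / 2) *
      (Matrix.trace ((A : Matrix (Fin n) (Fin n) ℂ) * (A : Matrix (Fin n) (Fin n) ℂ))).re)

/-- The law of an `n × n` GUE matrix. -/
def gueMeasure (n : ℕ) : Measure (HermitianMatrix n) :=
  (HermitianMatrix.lebesgue n).withDensity fun A => ENNReal.ofReal (gueDensity n A)

/-- Conjugation `A ↦ U A U*` by a unitary matrix. -/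
def HermitianMatrix.conj {n : ℕ} (U : Matrix.unitaryGroup (Fin n) ℂ) (A : HermitianMatrix n) :
    HermitianMatrix n :=
  ⟨(U : Matrix (Fin n) (Fin n) ℂ) * (A : Matrix (Fin n) (Fin n) ℂ) *
      star (U : Matrix (Fin n) (Fin n) ℂ),
    IsSelfAdjoint.conjugate A.2 (U : Matrix (Fin n) (Fin n) ℂ)⟩

/-- The eigenvalues of a Hermitian matrix, repeated according to multiplicity and listed in a
fixed (monotone up to a fixed relabelling of the indices) order. -/
def HermitianMatrix.eigs {n : ℕ} (A : HermitianMatrix n) : Fin n → ℝ :=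
  Matrix.IsHermitian.eigenvalues (A := (A : Matrix (Fin n) (Fin n) ℂ)) A.2

variable {Ω : Type*} [MeasurableSpace Ω]

/-- A random Hermitian matrix is unitarily invariant if `U X U*` has the same law as `X` for every
unitary matrix `U`. -/
def IsUnitarilyInvariant {n : ℕ} (P : Measure Ω) (X : Ω → HermitianMatrix n) : Prop :=
  ∀ U : Matrix.unitaryGroup (Fin n) ℂ,
    IdentDistrib (fun ω => HermitianMatrix.conj U (X ω)) X P P

/-- The law on `ℝⁿ` of the (unordered) eigenvalues of a random Hermitian matrix: the law of the
vector of eigenvalues taken in uniformly random order. -/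
def eigenvalueLaw {n : ℕ} (P : Measure Ω) (X : Ω → HermitianMatrix n) : Measure (Fin n → ℝ) :=
  ((n.factorial : ENNReal))⁻¹ •
    ∑ σ : Equiv.Perm (Fin n), P.map (fun ω => (X ω).eigs ∘ σ)

/-- The function `x ↦ Z⁻¹ Δₙ(x) det [w_k(x_j)]` on `ℝⁿ`. The determinant of
`Matrix.vandermonde x` is `Δₙ(x) = ∏_{j<k} (x_k - x_j)`. -/
def polynomialEnsembleDensity {n : ℕ} (w : Fin n → ℝ → ℝ) (Z : ℝ) (x : Fin n → ℝ) : ℝ :=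
  Z⁻¹ * (Matrix.vandermonde x).det * (Matrix.of fun j k => w k (x j)).det

/-- `X ∼ PE(w₁, …, wₙ)`: for some normalization constant `Z`, the function
`Z⁻¹ Δₙ(x) det [w_k(x_j)]` is nonnegative almost everywhere and is the density on `ℝⁿ` of the
eigenvalues of `X`. -/
structure IsPolynomialEnsemble {n : ℕ} (P : Measure Ω) (X : Ω → HermitianMatrix n)
    (w : Fin n → ℝ → ℝ) : Prop where
  aemeasurable : AEMeasurable X P
  aemeasurable_weight : ∀ k, AEMeasurable (w k) volume
  exists_density : ∃ Z : ℝ, Z ≠ 0 ∧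
    (∀ᵐ x : Fin n → ℝ, 0 ≤ polynomialEnsembleDensity w Z x) ∧
    eigenvalueLaw P X =
      (volume : Measure (Fin n → ℝ)).withDensity
        fun x => ENNReal.ofReal (polynomialEnsembleDensity w Z x)

/-- The convolution `y ↦ ∫ exp(-x²/2) f(y - x) dx`. -/
def gaussianConvolution (f : ℝ → ℝ) (y : ℝ) : ℝ :=
  ∫ x : ℝ, Real.exp (-(1 / 2) * x ^ 2) * f (y - x)

end

/-! The law of the eigenvalues is tested against products of Cauchy kernels `∏_k ∏_i (z_k - λ_i)⁻¹`
with nonreal `z_k`. For a Hermitian matrix `M` with eigenvalues `λ` such a product is `∏_k det(z_k -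
M)⁻¹`, a function of `M` whose Laplacian is itself times the explicit sum `cauchySum z λ`.

Write `Δ` for the Vandermonde determinant, which is harmonic. Multiplying the Cauchy product by
`Δ(z)` gives a function of `z` whose Laplacian is again itself times `cauchySum z λ`. Since
`cauchySum` is symmetric in its two groups of points, multiplying by `Δ(a)` has the same effect for
real points `a` in place of `λ`. When the Laplacians in two groups of variables agree, Gaussian
noise in one group may be traded for Gaussian noise in the other (`gaussian_smoothing_eq`). Trading
matrix noise for noise in `z`, and that for noise in the eigenvalues, gives
`vdm_eigs_mul_integral_gueMeasure`: if `B` is fixed with eigenvalues `b`, `A` is GUE, `ζ` is a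
standard Gaussian vector and `φ` is a Cauchy product, then `Δ(b) E φ(eigs (B + A)) = E [Δ(b + ζ) φ(b
+ ζ)]`.

Now average over `X`. Its eigenvalue density contains the factor `Δ(x)` appearing on the left, so no
denominator is left; Fubini and a shear move the Gaussian onto `det [f_k(x_j)]`, and expanding the
determinant turns this into `det [g_k(x_j)]` (`integral_cauchyProd_eigs_add`). By Stone–Weierstrass,
Cauchy products determine finite permutation-invariant measures. The candidate density is a priori
signed; comparing its positive and negative parts shows that it is nonnegative almost everywhere
(`ae_nonneg_and_eq_withDensity`).

Integrability rests on `integrable_pow_mul_weight`: integrability of a nontrivial `Δ(x) det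
[f_k(x_j)]` forces each `f_k` to have finite absolute moments up to order `n - 1`. These control the
Vandermonde factor in the Fubini argument, and integrability of `f_k` gives absolute convergence of
its convolution. -/

/-- The standard Gaussian weight `exp (-|x|² / 2)` on `ℝ^ι`. -/
noncomputable def gaussWeight {ι : Type*} [Fintype ι] (x : ι → ℝ) : ℝ :=
  Real.exp (-(1 / 2) * ∑ i, x i ^ 2)

/-- Functions bounded by a polynomial in the norm. -/
def PolyGrowth {E F : Type*} [Norm E] [Norm F] (f : E → F) : Prop :=
  ∃ C : ℝ, ∃ m : ℕ, ∀ x, ‖f x‖ ≤ C * (1 + ‖x‖) ^ m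

/-! ### Functions of polynomial growth -/

section PolyGrowth

variable {E : Type*} [SeminormedAddCommGroup E]

theorem PolyGrowth.exists_nonneg {F : Type*} [Norm F] {f : E → F} (hf : PolyGrowth f) :
    ∃ C : ℝ, 0 ≤ C ∧ ∃ m : ℕ, ∀ x, ‖f x‖ ≤ C * (1 + ‖x‖) ^ m := by
  obtain ⟨C, m, h⟩ := hf
  refine ⟨|C|, abs_nonneg C, m, fun x => (h x).trans ?_⟩
  gcongr
  exact le_abs_self C

theorem PolyGrowth.of_bound {F : Type*} [Norm F] {f : E → F} (C : ℝ) (h : ∀ x, ‖f x‖ ≤ C) :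
    PolyGrowth f :=
  ⟨C, 0, fun x => by simpa using h x⟩

theorem PolyGrowth.mul {R : Type*} [NonUnitalSeminormedRing R] {f g : E → R}
    (hf : PolyGrowth f) (hg : PolyGrowth g) : PolyGrowth fun x => f x * g x := by
  obtain ⟨C, hC, m, h⟩ := hf.exists_nonneg
  obtain ⟨D, hD, k, h'⟩ := hg.exists_nonneg
  refine ⟨C * D, m + k, fun x => (norm_mul_le _ _).trans ?_⟩
  calc ‖f x‖ * ‖g x‖ ≤ (C * (1 + ‖x‖) ^ m) * (D * (1 + ‖x‖) ^ k) := by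
        gcongr
        · exact h x
        · exact h' x
    _ = C * D * (1 + ‖x‖) ^ (m + k) := by ring

theorem PolyGrowth.add {F : Type*} [SeminormedAddCommGroup F] {f g : E → F}
    (hf : PolyGrowth f) (hg : PolyGrowth g) : PolyGrowth fun x => f x + g x := by
  obtain ⟨C, hC, m, h⟩ := hf.exists_nonneg
  obtain ⟨D, hD, k, h'⟩ := hg.exists_nonneg
  refine ⟨C + D, m + k, fun x => (norm_add_le _ _).trans ?_⟩
  have h1 : (1 : ℝ) ≤ 1 + ‖x‖ := by linarith [norm_nonneg x]
  calc ‖f x‖ + ‖g x‖ ≤ C * (1 + ‖x‖) ^ m + D * (1 + ‖x‖) ^ k := add_le_add (h x) (h' x)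
    _ ≤ C * (1 + ‖x‖) ^ (m + k) + D * (1 + ‖x‖) ^ (m + k) := by
        gcongr <;> first | exact h1 | omega
    _ = (C + D) * (1 + ‖x‖) ^ (m + k) := by ring

theorem PolyGrowth.neg {F : Type*} [SeminormedAddCommGroup F] {f : E → F}
    (hf : PolyGrowth f) : PolyGrowth fun x => - f x := by
  obtain ⟨C, m, h⟩ := hf
  exact ⟨C, m, fun x => by simpa using h x⟩

theorem PolyGrowth.sub {F : Type*} [SeminormedAddCommGroup F] {f g : E → F}
    (hf : PolyGrowth f) (hg : PolyGrowth g) : PolyGrowth fun x => f x - g x := by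
  simpa [sub_eq_add_neg] using hf.add hg.neg

theorem PolyGrowth.const {F : Type*} [Norm F] (c : F) : PolyGrowth fun _ : E => c :=
  .of_bound ‖c‖ fun _ => le_rfl

theorem PolyGrowth.sum {κ F : Type*} [SeminormedAddCommGroup F] (s : Finset κ) {f : κ → E → F}
    (hf : ∀ i ∈ s, PolyGrowth (f i)) : PolyGrowth fun x => ∑ i ∈ s, f i x := by
  classical
  induction s using Finset.induction_on with
  | empty => simpa using PolyGrowth.const (E := E) (0 : F)
  | insert a s ha ih =>
    simp only [Finset.sum_insert ha]
    exact (hf a (by simp)).add (ih fun i hi => hf i (by simp [hi]))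

theorem PolyGrowth.prod {κ R : Type*} [NormedCommRing R] (s : Finset κ) {f : κ → E → R}
    (hf : ∀ i ∈ s, PolyGrowth (f i)) : PolyGrowth fun x => ∏ i ∈ s, f i x := by
  classical
  induction s using Finset.induction_on with
  | empty => simpa using PolyGrowth.const (E := E) (1 : R)
  | insert a s ha ih =>
    simp only [Finset.prod_insert ha]
    exact (hf a (by simp)).mul (ih fun i hi => hf i (by simp [hi]))

theorem PolyGrowth.pow {R : Type*} [NormedCommRing R] {f : E → R} (hf : PolyGrowth f) (k : ℕ) :
    PolyGrowth fun x => f x ^ k := by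
  simpa using PolyGrowth.prod (Finset.range k) (f := fun _ => f) fun _ _ => hf

theorem PolyGrowth.comp_of_norm_le {F E' : Type*} [SeminormedAddCommGroup E'] [Norm F]
    {f : E → F} (hf : PolyGrowth f) {p : E' → E} (hp : ∀ x, ‖p x‖ ≤ ‖x‖) :
    PolyGrowth fun x => f (p x) := by
  obtain ⟨C, hC, m, h⟩ := hf.exists_nonneg
  refine ⟨C, m, fun x => (h _).trans ?_⟩
  gcongr
  exact hp x

end PolyGrowth

/-! ### Gaussian integrals and integration by parts -/

section Gauss

variable {ι : Type*} [Fintype ι]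

theorem gaussWeight_pos (x : ι → ℝ) : 0 < gaussWeight x := Real.exp_pos _

theorem continuous_gaussWeight : Continuous (gaussWeight (ι := ι)) := by
  unfold gaussWeight; fun_prop

theorem gaussWeight_eq_prod (x : ι → ℝ) :
    gaussWeight x = ∏ i, Real.exp (-(1 / 2) * x i ^ 2) := by
  rw [gaussWeight, Finset.mul_sum, Real.exp_sum]

theorem polyGrowth_coord (i : ι) : PolyGrowth fun x : ι → ℝ => (x i : ℂ) :=
  ⟨1, 1, fun x => by
    have := norm_le_pi_norm x i
    simp only [Complex.norm_real, pow_one, one_mul]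
    linarith⟩

/-- The power is at most `m!` times `exp (1 + ∑ |x i|)`, and `|x i| ≤ 1 + x i ^ 2 / 4` absorbs this
into half of the Gaussian exponent. The resulting majorant is a product of one-dimensional
Gaussians. -/
theorem integrable_pow_mul_gaussWeight (m : ℕ) :
    Integrable fun x : ι → ℝ => (1 + ‖x‖) ^ m * gaussWeight x := by
  have h1 : Integrable fun x : ι → ℝ =>
      (m.factorial * Real.exp 1) * ∏ i, (Real.exp 1 * Real.exp (-(1 / 4) * x i ^ 2)) := by
    refine Integrable.const_mul ?_ _
    exact Integrable.fintype_prod (f := fun _ y => Real.exp 1 * Real.exp (-(1 / 4) * y ^ 2))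
      fun i => (integrable_exp_neg_mul_sq (by norm_num)).const_mul _
  have hc := continuous_gaussWeight (ι := ι)
  refine h1.mono' (by fun_prop) ?_
  · refine Filter.Eventually.of_forall fun x => ?_
    have hnorm : ‖x‖ ≤ ∑ i, |x i| := by
      refine (pi_norm_le_iff_of_nonneg (by positivity)).2 fun i => ?_
      exact Finset.single_le_sum (f := fun i => |x i|) (fun i _ => abs_nonneg _) (Finset.mem_univ i)
    have hx : ∀ i, |x i| ≤ 1 + (1 / 4) * x i ^ 2 := fun i => by
      nlinarith [sq_nonneg (|x i| - 2), sq_abs (x i)]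
    have h2 : (1 + ‖x‖) ^ m ≤ m.factorial * (Real.exp 1 * ∏ i, Real.exp (|x i|)) := by
      have := Real.pow_div_factorial_le_exp (1 + ‖x‖) (by positivity) m
      rw [div_le_iff₀ (by positivity), mul_comm] at this
      refine this.trans ?_
      rw [← Real.exp_sum, ← Real.exp_add]
      gcongr
    have hw := gaussWeight_pos x
    rw [Real.norm_of_nonneg (by positivity)]
    refine (mul_le_mul_of_nonneg_right h2 hw.le).trans (le_of_eq_of_le (b := (m.factorial * Real.exp 1) *
      ∏ i, (Real.exp (|x i|) * Real.exp (-(1 / 2) * x i ^ 2))) ?_ ?_)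
    · rw [gaussWeight_eq_prod, Finset.prod_mul_distrib]; ring
    · refine mul_le_mul_of_nonneg_left (Finset.prod_le_prod (fun i _ => by positivity)
        fun i _ => ?_) (by positivity)
      rw [← Real.exp_add, ← Real.exp_add]
      exact Real.exp_le_exp.2 (by linarith [hx i])

theorem PolyGrowth.integrable_mul_gaussWeight {F : (ι → ℝ) → ℂ} (hF : PolyGrowth F)
    (hm : Continuous F) : Integrable fun x => F x * (gaussWeight x : ℂ) := by
  obtain ⟨C, m, h⟩ := hF
  have hc := continuous_gaussWeight (ι := ι)
  refine ((integrable_pow_mul_gaussWeight m).const_mul C).mono'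
    (by fun_prop) (Filter.Eventually.of_forall fun x => ?_)
  rw [norm_mul, Complex.norm_real, Real.norm_of_nonneg (gaussWeight_pos x).le, ← mul_assoc]
  exact mul_le_mul_of_nonneg_right (h x) (gaussWeight_pos x).le

theorem integrable_gaussWeight : Integrable (gaussWeight (ι := ι)) := by
  simpa using integrable_pow_mul_gaussWeight (ι := ι) 0

theorem integral_gaussWeight_pos : 0 < ∫ x : ι → ℝ, gaussWeight x :=
  integral_exp_pos integrable_gaussWeight

variable [DecidableEq ι]

theorem hasLineDerivAt_gaussWeight (x : ι → ℝ) (i : ι) :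
    HasLineDerivAt ℝ (fun x : ι → ℝ => (gaussWeight x : ℂ)) (-(x i * gaussWeight x : ℂ)) x
      (Pi.single i 1) := by
  have h : HasDerivAt (fun t : ℝ => gaussWeight (x + t • Pi.single i 1)) (-(x i * gaussWeight x)) 0 := by
    have h1 : ∀ j, HasDerivAt (fun t : ℝ => (x + t • (Pi.single i 1 : ι → ℝ)) j ^ 2)
        (2 * x j * (Pi.single i 1 : ι → ℝ) j) 0 := fun j => by
      have := (((hasDerivAt_id (0 : ℝ)).mul_const ((Pi.single i 1 : ι → ℝ) j)).const_add (x j)).fun_pow 2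
      simpa using this
    have h2 := ((HasDerivAt.fun_sum (u := Finset.univ) fun j _ => h1 j).const_mul (-(1 / 2))).exp
    refine h2.congr_deriv ?_
    simp [gaussWeight, Pi.single_apply]
    ring
  simpa [HasLineDerivAt] using h.ofReal_comp

/-- Gaussian integration by parts in a coordinate direction. -/
theorem integral_coord_mul_gaussWeight {F F' : (ι → ℝ) → ℂ} (i : ι)
    (hF : ∀ x, HasLineDerivAt ℝ F (F' x) x (Pi.single i 1))
    (hFc : Continuous F) (hF'c : Continuous F') (hFg : PolyGrowth F) (hF'g : PolyGrowth F') :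
    ∫ x, (x i : ℂ) * F x * (gaussWeight x : ℂ) = ∫ x, F' x * (gaussWeight x : ℂ) := by
  have h1 := hF'g.integrable_mul_gaussWeight hF'c
  have h2 := hFg.integrable_mul_gaussWeight hFc
  have h3 := ((polyGrowth_coord i).mul hFg).integrable_mul_gaussWeight (by fun_prop)
  have := integral_bilinear_hasLineDerivAt_right_eq_neg_left_of_integrable (μ := volume)
    (B := ContinuousLinearMap.mul ℝ ℂ) (f := F) (f' := F') (g := fun x => (gaussWeight x : ℂ))
    (g' := fun x => (-(x i * gaussWeight x : ℂ))) (v := Pi.single i 1) (by simpa using h1)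
    (by
      refine h3.neg.congr (Filter.Eventually.of_forall fun x => ?_)
      simp; ring) (by simpa using h2) (fun x _ => hF x)
      (fun x _ => hasLineDerivAt_gaussWeight x i)
  simp only [ContinuousLinearMap.mul_apply'] at this
  rw [eq_comm, ← neg_inj, ← this, ← integral_neg]
  congr 1; ext x; ring

end Gauss

/-! ### Exchanging Gaussian smoothing between two groups of variables -/

/-- If the Laplacians of `H` in two groups of variables agree, then Gaussian smoothing in one group
gives the same result as Gaussian smoothing in the other group. -/
theorem gaussian_smoothing_eq {A B : Type*} [Fintype A] [Fintype B] [DecidableEq A] [DecidableEq B]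
    {H : (A ⊕ B → ℝ) → ℂ} {d₁ d₂ : A ⊕ B → (A ⊕ B → ℝ) → ℂ} (hH : ContDiff ℝ 2 H)
    (h₁ : ∀ i x, HasLineDerivAt ℝ H (d₁ i x) x (Pi.single i 1))
    (h₂ : ∀ i x, HasLineDerivAt ℝ (d₁ i) (d₂ i x) x (Pi.single i 1))
    (hg : PolyGrowth H) (hg₁ : ∀ i, PolyGrowth (d₁ i)) (hg₂ : ∀ i, PolyGrowth (d₂ i))
    (hlap : ∀ x, ∑ a, d₂ (.inl a) x = ∑ b, d₂ (.inr b) x) :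
    ∫ x : A ⊕ B → ℝ, H (Sum.elim (fun a => x (.inl a)) (0 : B → ℝ)) * (gaussWeight x : ℂ) =
      ∫ x : A ⊕ B → ℝ, H (Sum.elim (0 : A → ℝ) (fun b => x (.inr b))) * (gaussWeight x : ℂ) := by
  have hd₁ : ∀ i, d₁ i = fun x => fderiv ℝ H x (Pi.single i 1) := fun i => by
    ext x
    exact (h₁ i x).unique ((hH.differentiable (by norm_num)).differentiableAt.hasFDerivAt.hasLineDerivAt _)
  have hs₁ : ∀ i, ContDiff ℝ 1 (d₁ i) := fun i => by
    rw [hd₁]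
    exact (hH.fderiv_right (m := 1) (by norm_num)).clm_apply contDiff_const
  have hd₂ : ∀ i, d₂ i = fun x => fderiv ℝ (d₁ i) x (Pi.single i 1) := fun i => by
    ext x
    exact (h₂ i x).unique (((hs₁ i).differentiable (by norm_num)).differentiableAt.hasFDerivAt.hasLineDerivAt _)
  have hc₁ : ∀ i, Continuous (d₁ i) := fun i => (hs₁ i).continuous
  have hc₂ : ∀ i, Continuous (d₂ i) := fun i => by
    rw [hd₂]
    exact (((hs₁ i).fderiv_right (m := 0) (by norm_num)).clm_apply contDiff_const).continuous
  have hc : Continuous H := hH.continuous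
  -- Interpolate by `φ θ = E H(sin θ • ξ, cos θ • η)`, which smooths only in `A` at `θ = π / 2` and
  -- only in `B` at `θ = 0`. Integration by parts gives `φ' θ = sin θ cos θ E [(Δ_A - Δ_B) H] = 0`.
  let c : ℝ → A ⊕ B → ℝ := fun θ => Sum.elim (fun _ => Real.sin θ) (fun _ => Real.cos θ)
  let c' : ℝ → A ⊕ B → ℝ := fun θ => Sum.elim (fun _ => Real.cos θ) (fun _ => -Real.sin θ)
  have hcc : ∀ i θ, HasDerivAt (fun θ => c θ i) (c' θ i) θ := by
    rintro (a | b) θ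
    · exact Real.hasDerivAt_sin θ
    · exact Real.hasDerivAt_cos θ
  have hcle : ∀ θ i, |c θ i| ≤ 1 := by
    rintro θ (a | b)
    · exact Real.abs_sin_le_one θ
    · exact Real.abs_cos_le_one θ
  have hc'le : ∀ θ i, |c' θ i| ≤ 1 := by
    rintro θ (a | b)
    · exact Real.abs_cos_le_one θ
    · simpa [c'] using Real.abs_sin_le_one θ
  let p : ℝ → (A ⊕ B → ℝ) → (A ⊕ B → ℝ) := fun θ x i => c θ i * x i
  have hpn : ∀ θ x, ‖p θ x‖ ≤ ‖x‖ := fun θ x => by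
    refine (pi_norm_le_iff_of_nonneg (norm_nonneg x)).2 fun i => ?_
    rw [norm_mul]
    exact (mul_le_of_le_one_left (norm_nonneg _) (hcle θ i)).trans (norm_le_pi_norm x i)
  have hpc : ∀ θ, Continuous (p θ) := fun θ => by fun_prop
  have hpd : ∀ θ x, HasDerivAt (fun θ => H (p θ x))
      (∑ i, (c' θ i : ℂ) * ((x i : ℂ) * d₁ i (p θ x))) θ := fun θ x => by
    have hp : HasDerivAt (fun θ => p θ x) (fun i => c' θ i * x i) θ :=
      hasDerivAt_pi.2 fun i => (hcc i θ).mul_const _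
    have h := (hH.differentiable (by norm_num)).differentiableAt.hasFDerivAt (x := p θ x)
      |>.comp_hasDerivAt θ hp
    refine h.congr_deriv ?_
    conv_lhs => rw [pi_eq_sum_univ' (fun i => c' θ i * x i), map_sum]
    refine Finset.sum_congr rfl fun i _ => ?_
    rw [map_smul, hd₁]
    simp [mul_assoc]
  let φ : ℝ → ℂ := fun θ => ∫ x, H (p θ x) * (gaussWeight x : ℂ)
  choose C hC m hCm using fun i => (hg₁ i).exists_nonneg
  have hφ : ∀ θ, HasDerivAt φ 0 θ := fun θ => by
    have key := hasDerivAt_integral_of_dominated_loc_of_deriv_le (μ := volume) (s := Set.univ)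
      (x₀ := θ) (F := fun θ x => H (p θ x) * (gaussWeight x : ℂ))
      (F' := fun θ x => (∑ i, (c' θ i : ℂ) * ((x i : ℂ) * d₁ i (p θ x))) * (gaussWeight x : ℂ))
      (bound := fun x => ∑ i, C i * ((1 + ‖x‖) ^ (m i + 1) * gaussWeight x)) Filter.univ_mem
      (Filter.Eventually.of_forall fun θ => by
        have := hpc θ
        have := continuous_gaussWeight (ι := A ⊕ B)
        fun_prop)
      ((hg.comp_of_norm_le (hpn θ)).integrable_mul_gaussWeight (hc.comp (hpc θ)))
      (by
        have := hpc θ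
        have := continuous_gaussWeight (ι := A ⊕ B)
        fun_prop)
      (Filter.Eventually.of_forall fun x θ _ => by
        have hw := gaussWeight_pos x
        rw [norm_mul, Complex.norm_real, Real.norm_of_nonneg hw.le]
        simp_rw [← mul_assoc]
        rw [← Finset.sum_mul]
        refine mul_le_mul_of_nonneg_right ((norm_sum_le _ _).trans (Finset.sum_le_sum fun i _ => ?_)) hw.le
        rw [norm_mul, norm_mul, Complex.norm_real, Complex.norm_real]
        have hx1 : ‖x i‖ ≤ 1 + ‖x‖ := (norm_le_pi_norm x i).trans (by linarith)
        calc ‖c' θ i‖ * ‖x i‖ * ‖d₁ i (p θ x)‖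
            ≤ 1 * (1 + ‖x‖) * (C i * (1 + ‖x‖) ^ m i) := by
              gcongr
              · exact hc'le θ i
              · refine (hCm i _).trans ?_
                have := hC i
                gcongr
                exact hpn θ x
          _ = C i * (1 + ‖x‖) ^ (m i + 1) := by ring)
      (integrable_finsetSum _ fun i _ => (integrable_pow_mul_gaussWeight _).const_mul _)
      (Filter.Eventually.of_forall fun x θ _ => (hpd θ x).mul_const _)
    refine key.2.congr_deriv ?_
    have hgp₁ : ∀ i, PolyGrowth fun x => d₁ i (p θ x) := fun i => (hg₁ i).comp_of_norm_le (hpn θ)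
    have hgp₂ : ∀ i, PolyGrowth fun x => d₂ i (p θ x) := fun i => (hg₂ i).comp_of_norm_le (hpn θ)
    have hline : ∀ i x, HasLineDerivAt ℝ (fun x => d₁ i (p θ x)) (c θ i * d₂ i (p θ x)) x
        (Pi.single i 1) := fun i x => by
      have h := h₂ i (p θ x)
      unfold HasLineDerivAt at h ⊢
      have h' : HasDerivAt (fun t : ℝ => c θ i * t) (c θ i) 0 := by
        simpa using (hasDerivAt_id (0 : ℝ)).const_mul (c θ i)
      have h3 := HasDerivAt.scomp (h := fun t : ℝ => c θ i * t) (0 : ℝ)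
        (by simpa using h) h'
      refine (h3.congr_deriv (by simp)).congr_of_eventuallyEq (Filter.Eventually.of_forall fun t => ?_)
      simp only [Function.comp]
      congr 1
      ext j
      simp only [p, Pi.add_apply, Pi.smul_apply, smul_eq_mul, Pi.single_apply]
      split_ifs with hj
      · subst hj; ring
      · ring
    -- The factor `x i` produced by differentiating in `θ` is integrated by parts; the chain rule
    -- through `p θ` returns the factor `c θ i`.
    have hst : ∀ i, ∫ x, (x i : ℂ) * d₁ i (p θ x) * (gaussWeight x : ℂ) =
        c θ i * ∫ x, d₂ i (p θ x) * (gaussWeight x : ℂ) := fun i => by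
      have := integral_coord_mul_gaussWeight i (hline i) ((hc₁ i).comp (hpc θ))
        (continuous_const.mul ((hc₂ i).comp (hpc θ))) (hgp₁ i) ((PolyGrowth.const _).mul (hgp₂ i))
      rw [this, ← integral_const_mul]
      simp_rw [mul_assoc]
    have hi₁ : ∀ i, Integrable fun x => (c' θ i : ℂ) * ((x i : ℂ) * d₁ i (p θ x) * (gaussWeight x : ℂ)) :=
      fun i => (((polyGrowth_coord i).mul (hgp₁ i)).integrable_mul_gaussWeight
        (by have := hpc θ; have := hc₁ i; fun_prop)).const_mul _
    have hi₂ : ∀ i, Integrable fun x => d₂ i (p θ x) * (gaussWeight x : ℂ) :=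
      fun i => (hgp₂ i).integrable_mul_gaussWeight ((hc₂ i).comp (hpc θ))
    calc ∫ x, (∑ i, (c' θ i : ℂ) * ((x i : ℂ) * d₁ i (p θ x))) * (gaussWeight x : ℂ)
        = ∫ x, ∑ i, (c' θ i : ℂ) * ((x i : ℂ) * d₁ i (p θ x) * (gaussWeight x : ℂ)) := by
          simp_rw [Finset.sum_mul, mul_assoc]
      _ = ∑ i, (c' θ i : ℂ) * (c θ i * ∫ x, d₂ i (p θ x) * (gaussWeight x : ℂ)) := by
          rw [integral_finsetSum _ fun i _ => hi₁ i]
          simp_rw [integral_const_mul, hst]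
      _ = Real.sin θ * Real.cos θ * (∫ x, (∑ a, d₂ (.inl a) (p θ x)) * (gaussWeight x : ℂ)) -
          Real.sin θ * Real.cos θ * (∫ x, (∑ b, d₂ (.inr b) (p θ x)) * (gaussWeight x : ℂ)) := by
          rw [Fintype.sum_sum_type]
          simp_rw [Finset.sum_mul]
          rw [integral_finsetSum _ fun i _ => hi₂ _, integral_finsetSum _ fun i _ => hi₂ _,
            Finset.mul_sum, Finset.mul_sum, sub_eq_add_neg, ← Finset.sum_neg_distrib]
          congr 1 <;> refine Finset.sum_congr rfl fun i _ => ?_ <;> simp [c, c'] <;> ring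
      _ = 0 := by simp_rw [hlap]; ring
  have hconst := is_const_of_deriv_eq_zero (fun θ => (hφ θ).differentiableAt)
    (fun θ => (hφ θ).deriv) (Real.pi / 2) 0
  have hp1 : ∀ x, p (Real.pi / 2) x = Sum.elim (fun a => x (.inl a)) (0 : B → ℝ) := fun x => by
    ext (a | b) <;> simp [p, c]
  have hp0 : ∀ x, p 0 x = Sum.elim (0 : A → ℝ) (fun b => x (.inr b)) := fun x => by
    ext (a | b) <;> simp [p, c]
  simpa only [φ, hp1, hp0] using hconst

/-- A Gaussian integral over `A ⊕ B` splits as a product. -/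
theorem integral_sum_gaussWeight {A B : Type*} [Fintype A] [Fintype B]
    (f : (A → ℝ) → ℂ) (g : (B → ℝ) → ℂ) :
    ∫ x : A ⊕ B → ℝ, f (fun a => x (.inl a)) * g (fun b => x (.inr b)) * (gaussWeight x : ℂ) =
      (∫ x : A → ℝ, f x * (gaussWeight x : ℂ)) * ∫ y : B → ℝ, g y * (gaussWeight y : ℂ) := by
  rw [← integral_prod_mul, ← Measure.volume_eq_prod,
    ← (volume_measurePreserving_sumPiEquivProdPi (fun _ : A ⊕ B => ℝ)).integral_comp
      (MeasurableEquiv.measurableEmbedding _)]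
  congr 1
  ext x
  have : gaussWeight x = gaussWeight (fun a => x (.inl a)) * gaussWeight (fun b => x (.inr b)) := by
    simp only [gaussWeight, Fintype.sum_sum_type, mul_add, Real.exp_add]
  rw [this]
  simp only [MeasurableEquiv.coe_sumPiEquivProdPi, Equiv.sumPiEquivProdPi_apply]
  push_cast
  ring

/-! ### Derivatives of determinants and products -/

section Det

open Matrix

theorem Matrix.det_updateRow_eq_sum {n R : Type*} [Fintype n] [DecidableEq n] [CommRing R]
    (A : Matrix n n R) (k : n) (r : n → R) :
    (A.updateRow k r).det = ∑ i, r i * A.adjugate i k := by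
  rw [← cramer_transpose_apply, cramer_eq_adjugate_mulVec, ← adjugate_transpose]
  simp [mulVec, dotProduct, mul_comm]

theorem Matrix.det_updateCol_eq_sum {n R : Type*} [Fintype n] [DecidableEq n] [CommRing R]
    (A : Matrix n n R) (i : n) (c : n → R) :
    (A.updateCol i c).det = ∑ k, c k * A.adjugate i k := by
  rw [← cramer_apply, cramer_eq_adjugate_mulVec]
  simp [mulVec, dotProduct, mul_comm]

/-- Both sides are the derivative of `det` at `A` in the direction `B`, expanded through the
adjugate. Passing from rows to columns is what makes the Laplacian of the Vandermonde determinant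
computable. -/
theorem Matrix.sum_det_updateRow {n R : Type*} [Fintype n] [DecidableEq n] [CommRing R]
    (A B : Matrix n n R) :
    ∑ k, (A.updateRow k (B k)).det = ∑ i, (A.updateCol i (fun k => B k i)).det := by
  simp_rw [det_updateRow_eq_sum, det_updateCol_eq_sum]
  exact Finset.sum_comm

theorem Matrix.hasDerivAt_det_updateRow {n : Type*} [Fintype n] [DecidableEq n]
    (A : Matrix n n ℂ) (k : n) {r : ℝ → n → ℂ} {r' : n → ℂ} {t : ℝ}
    (hr : ∀ i, HasDerivAt (fun t => r t i) (r' i) t) :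
    HasDerivAt (fun t => (A.updateRow k (r t)).det) (A.updateRow k r').det t := by
  simp_rw [det_updateRow_eq_sum]
  exact HasDerivAt.fun_sum fun i _ => (hr i).mul_const _

end Det

theorem hasDerivAt_prod_of_ne_zero {ι : Type*} (s : Finset ι) {f : ι → ℝ → ℂ} {f' : ι → ℂ} {t : ℝ}
    (hf : ∀ i ∈ s, HasDerivAt (f i) (f' i) t) (h0 : ∀ i ∈ s, f i t ≠ 0) :
    HasDerivAt (fun t => ∏ i ∈ s, f i t) ((∏ i ∈ s, f i t) * ∑ i ∈ s, f' i / f i t) t := by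
  classical
  induction s using Finset.induction_on with
  | empty => simpa using hasDerivAt_const t (1 : ℂ)
  | insert a s ha ih =>
    simp only [Finset.prod_insert ha, Finset.sum_insert ha]
    refine ((hf a (by simp)).fun_mul (ih (fun i hi => hf i (by simp [hi]))
      fun i hi => h0 i (by simp [hi]))).congr_deriv ?_
    have := h0 a (by simp)
    field_simp

/-! ### Vandermonde determinant, Cauchy products and their Laplacians -/

section Vandermonde

open Matrix

variable {N : ℕ}

/-- The Vandermonde determinant. -/
noncomputable def vdm (w : Fin N → ℂ) : ℂ := (vandermonde w).det

/-- First partial derivatives of the Vandermonde determinant. -/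
noncomputable def vdm₁ (k : Fin N) (w : Fin N → ℂ) : ℂ :=
  ((vandermonde w).updateRow k fun i => (i : ℂ) * w k ^ ((i : ℕ) - 1)).det

/-- Second unmixed partial derivatives of the Vandermonde determinant. -/
noncomputable def vdm₂ (k : Fin N) (w : Fin N → ℂ) : ℂ :=
  ((vandermonde w).updateRow k fun i =>
    (i : ℂ) * ((((i : ℕ) - 1 : ℕ) : ℂ) * w k ^ ((i : ℕ) - 1 - 1))).det

theorem vandermonde_add_single (w : Fin N → ℂ) (k : Fin N) (t : ℂ) :
    vandermonde (w + Pi.single k t) = (vandermonde w).updateRow k fun i => (w k + t) ^ (i : ℕ) := by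
  ext j i
  by_cases h : j = k
  · subst h; simp [vandermonde_apply]
  · simp [vandermonde_apply, h]

/-- For `m = 0` the truncated exponent `m - 1` is harmless, since the coefficient `m` vanishes. The
same convention is used in `vdm₁` and `vdm₂`. -/
theorem hasDerivAt_pow_shift (a : ℂ) (m : ℕ) :
    HasDerivAt (fun t : ℝ => (a + (t : ℂ)) ^ m) (m * a ^ (m - 1)) 0 := by
  have h := ((Complex.ofRealCLM.hasDerivAt (x := (0 : ℝ))).const_add a).fun_pow m
  simpa using h

theorem hasDerivAt_vdm (w : Fin N → ℂ) (k : Fin N) :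
    HasDerivAt (fun t : ℝ => vdm (w + Pi.single k (t : ℂ))) (vdm₁ k w) 0 := by
  simp_rw [vdm, vandermonde_add_single]
  exact hasDerivAt_det_updateRow _ _ fun i => hasDerivAt_pow_shift _ _

theorem hasDerivAt_vdm₁ (w : Fin N → ℂ) (k : Fin N) :
    HasDerivAt (fun t : ℝ => vdm₁ k (w + Pi.single k (t : ℂ))) (vdm₂ k w) 0 := by
  simp_rw [vdm₁, vandermonde_add_single, updateRow_idem]
  refine hasDerivAt_det_updateRow _ _ fun i => ?_
  simpa using (hasDerivAt_pow_shift (w k) ((i : ℕ) - 1)).const_mul (i : ℂ)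

/-- The Vandermonde determinant is harmonic. -/
theorem sum_vdm₂ (w : Fin N → ℂ) : ∑ k, vdm₂ k w = 0 := by
  unfold vdm₂
  -- After the sum is rearranged by columns, column `i` is replaced by `i (i - 1)` times column `i -
  -- 2`, or by zero when `i < 2`. The determinant vanishes in both cases.
  rw [sum_det_updateRow (vandermonde w) (fun k i =>
    (i : ℂ) * ((((i : ℕ) - 1 : ℕ) : ℂ) * w k ^ ((i : ℕ) - 1 - 1)))]
  refine Finset.sum_eq_zero fun i _ => ?_
  by_cases hi : 2 ≤ (i : ℕ)
  · obtain ⟨j, hj⟩ : ∃ j : Fin N, (j : ℕ) = (i : ℕ) - 1 - 1 := ⟨⟨(i : ℕ) - 1 - 1, by omega⟩, rfl⟩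
    have hji : j ≠ i := fun h => by subst h; omega
    have : (fun k => (i : ℂ) * ((((i : ℕ) - 1 : ℕ) : ℂ) * w k ^ ((i : ℕ) - 1 - 1))) =
        ((i : ℂ) * (((i : ℕ) - 1 : ℕ) : ℂ)) • fun k => vandermonde w k j := by
      ext k
      simp [vandermonde_apply, hj, mul_assoc]
    rw [this, det_updateCol_smul, det_zero_of_column_eq hji.symm, mul_zero]
    intro k
    simp [updateCol_ne hji]
  · refine det_eq_zero_of_column_eq_zero i fun k => ?_
    have : (i : ℕ) = 0 ∨ (i : ℕ) - 1 = 0 := by omega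
    rcases this with h | h <;> simp [h]

/-- Equal coordinates separate because their speeds differ, and distinct ones stay distinct for
small `t`. This allows identities proved for distinct points to be extended by continuity. -/
theorem eventually_injective_add_mul {ι : Type*} [Finite ι] (w c : ι → ℂ) (hc : c.Injective) :
    ∀ᶠ t : ℝ in nhdsWithin 0 {0}ᶜ, Function.Injective fun i => w i + t * c i := by
  have h : ∀ p : ι × ι, ∀ᶠ t : ℝ in nhdsWithin 0 {0}ᶜ,
      p.1 ≠ p.2 → w p.1 + t * c p.1 ≠ w p.2 + t * c p.2 := by
    rintro ⟨i, j⟩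
    by_cases hij : i = j
    · simp [hij]
    have hcij : c i - c j ≠ 0 := sub_ne_zero.2 (hc.ne hij)
    by_cases hw : w i = w j
    · filter_upwards [self_mem_nhdsWithin] with t ht _ h
      have : (t : ℂ) * (c i - c j) = 0 := by rw [hw] at h; linear_combination h
      simp_all
    · have hcont : ContinuousAt (fun t : ℝ => w i + t * c i - (w j + t * c j)) 0 := by fun_prop
      have := hcont.eventually_ne (y := 0) (by simpa using sub_ne_zero.2 hw)
      filter_upwards [this.filter_mono nhdsWithin_le_nhds] with t ht _ h
      exact ht (sub_eq_zero.2 h)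
  filter_upwards [Filter.eventually_all.2 h] with t ht i j hij
  by_contra hne
  exact ht (i, j) hne hij

theorem continuous_vdm : Continuous (vdm (N := N)) := by
  unfold vdm
  refine Continuous.matrix_det (continuous_matrix fun i j => ?_)
  simp only [vandermonde_apply]
  fun_prop

theorem continuous_vdm₁ (k : Fin N) : Continuous (vdm₁ k) := by
  unfold vdm₁
  refine Continuous.matrix_det (continuous_matrix fun i j => ?_)
  by_cases h : i = k
  · subst h
    simp only [updateRow_self]
    fun_prop
  · simp only [updateRow_ne h, vandermonde_apply]
    fun_prop

theorem vdm_ne_zero {w : Fin N → ℂ} (hw : w.Injective) : vdm w ≠ 0 := by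
  rw [vdm, det_vandermonde_ne_zero_iff]; exact hw

/-- Logarithmic differentiation of `∏_{i<j} (w j - w i)` pairs the terms into difference quotients
`(T j - T i) / (w j - w i)`, each equal to `-S i j`. Distinctness of the points is needed only for
dividing. -/
theorem sum_vdm₁_mul_of_injective {w : Fin N → ℂ} (hw : w.Injective) {T : Fin N → ℂ}
    {S : Fin N → Fin N → ℂ} (hTS : ∀ k l, T k - T l = -(w k - w l) * S k l) :
    ∑ k, vdm₁ k w * T k = - vdm w * ∑ i, ∑ j ∈ Finset.Ioi i, S i j := by
  have hne : ∀ i, ∀ j ∈ Finset.Ioi i, w j - w i ≠ 0 := fun i j hj =>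
    sub_ne_zero.2 (hw.ne (Finset.mem_Ioi.1 hj).ne')
  have hd : ∀ k, vdm₁ k w = vdm w * ∑ i, ∑ j ∈ Finset.Ioi i,
      ((Pi.single k 1 : Fin N → ℂ) j - (Pi.single k 1 : Fin N → ℂ) i) / (w j - w i) := fun k => by
    refine (hasDerivAt_vdm w k).unique ?_
    have h1 : ∀ i, HasDerivAt (fun t : ℝ => ∏ j ∈ Finset.Ioi i,
        ((w + Pi.single k (t : ℂ) : Fin N → ℂ) j - (w + Pi.single k (t : ℂ) : Fin N → ℂ) i))
        ((∏ j ∈ Finset.Ioi i, (w j - w i)) * ∑ j ∈ Finset.Ioi i,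
        ((Pi.single k 1 : Fin N → ℂ) j - (Pi.single k 1 : Fin N → ℂ) i) / (w j - w i)) 0 := fun i => by
      have h2 : ∀ j, HasDerivAt (fun t : ℝ => (w + Pi.single k (t : ℂ) : Fin N → ℂ) j)
          ((Pi.single k 1 : Fin N → ℂ) j) 0 := fun j => by
        by_cases hj : j = k
        · subst hj
          simpa using (Complex.ofRealCLM.hasDerivAt (x := (0 : ℝ))).const_add (w j)
        · simpa [hj] using hasDerivAt_const (0 : ℝ) (w j)
      have := hasDerivAt_prod_of_ne_zero (Finset.Ioi i)
        (f := fun j t => (w + Pi.single k (t : ℂ) : Fin N → ℂ) j - (w + Pi.single k (t : ℂ) : Fin N → ℂ) i)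
        (t := 0) (fun j _ => (h2 j).fun_sub (h2 i)) (fun j hj => by simpa using hne i j hj)
      simpa using this
    have := hasDerivAt_prod_of_ne_zero Finset.univ (t := 0) (fun i _ => h1 i)
      (fun i _ => by simpa using Finset.prod_ne_zero_iff.2 (hne i))
    simp only [vdm, det_vandermonde]
    refine this.congr_deriv ?_
    simp only [Complex.ofReal_zero, Pi.single_zero, add_zero]
    congr 1
    refine Finset.sum_congr rfl fun i _ => ?_
    rw [mul_div_cancel_left₀ _ (Finset.prod_ne_zero_iff.2 (hne i))]
  simp_rw [hd, mul_assoc, ← Finset.mul_sum, neg_mul, ← mul_neg]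
  congr 1
  simp_rw [Finset.sum_mul]
  rw [Finset.sum_comm, ← Finset.sum_neg_distrib]
  refine Finset.sum_congr rfl fun i _ => ?_
  rw [Finset.sum_comm, ← Finset.sum_neg_distrib]
  refine Finset.sum_congr rfl fun j hj => ?_
  have : ∑ k, ((Pi.single k 1 : Fin N → ℂ) j - (Pi.single k 1 : Fin N → ℂ) i) / (w j - w i) * T k =
      (T j - T i) / (w j - w i) := by
    simp_rw [div_mul_eq_mul_div, ← Finset.sum_div, sub_mul, Finset.sum_sub_distrib]
    simp [Pi.single_apply]
  rw [this, ← neg_sub (T i), hTS i j]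
  have := hne i j hj
  field_simp
  ring

variable {κ : Type*} [Fintype κ]

/-- The previous identity with `T k = ∑ i, (w k - a i)⁻¹`, whose difference quotients are explicit.
Both sides are continuous in `w`, so coinciding points are reached as a limit. -/
theorem sum_vdm₁_mul_inv_sub {w : Fin N → ℂ} {a : κ → ℂ} (hwa : ∀ k i, w k ≠ a i) :
    ∑ k, vdm₁ k w * ∑ i, (w k - a i)⁻¹ =
      - vdm w * ∑ k, ∑ l ∈ Finset.Ioi k, ∑ i, (w k - a i)⁻¹ * (w l - a i)⁻¹ := by
  let W : ℝ → Fin N → ℂ := fun t k => w k + t * (k : ℕ)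
  have hW0 : W 0 = w := by ext; simp [W]
  have hWc : Continuous W := by fun_prop
  have hWk : ∀ k, Continuous fun t => W t k := fun k => by fun_prop
  have hinv : ∀ k i, ContinuousAt (fun t => (W t k - a i)⁻¹) 0 := fun k i =>
    ((hWk k).continuousAt.sub continuousAt_const).inv₀ (by
      simpa [W] using sub_ne_zero.2 (hwa k i))
  have h1 : ContinuousAt (fun t => ∑ k, vdm₁ k (W t) * ∑ i, (W t k - a i)⁻¹) 0 := by
    have := fun k => ((continuous_vdm₁ (N := N) k).comp hWc).continuousAt (x := (0 : ℝ))
    simp only [Function.comp_def] at this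
    fun_prop
  have h2 : ContinuousAt (fun t => - vdm (W t) * ∑ k, ∑ l ∈ Finset.Ioi k, ∑ i,
      (W t k - a i)⁻¹ * (W t l - a i)⁻¹) 0 := by
    have := (continuous_vdm.comp hWc).continuousAt (x := (0 : ℝ))
    simp only [Function.comp_def] at this
    fun_prop
  have hev : ∀ᶠ t in nhdsWithin (0 : ℝ) {0}ᶜ,
      ∑ k, vdm₁ k (W t) * ∑ i, (W t k - a i)⁻¹ = - vdm (W t) * ∑ k, ∑ l ∈ Finset.Ioi k, ∑ i,
      (W t k - a i)⁻¹ * (W t l - a i)⁻¹ := by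
    have hne : ∀ᶠ t in nhdsWithin (0 : ℝ) {0}ᶜ, ∀ k i, W t k - a i ≠ 0 := by
      refine Filter.Eventually.filter_mono nhdsWithin_le_nhds
        (Filter.eventually_all.2 fun k => Filter.eventually_all.2 fun i => ?_)
      refine ((hWk k).continuousAt.sub continuousAt_const).eventually_ne ?_
      simpa [W] using sub_ne_zero.2 (hwa k i)
    filter_upwards [hne, eventually_injective_add_mul w (fun k : Fin N => ((k : ℕ) : ℂ))
      (fun i j h => Fin.ext (by simpa using h))] with t ht hinj
    refine sum_vdm₁_mul_of_injective hinj fun k l => ?_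
    rw [Finset.mul_sum, ← Finset.sum_sub_distrib]
    refine Finset.sum_congr rfl fun i _ => ?_
    have hk := ht k i
    have hl := ht l i
    simp only [W] at hk hl ⊢
    field_simp
    ring
  have := tendsto_nhds_unique_of_eventuallyEq (h1.tendsto.mono_left nhdsWithin_le_nhds)
    (h2.tendsto.mono_left nhdsWithin_le_nhds) hev
  simpa only [hW0] using this

theorem sum_Ioi_add_sum_diag {M : Type*} [AddCommMonoid M] (S : Fin N → Fin N → M)
    (hS : ∀ k l, S k l = S l k) :
    2 • (∑ k, ∑ l ∈ Finset.Ioi k, S k l) + ∑ k, S k k = ∑ k, ∑ l, S k l := by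
  have h := Finset.sum_sum_Ioi_add_eq_sum_sum_off_diag S
  have h2 : ∑ k, ∑ l ∈ Finset.Ioi k, (S l k + S k l) = 2 • (∑ k, ∑ l ∈ Finset.Ioi k, S k l) := by
    simp_rw [hS _ _, ← two_nsmul, Finset.sum_nsmul]
  rw [← h2, h, ← Finset.sum_add_distrib]
  refine Finset.sum_congr rfl fun k _ => ?_
  rw [← Finset.sum_compl_add_sum {k}]
  simp [hS _ k]

/-- The product of Cauchy kernels `∏ (w k - a i)⁻¹`. -/
noncomputable def cauchyProd (w : Fin N → ℂ) (a : κ → ℂ) : ℂ := ∏ k, ∏ i, (w k - a i)⁻¹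

/-- The symmetric sum that arises as the Laplacian of a product of Cauchy kernels. -/
noncomputable def cauchySum {ι : Type*} [Fintype ι] (w : ι → ℂ) (a : κ → ℂ) : ℂ :=
  ∑ k, ∑ l, ∑ i, (w k - a i)⁻¹ * (w l - a i)⁻¹ + ∑ k, (∑ i, (w k - a i)⁻¹) ^ 2

theorem sum_sum_sum_inv_sub {ι : Type*} [Fintype ι] (w : ι → ℂ) (a : κ → ℂ) :
    ∑ k, ∑ l, ∑ i, (w k - a i)⁻¹ * (w l - a i)⁻¹ = ∑ i, (∑ k, (a i - w k)⁻¹) ^ 2 := by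
  have : ∀ i k, (a i - w k)⁻¹ = -(w k - a i)⁻¹ := fun i k => by rw [← inv_neg, neg_sub]
  simp_rw [this, Finset.sum_neg_distrib, neg_sq, sq, Finset.sum_mul_sum]
  rw [Finset.sum_comm_cycle]

/-- Summing over `k` and `l` first turns the triple sum into a sum of squares, which is the second
term with the roles exchanged. This symmetry makes the Laplacians in the spectral parameters and in
the eigenvalues agree. -/
theorem cauchySum_comm {ι : Type*} [Fintype ι] (w : ι → ℂ) (a : κ → ℂ) :
    cauchySum w a = cauchySum a w := by
  rw [cauchySum, cauchySum, sum_sum_sum_inv_sub, sum_sum_sum_inv_sub, add_comm]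

theorem hasDerivAt_inv_sub {b a : ℂ} (h : b ≠ a) :
    HasDerivAt (fun t : ℝ => (b + (t : ℂ) - a)⁻¹) (-((b - a)⁻¹ * (b - a)⁻¹)) 0 := by
  have hb := sub_ne_zero.2 h
  have := (((Complex.ofRealCLM.hasDerivAt (x := (0 : ℝ))).const_add b).sub_const a).fun_inv
    (by simpa using hb)
  refine this.congr_deriv ?_
  simp
  field_simp

theorem hasDerivAt_cauchyProd {w : Fin N → ℂ} {a : κ → ℂ} (hwa : ∀ k i, w k ≠ a i) (k : Fin N) :
    HasDerivAt (fun t : ℝ => cauchyProd (w + Pi.single k (t : ℂ)) a)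
      (-(∑ i, (w k - a i)⁻¹) * cauchyProd w a) 0 := by
  have hne : ∀ j, ∏ i, (w j - a i)⁻¹ ≠ 0 := fun j =>
    Finset.prod_ne_zero_iff.2 fun i _ => inv_ne_zero (sub_ne_zero.2 (hwa j i))
  have h1 : ∀ j, HasDerivAt (fun t : ℝ => ∏ i, ((w + Pi.single k (t : ℂ) : Fin N → ℂ) j - a i)⁻¹)
      (if j = k then (∏ i, (w j - a i)⁻¹) * -(∑ i, (w k - a i)⁻¹) else 0) 0 := fun j => by
    split_ifs with hj
    · subst hj
      have := hasDerivAt_prod_of_ne_zero (t := 0) Finset.univ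
        (fun i _ => hasDerivAt_inv_sub (hwa j i))
        (fun i _ => by simpa using sub_ne_zero.2 (hwa j i))
      simp only [Pi.add_apply, Pi.single_eq_same]
      refine this.congr_deriv ?_
      simp only [Complex.ofReal_zero, add_zero]
      rw [← Finset.sum_neg_distrib]
      congr 1
      refine Finset.sum_congr rfl fun i _ => ?_
      have := sub_ne_zero.2 (hwa j i)
      field_simp
    · simpa [hj] using hasDerivAt_const (0 : ℝ) (∏ i, (w j - a i)⁻¹)
  have := hasDerivAt_prod_of_ne_zero (t := 0) Finset.univ (fun j _ => h1 j)
    (fun j _ => by simpa using hne j)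
  refine this.congr_deriv ?_
  simp only [Complex.ofReal_zero, Pi.single_zero, add_zero, ite_div, zero_div,
    Finset.sum_ite_eq', Finset.mem_univ, if_true]
  rw [mul_div_cancel_left₀ _ (hne k), mul_comm, cauchyProd]

/-- First partial derivatives of `vdm w * cauchyProd w a`. -/
noncomputable def vdmCauchy₁ (a : κ → ℂ) (k : Fin N) (w : Fin N → ℂ) : ℂ :=
  (vdm₁ k w - (∑ i, (w k - a i)⁻¹) * vdm w) * cauchyProd w a

/-- Second unmixed partial derivatives of `vdm w * cauchyProd w a`. -/
noncomputable def vdmCauchy₂ (a : κ → ℂ) (k : Fin N) (w : Fin N → ℂ) : ℂ :=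
  (vdm₂ k w - 2 * (∑ i, (w k - a i)⁻¹) * vdm₁ k w +
    ((∑ i, (w k - a i)⁻¹) ^ 2 + ∑ i, (w k - a i)⁻¹ * (w k - a i)⁻¹) * vdm w) * cauchyProd w a

theorem hasDerivAt_vdm_mul_cauchyProd {w : Fin N → ℂ} {a : κ → ℂ} (hwa : ∀ k i, w k ≠ a i)
    (k : Fin N) :
    HasDerivAt (fun t : ℝ => vdm (w + Pi.single k (t : ℂ)) * cauchyProd (w + Pi.single k (t : ℂ)) a)
      (vdmCauchy₁ a k w) 0 := by
  refine ((hasDerivAt_vdm w k).fun_mul (hasDerivAt_cauchyProd hwa k)).congr_deriv ?_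
  simp [vdmCauchy₁]
  ring

theorem hasDerivAt_vdmCauchy₁ {w : Fin N → ℂ} {a : κ → ℂ} (hwa : ∀ k i, w k ≠ a i)
    (k : Fin N) :
    HasDerivAt (fun t : ℝ => vdmCauchy₁ a k (w + Pi.single k (t : ℂ))) (vdmCauchy₂ a k w) 0 := by
  have hb : HasDerivAt (fun t : ℝ => ∑ i, ((w + Pi.single k (t : ℂ) : Fin N → ℂ) k - a i)⁻¹)
      (∑ i, -((w k - a i)⁻¹ * (w k - a i)⁻¹)) 0 := by
    simp only [Pi.add_apply, Pi.single_eq_same]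
    exact HasDerivAt.fun_sum fun i _ => hasDerivAt_inv_sub (hwa k i)
  refine (((hasDerivAt_vdm₁ w k).fun_sub (hb.fun_mul (hasDerivAt_vdm w k))).fun_mul
    (hasDerivAt_cauchyProd hwa k)).congr_deriv ?_
  simp only [vdmCauchy₂, Complex.ofReal_zero, Pi.single_zero, add_zero, Finset.sum_neg_distrib]
  ring

/-- In the product rule the term with `vdm₂` vanishes by harmonicity, and the cross term supplies
the off-diagonal part of the double sum in `cauchySum`. The second derivative of the Cauchy product
supplies the diagonal part and the squares. -/
theorem sum_vdmCauchy₂ {w : Fin N → ℂ} {a : κ → ℂ} (hwa : ∀ k i, w k ≠ a i) :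
    ∑ k, vdmCauchy₂ a k w = vdm w * cauchyProd w a * cauchySum w a := by
  have h := sum_Ioi_add_sum_diag (fun k l => ∑ i, (w k - a i)⁻¹ * (w l - a i)⁻¹)
    (fun k l => by simp_rw [mul_comm])
  have h1 := sum_vdm₁_mul_inv_sub hwa
  unfold vdmCauchy₂ cauchySum
  rw [← Finset.sum_mul, Finset.sum_add_distrib, Finset.sum_sub_distrib, sum_vdm₂, ← Finset.sum_mul,
    Finset.sum_add_distrib, ← h]
  have h2 : ∑ k, 2 * (∑ i, (w k - a i)⁻¹) * vdm₁ k w =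
      2 * ∑ k, vdm₁ k w * ∑ i, (w k - a i)⁻¹ := by
    rw [Finset.mul_sum]
    exact Finset.sum_congr rfl fun k _ => by ring
  rw [h2, h1]
  simp only [nsmul_eq_mul]
  push_cast
  ring

end Vandermonde

/-! ### Resolvents and reciprocal characteristic determinants -/

section Resolvent

open Matrix

variable {n : ℕ}

local notation "Mat" n => Matrix (Fin n) (Fin n) ℂ

/-- Jacobi's formula: factor out `A` and use `det (1 + x B) = 1 + x tr B + O(x²)`, where the
remainder is the polynomial `p` times `x²`. -/
theorem Matrix.hasDerivAt_det_sub_smul {A E : Matrix (Fin n) (Fin n) ℂ} (hA : IsUnit A.det) :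
    HasDerivAt (fun t : ℝ => (A - (t : ℂ) • E).det) (-(A.det * (A⁻¹ * E).trace)) 0 := by
  set p := (det (1 + (Polynomial.X : Polynomial ℂ) • (A⁻¹ * E).map Polynomial.C)).divX.divX with hp
  have h : ∀ t : ℝ, (A - (t : ℂ) • E).det =
      A.det * (1 + (A⁻¹ * E).trace * -(t : ℂ) + p.eval (-(t : ℂ)) * (-(t : ℂ)) ^ 2) := fun t => by
    rw [hp, ← det_one_add_smul, ← det_mul, mul_add, mul_one, mul_smul_comm,
      mul_nonsing_inv_cancel_left _ _ hA, neg_smul, sub_eq_add_neg]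
  simp only [h]
  have ht : HasDerivAt (fun t : ℝ => -(t : ℂ)) (-1) 0 :=
    (Complex.ofRealCLM.hasDerivAt (x := (0 : ℝ))).neg
  have hpd : HasDerivAt (fun t : ℝ => p.eval (-(t : ℂ))) (p.derivative.eval (-((0 : ℝ) : ℂ)) * -1) 0 :=
    HasDerivAt.comp (h := fun t : ℝ => -(t : ℂ)) (0 : ℝ) (p.hasDerivAt (-((0 : ℝ) : ℂ))) ht
  have := ((((ht.const_mul (A⁻¹ * E).trace).const_add 1).fun_add (hpd.fun_mul (ht.fun_pow 2))).const_mul A.det)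
  refine this.congr_deriv ?_
  simp

/-- The resolvent of a matrix. -/
noncomputable def resolventMatrix (u : ℂ) (M : Mat n) : Mat n := (scalar (Fin n) u - M)⁻¹

theorem IsHermitian.scalar_sub_eq {M : Mat n} (hM : M.IsHermitian) (u : ℂ) :
    scalar (Fin n) u - M = (hM.eigenvectorUnitary : Mat n) *
      diagonal (fun i => u - hM.eigenvalues i) * star (hM.eigenvectorUnitary : Mat n) := by
  have h := hM.spectral_theorem
  rw [Unitary.conjStarAlgAut_apply] at h
  have h1 : diagonal (fun i => u - (hM.eigenvalues i : ℂ)) =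
      scalar (Fin n) u - diagonal (RCLike.ofReal ∘ hM.eigenvalues : Fin n → ℂ) := by
    ext i j
    by_cases hij : i = j
    · subst hij; simp
    · simp [hij]
  have h2 : scalar (Fin n) u = (hM.eigenvectorUnitary : Mat n) * scalar (Fin n) u *
      star (hM.eigenvectorUnitary : Mat n) := by
    rw [← (scalar_commute u (fun r' => mul_comm _ _) (hM.eigenvectorUnitary : Mat n)).eq, mul_assoc]
    simp
  rw [h1, mul_sub, sub_mul, ← h2]
  congr 1

theorem sub_ofReal_ne_zero {u : ℂ} (hu : u.im ≠ 0) (a : ℝ) : u - a ≠ 0 := fun h => by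
  have := congrArg Complex.im h
  simp at this
  exact hu this

theorem IsHermitian.det_scalar_sub {M : Mat n} (hM : M.IsHermitian) (u : ℂ) :
    (scalar (Fin n) u - M).det = ∏ i, (u - hM.eigenvalues i) := by
  rw [IsHermitian.scalar_sub_eq hM, det_mul_right_comm]
  simp

theorem IsHermitian.det_scalar_sub_ne_zero {M : Mat n} (hM : M.IsHermitian) {u : ℂ} (hu : u.im ≠ 0) :
    (scalar (Fin n) u - M).det ≠ 0 := by
  rw [IsHermitian.det_scalar_sub hM]
  exact Finset.prod_ne_zero_iff.2 fun i _ => sub_ofReal_ne_zero hu _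

theorem IsHermitian.resolventMatrix_eq {M : Mat n} (hM : M.IsHermitian) {u : ℂ} (hu : u.im ≠ 0) :
    resolventMatrix u M = (hM.eigenvectorUnitary : Mat n) *
      diagonal (fun i => (u - hM.eigenvalues i : ℂ)⁻¹) * star (hM.eigenvectorUnitary : Mat n) := by
  refine inv_eq_right_inv ?_
  rw [IsHermitian.scalar_sub_eq hM]
  have h : ∀ U D D' : Mat n, star U * U = 1 → D * D' = 1 → U * star U = 1 →
      U * D * star U * (U * D' * star U) = 1 := fun U D D' h1 h2 h3 => by
    calc U * D * star U * (U * D' * star U) = U * D * (star U * U) * D' * star U := by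
          simp only [mul_assoc]
      _ = U * (D * D') * star U := by rw [h1]; simp only [mul_assoc, mul_one]
      _ = 1 := by rw [h2, mul_one, h3]
  refine h _ _ _ (by simp) ?_ (by simp)
  rw [diagonal_mul_diagonal, ← diagonal_one]
  congr 1
  ext i
  exact mul_inv_cancel₀ (sub_ofReal_ne_zero hu _)

theorem IsHermitian.trace_resolventMatrix {M : Mat n} (hM : M.IsHermitian) {u : ℂ} (hu : u.im ≠ 0) :
    (resolventMatrix u M).trace = ∑ i, (u - hM.eigenvalues i : ℂ)⁻¹ := by
  rw [IsHermitian.resolventMatrix_eq hM hu, trace_mul_comm, ← mul_assoc]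
  simp [trace]

theorem IsHermitian.trace_resolventMatrix_mul {M : Mat n} (hM : M.IsHermitian) {u v : ℂ}
    (hu : u.im ≠ 0) (hv : v.im ≠ 0) :
    (resolventMatrix u M * resolventMatrix v M).trace =
      ∑ i, (u - hM.eigenvalues i : ℂ)⁻¹ * (v - hM.eigenvalues i : ℂ)⁻¹ := by
  rw [IsHermitian.resolventMatrix_eq hM hu, IsHermitian.resolventMatrix_eq hM hv]
  have h : ∀ U D D' : Mat n, star U * U = 1 →
      (U * D * star U * (U * D' * star U)).trace = (D * D').trace := fun U D D' h1 => by
    calc (U * D * star U * (U * D' * star U)).trace = (U * (D * (star U * U) * D' * star U)).trace := by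
          simp only [mul_assoc]
      _ = (D * D' * (star U * U)).trace := by
          rw [trace_mul_comm, h1]
          simp only [mul_assoc, mul_one, h1]
      _ = _ := by rw [h1, mul_one]
  rw [h _ _ _ (by simp)]
  simp [trace]

theorem norm_inv_sub_ofReal_le {u : ℂ} (hu : u.im ≠ 0) (a : ℝ) : ‖(u - a)⁻¹‖ ≤ |u.im|⁻¹ := by
  rw [norm_inv]
  refine inv_anti₀ (abs_pos.2 hu) ?_
  simpa using Complex.abs_im_le_norm (u - a)

/-- In the spectral decomposition the unitary entries are at most one and each reciprocal eigenvalue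
of `u - M` is at most `|u.im|⁻¹`. The bound is uniform over Hermitian `M`, which yields the growth
conditions. -/
theorem IsHermitian.norm_resolventMatrix_apply_le {M : Mat n} (hM : M.IsHermitian) {u : ℂ}
    (hu : u.im ≠ 0) (i j : Fin n) : ‖resolventMatrix u M i j‖ ≤ n * |u.im|⁻¹ := by
  rw [IsHermitian.resolventMatrix_eq hM hu, mul_apply]
  refine (norm_sum_le _ _).trans ((Finset.sum_le_card_nsmul _ _ (|u.im|⁻¹) fun l _ => ?_).trans
    (by simp))
  have h1 := entry_norm_bound_of_unitary hM.eigenvectorUnitary.2 i l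
  have h2 := entry_norm_bound_of_unitary hM.eigenvectorUnitary.2 j l
  rw [mul_diagonal, norm_mul, norm_mul, star_apply, norm_star]
  calc _ ≤ 1 * |u.im|⁻¹ * 1 := by
        gcongr
        exact norm_inv_sub_ofReal_le hu _
    _ = _ := by ring

theorem norm_mul_apply_le {A B : Mat n} {a b : ℝ} (hA : ∀ i j, ‖A i j‖ ≤ a)
    (hB : ∀ i j, ‖B i j‖ ≤ b) (i j : Fin n) : ‖(A * B) i j‖ ≤ n * (a * b) := by
  rw [mul_apply]
  refine (norm_sum_le _ _).trans ((Finset.sum_le_card_nsmul _ _ (a * b) fun l _ => ?_).trans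
    (by simp))
  rw [norm_mul]
  exact mul_le_mul (hA _ _) (hB _ _) (norm_nonneg _) ((norm_nonneg _).trans (hA i l))

theorem norm_trace_le {A : Mat n} {a : ℝ} (hA : ∀ i j, ‖A i j‖ ≤ a) : ‖A.trace‖ ≤ n * a :=
  (norm_sum_le _ _).trans ((Finset.sum_le_card_nsmul _ _ a fun l _ => hA l l).trans (by simp))

theorem continuousAt_nonsing_inv {X : Type*} [TopologicalSpace X] {f : X → Mat n} {x : X}
    (hf : ContinuousAt f x) (h : (f x).det ≠ 0) : ContinuousAt (fun y => (f y)⁻¹) x := by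
  simp_rw [inv_def, Ring.inverse_eq_inv']
  have hd : ContinuousAt (fun y => (f y).det) x :=
    (Continuous.matrix_det continuous_id).continuousAt.comp hf
  have ha : ContinuousAt (fun y => (f y).adjugate) x :=
    (Continuous.matrix_adjugate continuous_id).continuousAt.comp hf
  exact (hd.inv₀ h).smul ha

theorem add_smul_isHermitian {M E : Mat n} (hM : M.IsHermitian) (hE : E.IsHermitian) (t : ℝ) :
    (M + (t : ℂ) • E).IsHermitian := by
  refine hM.add ?_
  rw [IsHermitian, conjTranspose_smul, hE.eq]
  simp

/-- By the resolvent identity `R_t - R_0 = t R_t E R_0`, the slope is the trace of `R_t E R_0 E`.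
Continuity of `R_t` at `t = 0` then gives the limit. -/
theorem hasDerivAt_trace_resolventMatrix_mul {M E : Mat n} (hM : M.IsHermitian)
    (hE : E.IsHermitian) {u : ℂ} (hu : u.im ≠ 0) :
    HasDerivAt (fun t : ℝ => (resolventMatrix u (M + (t : ℂ) • E) * E).trace)
      (resolventMatrix u M * E * resolventMatrix u M * E).trace 0 := by
  have hdet : ∀ t : ℝ, IsUnit (scalar (Fin n) u - (M + (t : ℂ) • E)).det := fun t =>
    (IsHermitian.det_scalar_sub_ne_zero (add_smul_isHermitian hM hE t) hu).isUnit
  have hdet0 : IsUnit (scalar (Fin n) u - M).det :=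
    (IsHermitian.det_scalar_sub_ne_zero hM hu).isUnit
  have hdiff : ∀ t : ℝ, resolventMatrix u (M + (t : ℂ) • E) - resolventMatrix u M =
      (t : ℂ) • (resolventMatrix u (M + (t : ℂ) • E) * E * resolventMatrix u M) := fun t => by
    have h1 : ∀ X Y F : Mat n, IsUnit X.det → IsUnit Y.det → F = X - Y →
        Y⁻¹ - X⁻¹ = Y⁻¹ * F * X⁻¹ := fun X Y F hX hY h => by
      rw [h, mul_sub, sub_mul, nonsing_inv_mul _ hY, one_mul, mul_assoc, mul_nonsing_inv _ hX,
        mul_one]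
    rw [← smul_mul_assoc, ← mul_smul_comm]
    exact h1 _ _ _ hdet0 (hdet t) (by abel)
  rw [hasDerivAt_iff_tendsto_slope]
  have hcont : ContinuousAt (fun t : ℝ =>
      (resolventMatrix u (M + (t : ℂ) • E) * E * resolventMatrix u M * E).trace) 0 := by
    have h2 : ContinuousAt (fun t : ℝ => resolventMatrix u (M + (t : ℂ) • E)) 0 :=
      continuousAt_nonsing_inv (continuousAt_const.sub (continuousAt_const.add
        (Complex.continuous_ofReal.continuousAt.smul continuousAt_const))) (hdet 0).ne_zero
    have h3 : Continuous fun R : Mat n => (R * E * resolventMatrix u M * E).trace :=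
      (((continuous_id.matrix_mul continuous_const).matrix_mul continuous_const).matrix_mul
        continuous_const).matrix_trace
    exact ContinuousAt.comp (g := fun R : Mat n => (R * E * resolventMatrix u M * E).trace)
      h3.continuousAt h2
  have h4 := hcont.tendsto.mono_left (nhdsWithin_le_nhds (s := {0}ᶜ))
  simp only [Complex.ofReal_zero, zero_smul, add_zero] at h4
  refine h4.congr' ?_
  filter_upwards [self_mem_nhdsWithin] with t ht
  have ht' : (t : ℂ) ≠ 0 := by simpa using ht
  rw [slope_def_module, ← trace_sub, ← sub_mul]
  simp only [Complex.ofReal_zero, zero_smul, add_zero, sub_zero]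
  rw [hdiff, smul_mul_assoc, trace_smul, Complex.real_smul, smul_eq_mul, ← mul_assoc]
  simp [ht']

variable {N : ℕ}

/-- The product of reciprocal characteristic determinants. -/
noncomputable def resProd (w : Fin N → ℂ) (M : Mat n) : ℂ :=
  ∏ k, ((scalar (Fin n) (w k) - M).det)⁻¹

/-- First derivative of `resProd` in the direction `E`. -/
noncomputable def resProd₁ (w : Fin N → ℂ) (E M : Mat n) : ℂ :=
  (∑ k, (resolventMatrix (w k) M * E).trace) * resProd w M

/-- Second derivative of `resProd` in the direction `E`. -/
noncomputable def resProd₂ (w : Fin N → ℂ) (E M : Mat n) : ℂ :=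
  ((∑ k, (resolventMatrix (w k) M * E).trace) ^ 2 +
    ∑ k, (resolventMatrix (w k) M * E * resolventMatrix (w k) M * E).trace) * resProd w M

theorem IsHermitian.resProd_eq {M : Mat n} (hM : M.IsHermitian) (w : Fin N → ℂ) :
    resProd w M = cauchyProd w (fun i => (hM.eigenvalues i : ℂ)) := by
  simp_rw [resProd, IsHermitian.det_scalar_sub hM, cauchyProd, Finset.prod_inv_distrib]

theorem hasDerivAt_resProd {M : Mat n} (hM : M.IsHermitian) (E : Mat n)
    {w : Fin N → ℂ} (hw : ∀ k, (w k).im ≠ 0) :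
    HasDerivAt (fun t : ℝ => resProd w (M + (t : ℂ) • E)) (resProd₁ w E M) 0 := by
  have hdet : ∀ k, (scalar (Fin n) (w k) - M).det ≠ 0 := fun k =>
    IsHermitian.det_scalar_sub_ne_zero hM (hw k)
  have h1 : ∀ k, HasDerivAt (fun t : ℝ => ((scalar (Fin n) (w k) - (M + (t : ℂ) • E)).det)⁻¹)
      (((scalar (Fin n) (w k) - M).det)⁻¹ * (resolventMatrix (w k) M * E).trace) 0 := fun k => by
    have := (hasDerivAt_det_sub_smul (E := E) (hdet k).isUnit).fun_inv (by simpa using hdet k)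
    simp_rw [← sub_sub]
    refine this.congr_deriv ?_
    have := hdet k
    simp only [Complex.ofReal_zero, zero_smul, sub_zero, resolventMatrix]
    field_simp
  have := hasDerivAt_prod_of_ne_zero (t := 0) Finset.univ (fun k _ => h1 k)
    (fun k _ => by simpa using hdet k)
  refine this.congr_deriv ?_
  simp only [Complex.ofReal_zero, zero_smul, add_zero, resProd₁, resProd]
  rw [mul_comm]
  congr 1
  refine Finset.sum_congr rfl fun k _ => ?_
  rw [mul_div_cancel_left₀ _ (inv_ne_zero (hdet k))]

theorem hasDerivAt_resProd₁ {M E : Mat n} (hM : M.IsHermitian) (hE : E.IsHermitian)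
    {w : Fin N → ℂ} (hw : ∀ k, (w k).im ≠ 0) :
    HasDerivAt (fun t : ℝ => resProd₁ w E (M + (t : ℂ) • E)) (resProd₂ w E M) 0 := by
  refine ((HasDerivAt.fun_sum (u := Finset.univ) fun k _ =>
    hasDerivAt_trace_resolventMatrix_mul hM hE (hw k)).fun_mul
    (hasDerivAt_resProd hM E hw)).congr_deriv ?_
  simp only [Complex.ofReal_zero, zero_smul, add_zero, resProd₂, resProd₁]
  ring

end Resolvent

/-! ### Orthonormal coordinates on Hermitian matrices -/

section HermParam

open Matrix Complex

variable {n : ℕ}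

/-- Parametrization of Hermitian matrices by real square matrices; it is isometric for the
Hilbert–Schmidt norms. -/
noncomputable def hermParam (ξ : Fin n × Fin n → ℝ) : Matrix (Fin n) (Fin n) ℂ :=
  of fun j k => ((1 + I) * ξ (j, k) + (1 - I) * ξ (k, j)) / 2

theorem hermParam_apply (ξ : Fin n × Fin n → ℝ) (j k : Fin n) :
    hermParam ξ j k = ((1 + I) * ξ (j, k) + (1 - I) * ξ (k, j)) / 2 := rfl

theorem hermParam_isHermitian (ξ : Fin n × Fin n → ℝ) : (hermParam ξ).IsHermitian := by
  ext j k
  simp only [conjTranspose_apply, hermParam_apply, star_def, map_div₀, map_add, map_mul, map_sub,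
    map_one, conj_I, conj_ofReal, map_ofNat]
  ring

theorem hermParam_add_smul (ξ η : Fin n × Fin n → ℝ) (t : ℝ) :
    hermParam (ξ + t • η) = hermParam ξ + (t : ℂ) • hermParam η := by
  ext j k
  simp only [hermParam_apply, Pi.add_apply, Pi.smul_apply, smul_eq_mul, Matrix.add_apply,
    Matrix.smul_apply]
  push_cast
  ring

/-- An entry has real part `(ξ (j, k) + ξ (k, j)) / 2` and imaginary part `(ξ (j, k) - ξ (k, j)) /
2`, so its squared modulus is the average of two squared coordinates. In these coordinates the GUE
weight is therefore the standard `gaussWeight`. -/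
theorem trace_hermParam_sq (ξ : Fin n × Fin n → ℝ) :
    (hermParam ξ * hermParam ξ).trace = ((∑ p, ξ p ^ 2 : ℝ) : ℂ) := by
  have h : (hermParam ξ * hermParam ξ).trace =
      ∑ j, ∑ k, (1 / 2 * (ξ (j, k) : ℂ) ^ 2 + 1 / 2 * (ξ (k, j) : ℂ) ^ 2) := by
    simp only [trace, diag_apply, mul_apply, hermParam_apply]
    refine Finset.sum_congr rfl fun j _ => Finset.sum_congr rfl fun k _ => ?_
    linear_combination (1 / 2 * (ξ (j, k) : ℂ) * ξ (k, j) -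
      1 / 4 * ((ξ (j, k) : ℂ) ^ 2 + (ξ (k, j) : ℂ) ^ 2)) * I_sq
  rw [h, Fintype.sum_prod_type]
  push_cast
  simp only [Finset.sum_add_distrib, ← Finset.mul_sum]
  rw [Finset.sum_comm (f := fun j k => (ξ (k, j) : ℂ) ^ 2)]
  ring

theorem hermParam_single (p : Fin n × Fin n) : hermParam (Pi.single p 1) =
    ((1 + I) / 2) • Matrix.single p.1 p.2 (1 : ℂ) + ((1 - I) / 2) • Matrix.single p.2 p.1 (1 : ℂ) := by
  ext j k
  obtain ⟨a, b⟩ := p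
  simp only [hermParam_apply, Pi.single_apply, Prod.mk.injEq, Matrix.add_apply, Matrix.smul_apply,
    Matrix.single_apply, smul_eq_mul]
  have h1 : (a = j ∧ b = k) ↔ (j = a ∧ k = b) := by simp [eq_comm]
  have h2 : (b = j ∧ a = k) ↔ (k = a ∧ j = b) := by simp [eq_comm, and_comm]
  simp only [h1, h2]
  split_ifs <;> push_cast <;> ring

theorem norm_hermParam_single_apply_le (p : Fin n × Fin n) (j k : Fin n) :
    ‖hermParam (Pi.single p 1) j k‖ ≤ 2 := by
  have h1 : ∀ q : Fin n × Fin n, ‖((Pi.single p 1 : Fin n × Fin n → ℝ) q : ℂ)‖ ≤ 1 := fun q => by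
    rw [Pi.single_apply]; split_ifs <;> simp
  have h2 : ‖(1 + I : ℂ)‖ ≤ 2 := (norm_add_le _ _).trans (by norm_num)
  have h3 : ‖(1 - I : ℂ)‖ ≤ 2 := (norm_sub_le _ _).trans (by norm_num)
  rw [hermParam_apply, norm_div]
  have : ‖(1 + I) * ((Pi.single p 1 : Fin n × Fin n → ℝ) (j, k) : ℂ) +
      (1 - I) * ((Pi.single p 1 : Fin n × Fin n → ℝ) (k, j) : ℂ)‖ ≤ 2 * 1 + 2 * 1 := by
    refine (norm_add_le _ _).trans ?_
    rw [norm_mul, norm_mul]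
    gcongr <;> exact h1 _
  rw [div_le_iff₀ (by simp)]
  simpa using this.trans (by norm_num)

theorem trace_mul_hermParam_single (A : Matrix (Fin n) (Fin n) ℂ) (p : Fin n × Fin n) :
    (A * hermParam (Pi.single p 1)).trace = (1 + I) / 2 * A p.2 p.1 + (1 - I) / 2 * A p.1 p.2 := by
  rw [hermParam_single, mul_add, trace_add, mul_smul_comm, mul_smul_comm, trace_smul, trace_smul,
    trace_mul_single, trace_mul_single]
  simp

/-- Parseval's identity for the orthonormal basis `hermParam (Pi.single p 1)`, extended complex
bilinearly. -/
theorem sum_trace_mul_hermParam_single (A B : Matrix (Fin n) (Fin n) ℂ) :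
    ∑ p, (A * hermParam (Pi.single p 1)).trace * (B * hermParam (Pi.single p 1)).trace =
      (A * B).trace := by
  simp_rw [trace_mul_hermParam_single]
  rw [Fintype.sum_prod_type]
  have h : (A * B).trace = ∑ j, ∑ k, A j k * B k j := by simp [trace, mul_apply]
  have h2 : ∀ j k, ((1 + I) / 2 * A k j + (1 - I) / 2 * A j k) *
      ((1 + I) / 2 * B k j + (1 - I) / 2 * B j k) =
      I / 2 * (A k j * B k j) - I / 2 * (A j k * B j k) + 1 / 2 * (A j k * B k j)
        + 1 / 2 * (A k j * B j k) := fun j k => by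
    linear_combination (1 / 4 * (A k j * B k j + A j k * B j k - A j k * B k j - A k j * B j k)) * I_sq
  simp_rw [h2]
  simp only [Finset.sum_add_distrib, Finset.sum_sub_distrib, ← Finset.mul_sum]
  rw [h, Finset.sum_comm (f := fun j k => A k j * B k j), Finset.sum_comm (f := fun j k => A k j * B j k)]
  ring

/-- The other contraction of the same basis `E_p`: `∑ E_p B E_p = (tr B) 1`. -/
theorem sum_trace_mul_hermParam_single_mul (A B : Matrix (Fin n) (Fin n) ℂ) :
    ∑ p, (A * hermParam (Pi.single p 1) * B * hermParam (Pi.single p 1)).trace =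
      A.trace * B.trace := by
  have h2 : ∀ p : Fin n × Fin n, (A * hermParam (Pi.single p 1) * B * hermParam (Pi.single p 1)).trace =
      I / 2 * (A p.2 p.1 * B p.2 p.1) - I / 2 * (A p.1 p.2 * B p.1 p.2) + 1 / 2 * (A p.1 p.1 * B p.2 p.2)
        + 1 / 2 * (A p.2 p.2 * B p.1 p.1) := fun p => by
    have h3 : ∀ i j k l : Fin n, (A * Matrix.single i j 1 * (B * Matrix.single k l 1)).trace =
        A l i * B j k := fun i j k l => by
      rw [← mul_assoc, trace_mul_single, mul_apply]
      simp [mul_apply, Matrix.single_apply, ite_and]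
    rw [mul_assoc, hermParam_single]
    simp only [mul_add, add_mul, mul_smul_comm, smul_mul_assoc, trace_add, trace_smul, h3, smul_eq_mul]
    linear_combination (1 / 4 * (A p.2 p.1 * B p.2 p.1 + A p.1 p.2 * B p.1 p.2 - A p.1 p.1 * B p.2 p.2 - A p.2 p.2 * B p.1 p.1)) * I_sq
  simp_rw [h2]
  rw [Fintype.sum_prod_type]
  simp only [Finset.sum_add_distrib, Finset.sum_sub_distrib, ← Finset.mul_sum]
  rw [Finset.sum_comm (f := fun j k => A k j * B k j), Finset.sum_comm (f := fun j k => A k k * B j j)]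
  simp only [trace, diag_apply, ← Finset.mul_sum, ← Finset.sum_mul]
  ring

variable {N : ℕ}

/-- The squared gradient contracts to traces of `R(w k) R(w l)`, the derivatives of the resolvents
to squares of traces of `R(w k)`. In the eigenvalues these are the two terms of `cauchySum`. -/
theorem sum_resProd₂ {M : Matrix (Fin n) (Fin n) ℂ} (hM : M.IsHermitian) {w : Fin N → ℂ}
    (hw : ∀ k, (w k).im ≠ 0) :
    ∑ p, resProd₂ w (hermParam (Pi.single p 1)) M =
      resProd w M * cauchySum w (fun i => (hM.eigenvalues i : ℂ)) := by
  unfold resProd₂ cauchySum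
  rw [← Finset.sum_mul, mul_comm, Finset.sum_add_distrib]
  congr 2
  · simp_rw [sq, Finset.sum_mul_sum]
    rw [Finset.sum_comm]
    refine Finset.sum_congr rfl fun k _ => ?_
    rw [Finset.sum_comm]
    refine Finset.sum_congr rfl fun l _ => ?_
    rw [sum_trace_mul_hermParam_single, IsHermitian.trace_resolventMatrix_mul hM (hw k) (hw l)]
  · rw [Finset.sum_comm]
    refine Finset.sum_congr rfl fun k _ => ?_
    rw [sum_trace_mul_hermParam_single_mul, IsHermitian.trace_resolventMatrix hM (hw k), sq]

end HermParam

/-! ### Growth and smoothness of the test functions -/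

section Growth

variable {E : Type*} [SeminormedAddCommGroup E] {n N : ℕ}

theorem polyGrowth_det {m : Type*} [Fintype m] [DecidableEq m] {A : E → Matrix m m ℂ}
    (hA : ∀ i j, PolyGrowth fun x => A x i j) : PolyGrowth fun x => (A x).det := by
  simp_rw [Matrix.det_apply']
  exact .sum _ fun σ _ => (PolyGrowth.const _).mul (.prod _ fun i _ => hA _ _)

variable {w : E → Fin N → ℂ}

theorem PolyGrowth.vdm (hw : ∀ k, PolyGrowth fun x => w x k) : PolyGrowth fun x => vdm (w x) :=
  polyGrowth_det fun i j => (hw i).pow j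

theorem polyGrowth_det_updateRow_vandermonde (hw : ∀ k, PolyGrowth fun x => w x k) (k : Fin N)
    {r : E → Fin N → ℂ} (hr : ∀ i, PolyGrowth fun x => r x i) :
    PolyGrowth fun x => ((Matrix.vandermonde (w x)).updateRow k (r x)).det :=
  polyGrowth_det fun i j => by
    by_cases h : i = k
    · subst h; simpa using hr j
    · simpa [Matrix.updateRow_ne h, Matrix.vandermonde_apply] using (hw i).pow j

theorem PolyGrowth.vdm₁ (hw : ∀ k, PolyGrowth fun x => w x k) (k : Fin N) :
    PolyGrowth fun x => vdm₁ k (w x) :=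
  polyGrowth_det_updateRow_vandermonde hw k fun _ => (PolyGrowth.const _).mul ((hw k).pow _)

theorem PolyGrowth.vdm₂ (hw : ∀ k, PolyGrowth fun x => w x k) (k : Fin N) :
    PolyGrowth fun x => vdm₂ k (w x) :=
  polyGrowth_det_updateRow_vandermonde hw k fun _ =>
    (PolyGrowth.const _).mul ((PolyGrowth.const _).mul ((hw k).pow _))

variable {κ : Type*} {a : E → κ → ℂ}

/-- The points `w x` stay at a positive distance from the points `a x`. -/
def UniformlySeparated (w : E → Fin N → ℂ) (a : E → κ → ℂ) : Prop :=
  ∃ C : ℝ, ∀ x k i, ‖(w x k - a x i)⁻¹‖ ≤ C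

theorem UniformlySeparated.polyGrowth (h : UniformlySeparated w a) (k : Fin N) (i : κ) :
    PolyGrowth fun x => (w x k - a x i)⁻¹ := by
  obtain ⟨C, hC⟩ := h
  exact .of_bound C fun x => hC x k i

variable [Fintype κ]

theorem UniformlySeparated.polyGrowth_cauchyProd (h : UniformlySeparated w a) :
    PolyGrowth fun x => cauchyProd (w x) (a x) :=
  .prod _ fun k _ => .prod _ fun i _ => h.polyGrowth k i

theorem PolyGrowth.vdmCauchy₁ (hw : ∀ k, PolyGrowth fun x => w x k) (h : UniformlySeparated w a)
    (k : Fin N) : PolyGrowth fun x => vdmCauchy₁ (a x) k (w x) :=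
  ((PolyGrowth.vdm₁ hw k).sub ((PolyGrowth.sum _ fun i _ => h.polyGrowth k i).mul
    (PolyGrowth.vdm hw))).mul h.polyGrowth_cauchyProd

theorem PolyGrowth.vdmCauchy₂ (hw : ∀ k, PolyGrowth fun x => w x k) (h : UniformlySeparated w a)
    (k : Fin N) : PolyGrowth fun x => vdmCauchy₂ (a x) k (w x) := by
  have hs : PolyGrowth fun x => ∑ i, (w x k - a x i)⁻¹ := .sum _ fun i _ => h.polyGrowth k i
  refine (((PolyGrowth.vdm₂ hw k).sub (((PolyGrowth.const 2).mul hs).mul (PolyGrowth.vdm₁ hw k))).add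
    (((hs.pow 2).add (.sum _ fun i _ => (h.polyGrowth k i).mul (h.polyGrowth k i))).mul
      (PolyGrowth.vdm hw))).mul h.polyGrowth_cauchyProd

theorem contDiff_det {V : Type*} [NormedAddCommGroup V] [NormedSpace ℝ V] {m : Type*} [Fintype m]
    [DecidableEq m] {k : WithTop ℕ∞} {A : V → Matrix m m ℂ}
    (hA : ∀ i j, ContDiff ℝ k fun x => A x i j) : ContDiff ℝ k fun x => (A x).det := by
  simp_rw [Matrix.det_apply']
  exact ContDiff.sum fun σ _ => contDiff_const.mul (contDiff_prod fun i _ => hA _ _)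

theorem ContDiff.vdm {V : Type*} [NormedAddCommGroup V] [NormedSpace ℝ V] {k : WithTop ℕ∞}
    {w : V → Fin N → ℂ} (hw : ∀ i, ContDiff ℝ k fun x => w x i) :
    ContDiff ℝ k fun x => vdm (w x) :=
  contDiff_det fun i j => by
    simp only [Matrix.vandermonde_apply]
    exact (hw i).pow _

end Growth

/-! ### Coordinate shifts in the joint variable -/

section Shift

variable {A B : Type*} [DecidableEq A] [DecidableEq B]

theorem add_smul_single_inl_comp_inl (x : A ⊕ B → ℝ) (t : ℝ) (i : A) :
    (fun a => (x + t • (Pi.single (Sum.inl i) 1 : A ⊕ B → ℝ)) (.inl a)) =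
      (fun a => x (.inl a)) + t • Pi.single i 1 := by
  ext a
  simp [Pi.single_apply]

theorem add_smul_single_inl_apply_inr (x : A ⊕ B → ℝ) (t : ℝ) (i : A) (b : B) :
    (x + t • (Pi.single (Sum.inl i) 1 : A ⊕ B → ℝ)) (.inr b) = x (.inr b) := by
  simp

theorem add_smul_single_inr_apply_inl (x : A ⊕ B → ℝ) (t : ℝ) (i : B) (a : A) :
    (x + t • (Pi.single (Sum.inr i) 1 : A ⊕ B → ℝ)) (.inl a) = x (.inl a) := by
  simp

theorem add_ofReal_add_smul_single {κ : Type*} [DecidableEq κ] (z : κ → ℂ) (y : κ → ℝ) (t : ℝ) (i : κ) :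
    (fun k => z k + ((y + t • (Pi.single i 1 : κ → ℝ)) k : ℂ)) =
      (fun k => z k + (y k : ℂ)) + Pi.single i (t : ℂ) := by
  ext k
  by_cases h : k = i
  · subst h; simp [add_assoc]
  · simp [h]

theorem add_smul_single_inr_comp_inr (x : A ⊕ B → ℝ) (t : ℝ) (i : B) :
    (fun a => (x + t • (Pi.single (Sum.inr i) 1 : A ⊕ B → ℝ)) (.inr a)) =
      (fun a => x (.inr a)) + t • Pi.single i 1 := by
  ext a
  simp [Pi.single_apply]

end Shift

/-! ### From matrix noise to eigenvalue noise -/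

section Flow

variable {n N : ℕ}

theorem polyGrowth_add_coord {A : Type*} [Fintype A] {κ : Type*} (z : κ → ℂ) (e : κ → A) (k : κ) :
    PolyGrowth fun x : A → ℝ => z k + (x (e k) : ℂ) :=
  (PolyGrowth.const _).add (polyGrowth_coord _)

theorem contDiff_add_coord {A : Type*} [Fintype A] {κ : Type*} (z : κ → ℂ) (e : κ → A) (k : κ) :
    ContDiff ℝ 2 fun x : A → ℝ => z k + (x (e k) : ℂ) :=
  contDiff_const.add (Complex.ofRealCLM.contDiff.comp (contDiff_apply ℝ ℝ (e k)))

theorem exists_inv_im_bound (z : Fin N → ℂ) : ∃ C : ℝ, 0 ≤ C ∧ ∀ k, |(z k).im|⁻¹ ≤ C :=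
  ⟨∑ k, |(z k).im|⁻¹, by positivity,
    fun k => Finset.single_le_sum (f := fun k => |(z k).im|⁻¹) (fun _ _ => by positivity)
      (Finset.mem_univ k)⟩

theorem UniformlySeparated.symm {E : Type*} {m : ℕ} {w : E → Fin N → ℂ} {a : E → Fin m → ℂ}
    (h : UniformlySeparated w a) : UniformlySeparated a w := by
  obtain ⟨C, hC⟩ := h
  refine ⟨C, fun x i k => ?_⟩
  rw [norm_inv, norm_sub_rev, ← norm_inv]
  exact hC x k i

/-- Smoothing moves the spectral parameters only by real amounts, so their distance to the real
axis, and hence to any eigenvalue, never changes. -/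
theorem uniformlySeparated_of_im {E κ : Type*} {z : Fin N → ℂ} (hz : ∀ k, (z k).im ≠ 0)
    {w : E → Fin N → ℂ} (hw : ∀ x k, (w x k).im = (z k).im) {a : E → κ → ℂ}
    (ha : ∀ x i, (a x i).im = 0) : UniformlySeparated w a := by
  obtain ⟨C, -, hC⟩ := exists_inv_im_bound z
  refine ⟨C, fun x k i => ?_⟩
  have h := norm_inv_sub_ofReal_le (u := w x k) (by rw [hw]; exact hz k) (a x i).re
  have h2 : ((a x i).re : ℂ) = a x i := by
    apply Complex.ext <;> simp [ha]
  rw [h2, hw] at h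
  exact h.trans (hC k)

/-- Gaussian smoothing of a product of reciprocal characteristic determinants over Hermitian
matrices can be traded for Gaussian smoothing in the spectral parameters. -/
theorem gaussian_smoothing_resProd {M : Matrix (Fin n) (Fin n) ℂ} (hM : M.IsHermitian)
    {z : Fin N → ℂ} (hz : ∀ k, (z k).im ≠ 0) :
    (∫ ξ : Fin n × Fin n → ℝ, (vdm z * resProd z (M + hermParam ξ)) * (gaussWeight ξ : ℂ)) *
        ∫ η : Fin N → ℝ, (gaussWeight η : ℂ) =
      (∫ ξ : Fin n × Fin n → ℝ, (gaussWeight ξ : ℂ)) *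
        ∫ η : Fin N → ℝ, (vdm (fun k => z k + (η k : ℂ)) * resProd (fun k => z k + (η k : ℂ)) M) *
          (gaussWeight η : ℂ) := by
  let w : ((Fin n × Fin n) ⊕ Fin N → ℝ) → Fin N → ℂ := fun x k => z k + (x (.inr k) : ℂ)
  let M' : ((Fin n × Fin n) ⊕ Fin N → ℝ) → Matrix (Fin n) (Fin n) ℂ :=
    fun x => M + hermParam fun p => x (.inl p)
  have hM' : ∀ x, (M' x).IsHermitian := fun x => hM.add (hermParam_isHermitian _)
  have hw : ∀ x k, (w x k).im ≠ 0 := fun x k => by simpa [w] using hz k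
  let a : ((Fin n × Fin n) ⊕ Fin N → ℝ) → Fin n → ℂ := fun x i => ((hM' x).eigenvalues i : ℂ)
  have hsep : UniformlySeparated w a :=
    uniformlySeparated_of_im hz (fun x k => by simp [w]) fun x i => by simp [a]
  have hwa : ∀ x k i, w x k ≠ a x i := fun x k i => sub_ne_zero.1 (sub_ofReal_ne_zero (hw x k) _)
  have hwg : ∀ k, PolyGrowth fun x => w x k := polyGrowth_add_coord z Sum.inr
  have hres : ∀ x, resProd (w x) (M' x) = cauchyProd (w x) (a x) := fun x =>
    IsHermitian.resProd_eq (hM' x) _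
  have hresg : PolyGrowth fun x => resProd (w x) (M' x) := by
    simp_rw [hres]; exact hsep.polyGrowth_cauchyProd
  obtain ⟨C, hC0, hC⟩ := exists_inv_im_bound z
  have hRg : ∀ k x i j, ‖resolventMatrix (w x k) (M' x) i j‖ ≤ n * C := fun k x i j => by
    refine (IsHermitian.norm_resolventMatrix_apply_le (hM' x) (hw x k) i j).trans ?_
    have := hC k
    gcongr
    simpa [w] using this
  have hT1 : ∀ p, PolyGrowth fun x =>
      ∑ k, (resolventMatrix (w x k) (M' x) * hermParam (Pi.single p 1)).trace := fun p =>
    .sum _ fun k _ => .of_bound _ fun x => norm_trace_le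
      (norm_mul_apply_le (hRg k x) (norm_hermParam_single_apply_le p))
  have hT2 : ∀ p, PolyGrowth fun x => ∑ k, (resolventMatrix (w x k) (M' x) *
      hermParam (Pi.single p 1) * resolventMatrix (w x k) (M' x) * hermParam (Pi.single p 1)).trace :=
    fun p => .sum _ fun k _ => .of_bound _ fun x => norm_trace_le
      (norm_mul_apply_le (norm_mul_apply_le (norm_mul_apply_le (hRg k x)
        (norm_hermParam_single_apply_le p)) (hRg k x)) (norm_hermParam_single_apply_le p))
  have key := gaussian_smoothing_eq (H := fun x => vdm (w x) * resProd (w x) (M' x))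
    (d₁ := Sum.elim (fun p x => vdm (w x) * resProd₁ (w x) (hermParam (Pi.single p 1)) (M' x))
      (fun k x => vdmCauchy₁ (a x) k (w x)))
    (d₂ := Sum.elim (fun p x => vdm (w x) * resProd₂ (w x) (hermParam (Pi.single p 1)) (M' x))
      (fun k x => vdmCauchy₂ (a x) k (w x)))
    (by
      refine (ContDiff.vdm (contDiff_add_coord z Sum.inr)).mul (contDiff_prod fun k _ => ?_)
      refine ContDiff.inv (contDiff_det fun i j => ?_)
        fun x => IsHermitian.det_scalar_sub_ne_zero (hM' x) (hw x k)
      have hc := fun q : Fin n × Fin n => Complex.ofRealCLM.contDiff.comp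
        (contDiff_apply (n := 2) ℝ ℝ (Sum.inl q : (Fin n × Fin n) ⊕ Fin N))
      have h1 := hc (i, j)
      have h2 := hc (j, i)
      have h3 := contDiff_add_coord z (fun k => (Sum.inr k : (Fin n × Fin n) ⊕ Fin N)) k
      simp only [Matrix.sub_apply, Matrix.scalar_apply, Matrix.diagonal_apply, M', Matrix.add_apply,
        hermParam_apply, w]
      refine ContDiff.sub ?_ (contDiff_const.add
        (((contDiff_const.mul h1).add (contDiff_const.mul h2)).div_const _))
      split_ifs
      · exact h3
      · exact contDiff_const)
    (by
      rintro (p | k) x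
      · have h := (hasDerivAt_resProd (hM' x) (hermParam (Pi.single p 1)) (hw x)).const_mul
          (vdm (w x))
        refine h.congr_of_eventuallyEq (Filter.Eventually.of_forall fun t => ?_)
        simp only [w, M', add_smul_single_inl_comp_inl, add_smul_single_inl_apply_inr,
          hermParam_add_smul, add_assoc]
      · have h := hasDerivAt_vdm_mul_cauchyProd (hwa x) k
        refine h.congr_of_eventuallyEq (Filter.Eventually.of_forall fun t => ?_)
        have : w (x + t • Pi.single (Sum.inr k) 1) = w x + Pi.single k (t : ℂ) := by
          simp only [w]
          rw [← add_ofReal_add_smul_single, ← add_smul_single_inr_comp_inr]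
        simp only [this, M', add_smul_single_inr_apply_inl]
        rw [IsHermitian.resProd_eq (hM' x)])
    (by
      rintro (p | k) x
      · have h := (hasDerivAt_resProd₁ (hM' x) (hermParam_isHermitian (Pi.single p 1)) (hw x)).const_mul
          (vdm (w x))
        refine h.congr_of_eventuallyEq (Filter.Eventually.of_forall fun t => ?_)
        simp only [w, M', Sum.elim_inl, add_smul_single_inl_comp_inl, add_smul_single_inl_apply_inr,
          hermParam_add_smul, add_assoc]
      · have h := hasDerivAt_vdmCauchy₁ (hwa x) k
        refine h.congr_of_eventuallyEq (Filter.Eventually.of_forall fun t => ?_)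
        have : w (x + t • Pi.single (Sum.inr k) 1) = w x + Pi.single k (t : ℂ) := by
          simp only [w]
          rw [← add_ofReal_add_smul_single, ← add_smul_single_inr_comp_inr]
        simp only [this, Sum.elim_inr, a, M', add_smul_single_inr_apply_inl])
    ((PolyGrowth.vdm hwg).mul hresg)
    (by
      rintro (p | k)
      · exact (PolyGrowth.vdm hwg).mul ((hT1 p).mul hresg)
      · exact PolyGrowth.vdmCauchy₁ hwg hsep k)
    (by
      rintro (p | k)
      · exact (PolyGrowth.vdm hwg).mul ((((hT1 p).pow 2).add (hT2 p)).mul hresg)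
      · exact PolyGrowth.vdmCauchy₂ hwg hsep k)
    -- Both Laplacians equal `vdm * resProd * cauchySum`.
    (fun x => by
      simp only [Sum.elim_inl, Sum.elim_inr]
      rw [← Finset.mul_sum, sum_resProd₂ (hM' x) (hw x), sum_vdmCauchy₂ (hwa x), hres, mul_assoc])
  have h1 := integral_sum_gaussWeight (A := Fin n × Fin n) (B := Fin N)
    (fun ξ => vdm z * resProd z (M + hermParam ξ)) (fun _ => 1)
  have h2 := integral_sum_gaussWeight (A := Fin n × Fin n) (B := Fin N) (fun _ => 1)
    (fun η => vdm (fun k => z k + (η k : ℂ)) * resProd (fun k => z k + (η k : ℂ)) M)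
  simp only [one_mul, mul_one] at h1 h2
  rw [← h1, ← h2]
  have h0 : hermParam (fun _ : Fin n × Fin n => (0 : ℝ)) = 0 := by
    ext i j; simp [hermParam_apply]
  simpa [w, M', h0] using key

/-- The derivative formulas are stated for the first argument of `cauchyProd`; the swap makes them
available for the second, at the cost of a constant sign. -/
theorem cauchyProd_swap (w : Fin N → ℂ) (a : Fin n → ℂ) :
    cauchyProd w a = (-1) ^ (n * N) * cauchyProd a w := by
  have h : ∀ k i, (w k - a i)⁻¹ = -1 * (a i - w k)⁻¹ := fun k i => by
    rw [neg_one_mul, ← inv_neg, neg_sub]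
  simp_rw [cauchyProd, h, Finset.prod_mul_distrib]
  rw [Finset.prod_comm (f := fun k i => (a i - w k)⁻¹)]
  simp [pow_mul]

/-- The scalar counterpart of `gaussian_smoothing_resProd`. -/
theorem gaussian_smoothing_cauchyProd (m : Fin n → ℝ) {z : Fin N → ℂ} (hz : ∀ k, (z k).im ≠ 0) :
    (∫ ζ : Fin n → ℝ, (vdm z * (vdm (fun i => (m i : ℂ) + (ζ i : ℂ)) *
          cauchyProd z (fun i => (m i : ℂ) + (ζ i : ℂ)))) * (gaussWeight ζ : ℂ)) *
        ∫ η : Fin N → ℝ, (gaussWeight η : ℂ) =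
      (∫ ζ : Fin n → ℝ, (gaussWeight ζ : ℂ)) *
        ∫ η : Fin N → ℝ, (vdm (fun k => z k + (η k : ℂ)) * (vdm (fun i => (m i : ℂ)) *
          cauchyProd (fun k => z k + (η k : ℂ)) (fun i => (m i : ℂ)))) * (gaussWeight η : ℂ) := by
  let w : (Fin n ⊕ Fin N → ℝ) → Fin N → ℂ := fun x k => z k + (x (.inr k) : ℂ)
  let a : (Fin n ⊕ Fin N → ℝ) → Fin n → ℂ := fun x k => (m k : ℂ) + (x (.inl k) : ℂ)
  have hw : ∀ x k, (w x k).im ≠ 0 := fun x k => by simpa [w] using hz k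
  have ha : ∀ x i, (a x i).im = 0 := fun x i => by simp [a]
  have hsep : UniformlySeparated w a := uniformlySeparated_of_im hz (fun x k => by simp [w]) ha
  have hsep' := hsep.symm
  have hwa : ∀ x k i, w x k ≠ a x i := fun x k i h => hw x k (by rw [h, ha])
  have haw : ∀ x i k, a x i ≠ w x k := fun x i k => (hwa x k i).symm
  have hwg : ∀ k, PolyGrowth fun x => w x k := polyGrowth_add_coord z Sum.inr
  have hag : ∀ k, PolyGrowth fun x => a x k := polyGrowth_add_coord (fun i => (m i : ℂ)) Sum.inl
  have hwl : ∀ x (t : ℝ) i, w (x + t • Pi.single (Sum.inl i) 1) = w x := fun x t i => by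
    simp only [w, add_smul_single_inl_apply_inr]
  have hwr : ∀ x (t : ℝ) k, w (x + t • Pi.single (Sum.inr k) 1) = w x + Pi.single k (t : ℂ) :=
    fun x t k => by
      simp only [w]
      rw [← add_ofReal_add_smul_single, ← add_smul_single_inr_comp_inr]
  have har : ∀ x (t : ℝ) i, a (x + t • Pi.single (Sum.inr i) 1) = a x := fun x t i => by
    simp only [a, add_smul_single_inr_apply_inl]
  have hal : ∀ x (t : ℝ) k, a (x + t • Pi.single (Sum.inl k) 1) = a x + Pi.single k (t : ℂ) :=
    fun x t k => by
      simp only [a]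
      rw [← add_ofReal_add_smul_single, ← add_smul_single_inl_comp_inl]
  let ε : ℂ := (-1) ^ (n * N)
  have hswap : ∀ x, vdm (w x) * (vdm (a x) * cauchyProd (w x) (a x)) =
      ε * vdm (w x) * (vdm (a x) * cauchyProd (a x) (w x)) := fun x => by
    rw [cauchyProd_swap]; ring
  have key := gaussian_smoothing_eq
    (H := fun x => vdm (w x) * (vdm (a x) * cauchyProd (w x) (a x)))
    (d₁ := Sum.elim (fun i x => ε * vdm (w x) * vdmCauchy₁ (w x) i (a x))
      (fun k x => vdm (a x) * vdmCauchy₁ (a x) k (w x)))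
    (d₂ := Sum.elim (fun i x => ε * vdm (w x) * vdmCauchy₂ (w x) i (a x))
      (fun k x => vdm (a x) * vdmCauchy₂ (a x) k (w x)))
    (by
      refine (ContDiff.vdm (contDiff_add_coord z Sum.inr)).mul
        ((ContDiff.vdm (contDiff_add_coord (fun i => (m i : ℂ)) Sum.inl)).mul
          (contDiff_prod fun k _ => contDiff_prod fun i _ => ?_))
      exact ContDiff.inv ((contDiff_add_coord z Sum.inr k).sub (contDiff_add_coord (fun i => (m i : ℂ)) Sum.inl i))
        fun x => sub_ne_zero.2 (hwa x k i))
    (by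
      rintro (p | k) x
      · simp_rw [hswap]
        have h := (hasDerivAt_vdm_mul_cauchyProd (haw x) p).const_mul (ε * vdm (w x))
        refine h.congr_of_eventuallyEq (Filter.Eventually.of_forall fun t => ?_)
        simp only [hwl, hal]
      · have h := (hasDerivAt_vdm_mul_cauchyProd (hwa x) k).const_mul (vdm (a x))
        refine h.congr_of_eventuallyEq (Filter.Eventually.of_forall fun t => ?_)
        simp only [hwr, har]
        ring)
    (by
      rintro (p | k) x
      · have h := (hasDerivAt_vdmCauchy₁ (haw x) p).const_mul (ε * vdm (w x))
        refine h.congr_of_eventuallyEq (Filter.Eventually.of_forall fun t => ?_)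
        simp only [Sum.elim_inl, hwl, hal]
      · have h := (hasDerivAt_vdmCauchy₁ (hwa x) k).const_mul (vdm (a x))
        refine h.congr_of_eventuallyEq (Filter.Eventually.of_forall fun t => ?_)
        simp only [Sum.elim_inr, hwr, har])
    ((PolyGrowth.vdm hwg).mul ((PolyGrowth.vdm hag).mul hsep.polyGrowth_cauchyProd))
    (by
      rintro (p | k)
      · exact ((PolyGrowth.const ε).mul (PolyGrowth.vdm hwg)).mul (PolyGrowth.vdmCauchy₁ hag hsep' p)
      · exact (PolyGrowth.vdm hag).mul (PolyGrowth.vdmCauchy₁ hwg hsep k))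
    (by
      rintro (p | k)
      · exact ((PolyGrowth.const ε).mul (PolyGrowth.vdm hwg)).mul (PolyGrowth.vdmCauchy₂ hag hsep' p)
      · exact (PolyGrowth.vdm hag).mul (PolyGrowth.vdmCauchy₂ hwg hsep k))
    -- The two Laplacians match by `cauchySum_comm`; the sign `ε` is absorbed by `cauchyProd_swap`.
    (fun x => by
      simp only [Sum.elim_inl, Sum.elim_inr]
      rw [← Finset.mul_sum, ← Finset.mul_sum, sum_vdmCauchy₂ (hwa x), sum_vdmCauchy₂ (haw x),
        cauchySum_comm (a x), cauchyProd_swap (w x)]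
      ring)
  have h1 := integral_sum_gaussWeight (A := Fin n) (B := Fin N)
    (fun ζ => vdm z * (vdm (fun i => (m i : ℂ) + (ζ i : ℂ)) *
          cauchyProd z (fun i => (m i : ℂ) + (ζ i : ℂ)))) (fun _ => 1)
  have h2 := integral_sum_gaussWeight (A := Fin n) (B := Fin N) (fun _ => 1)
    (fun η => vdm (fun k => z k + (η k : ℂ)) * (vdm (fun i => (m i : ℂ)) *
          cauchyProd (fun k => z k + (η k : ℂ)) (fun i => (m i : ℂ))))
  simp only [one_mul, mul_one] at h1 h2
  rw [← h1, ← h2]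
  simpa [w, a] using key

/-- Gaussian smoothing of a product of reciprocal characteristic determinants over Hermitian
matrices, in terms of eigenvalues. -/
theorem vdm_eigenvalues_mul_integral_resProd {M : Matrix (Fin n) (Fin n) ℂ} (hM : M.IsHermitian)
    {z : Fin N → ℂ} (hz : ∀ k, (z k).im ≠ 0) (hinj : z.Injective) :
    vdm (fun i => (hM.eigenvalues i : ℂ)) *
        (∫ ξ : Fin n × Fin n → ℝ, resProd z (M + hermParam ξ) * (gaussWeight ξ : ℂ)) *
        (∫ ζ : Fin n → ℝ, (gaussWeight ζ : ℂ)) =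
      (∫ ξ : Fin n × Fin n → ℝ, (gaussWeight ξ : ℂ)) *
      ∫ ζ : Fin n → ℝ, vdm (fun i => (hM.eigenvalues i : ℂ) + (ζ i : ℂ)) *
          cauchyProd z (fun i => (hM.eigenvalues i : ℂ) + (ζ i : ℂ)) * (gaussWeight ζ : ℂ) := by
  have h1 := gaussian_smoothing_resProd hM hz
  have h2 := gaussian_smoothing_cauchyProd hM.eigenvalues hz
  have hN : (∫ η : Fin N → ℝ, (gaussWeight η : ℂ)) ≠ 0 := by
    rw [integral_complex_ofReal]
    exact_mod_cast integral_gaussWeight_pos.ne'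
  have hv := vdm_ne_zero hinj
  have h3 : ∀ η : Fin N → ℝ, (vdm (fun k => z k + (η k : ℂ)) * (vdm (fun i => (hM.eigenvalues i : ℂ)) *
      cauchyProd (fun k => z k + (η k : ℂ)) (fun i => (hM.eigenvalues i : ℂ)))) * (gaussWeight η : ℂ) =
      vdm (fun i => (hM.eigenvalues i : ℂ)) * ((vdm (fun k => z k + (η k : ℂ)) *
        resProd (fun k => z k + (η k : ℂ)) M) * (gaussWeight η : ℂ)) := fun η => by
    rw [IsHermitian.resProd_eq hM]; ring
  simp_rw [h3] at h2
  rw [integral_const_mul] at h2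
  simp_rw [mul_assoc (vdm z)] at h1 h2
  rw [integral_const_mul] at h1 h2
  -- `h1` and `h2` contain the same integral smoothed in `z`. Eliminating it leaves the claim times
  -- `vdm z`, nonzero for distinct parameters, and a Gaussian mass.
  refine mul_left_cancel₀ (mul_ne_zero hv hN) ?_
  linear_combination (vdm (fun i => (hM.eigenvalues i : ℂ)) * (∫ ζ : Fin n → ℝ, (gaussWeight ζ : ℂ))) * h1
    - (∫ ξ : Fin n × Fin n → ℝ, (gaussWeight ξ : ℂ)) * h2

end Flow

/-! ### Ordered eigenvalues and their measurability -/

section Spectrum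

variable {n : ℕ}

theorem exists_perm_of_map_univ_eq {α : Type*} [LinearOrder α] {x y : Fin n → α}
    (h : Finset.univ.val.map x = Finset.univ.val.map y) : ∃ σ : Equiv.Perm (Fin n), y = x ∘ σ := by
  have hp : (List.ofFn x).Perm (List.ofFn y) := by
    rw [Fin.univ_val_map, Fin.univ_val_map] at h
    exact Multiset.coe_eq_coe.1 h
  have hs : (List.ofFn (x ∘ Tuple.sort x)).Perm (List.ofFn (y ∘ Tuple.sort y)) :=
    (((Tuple.sort x).ofFn_comp_perm x).trans hp).trans ((Tuple.sort y).ofFn_comp_perm y).symm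
  have he := List.ofFn_injective (hs.eq_of_pairwise' (Tuple.monotone_sort x).sortedLE_ofFn.pairwise
    (Tuple.monotone_sort y).sortedLE_ofFn.pairwise)
  refine ⟨Tuple.sort x * (Tuple.sort y)⁻¹, ?_⟩
  ext i
  have := congrFun he ((Tuple.sort y)⁻¹ i)
  simpa using this.symm

/-- Monic polynomials that agree on an infinite set are equal, hence have the same multiset of
roots. -/
theorem exists_perm_of_prod_sub_eq {x y : Fin n → ℝ} {S : Set ℂ} (hS : S.Infinite)
    (h : ∀ u ∈ S, ∏ i, (u - x i) = ∏ i, (u - y i)) : ∃ σ : Equiv.Perm (Fin n), y = x ∘ σ := by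
  have hp : (∏ i, (Polynomial.X - Polynomial.C (x i : ℂ))) =
      ∏ i, (Polynomial.X - Polynomial.C (y i : ℂ)) := by
    refine Polynomial.eq_of_infinite_eval_eq _ _ (hS.mono fun u hu => ?_)
    simpa [Polynomial.eval_prod] using h u hu
  have hr := congrArg Polynomial.roots hp
  rw [Polynomial.roots_prod _ _ (Finset.prod_ne_zero_iff.2 fun i _ => Polynomial.X_sub_C_ne_zero _),
    Polynomial.roots_prod _ _ (Finset.prod_ne_zero_iff.2 fun i _ => Polynomial.X_sub_C_ne_zero _)] at hr
  simp only [Polynomial.roots_X_sub_C, Multiset.bind_singleton] at hr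
  refine exists_perm_of_map_univ_eq ?_
  have := congrArg (Multiset.map Complex.re) hr
  simpa [Multiset.map_map, Function.comp_def] using this

/-- The index relabelling used by `Matrix.IsHermitian.eigenvalues`. -/
noncomputable def eigIndexEquiv (n : ℕ) : Fin (Fintype.card (Fin n)) ≃ Fin n :=
  Fintype.equivOfCardEq (Fintype.card_fin _)

/-- The set of vectors listed in the order used by `Matrix.IsHermitian.eigenvalues`. -/
def orderedVectors (n : ℕ) : Set (Fin n → ℝ) := {x | Antitone (x ∘ eigIndexEquiv n)}

theorem isClosed_orderedVectors : IsClosed (orderedVectors n) :=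
  isClosed_antitone.preimage
    (f := fun x : Fin n → ℝ => x ∘ eigIndexEquiv n) (continuous_pi fun _ => continuous_apply _)

instance : PolishSpace (orderedVectors n) := isClosed_orderedVectors.polishSpace

theorem eigs_mem_orderedVectors (A : HermitianMatrix n) : A.eigs ∈ orderedVectors n := by
  have h : A.eigs ∘ eigIndexEquiv n =
      Matrix.IsHermitian.eigenvalues₀ (A := (A : Matrix (Fin n) (Fin n) ℂ)) A.2 := by
    ext i
    simp [HermitianMatrix.eigs, Matrix.IsHermitian.eigenvalues, eigIndexEquiv]
  rw [orderedVectors, Set.mem_ofPred_eq, h]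
  exact Matrix.IsHermitian.eigenvalues₀_antitone _

theorem eq_of_mem_orderedVectors {x y : Fin n → ℝ} (hx : x ∈ orderedVectors n)
    (hy : y ∈ orderedVectors n) {σ : Equiv.Perm (Fin n)} (h : y = x ∘ σ) : x = y := by
  let e := eigIndexEquiv n
  have h1 : y ∘ e = (x ∘ e) ∘ ((e.trans σ).trans e.symm) := by
    ext i; simp [h]
  have h2 := Tuple.unique_antitone (f := x ∘ e) (σ := 1) (τ := (e.trans σ).trans e.symm)
    (by simpa using! hx) (by rw [← h1]; exact hy)
  rw [← h1] at h2
  ext i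
  have := congrFun h2 (e.symm i)
  simpa using this

/-- The values at the natural numbers of the monic polynomial with prescribed roots. -/
def monicValues (x : Fin n → ℝ) (q : ℕ) : ℝ := ∏ i, ((q : ℝ) - x i)

/-- A continuous injection of a Polish space is a measurable embedding (Lusin–Souslin).
Measurability of the eigenvalues is thereby reduced to continuity of the characteristic polynomial
at integer points. -/
theorem measurableEmbedding_monicValues :
    MeasurableEmbedding fun x : orderedVectors n => monicValues (x : Fin n → ℝ) := by
  refine Continuous.measurableEmbedding ?_ ?_
  · refine continuous_pi fun q => ?_
    have h : Continuous fun x : Fin n → ℝ => monicValues x q := by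
      unfold monicValues
      fun_prop
    exact h.comp continuous_subtype_val
  · intro x y h
    obtain ⟨σ, hσ⟩ := exists_perm_of_prod_sub_eq (x := (x : Fin n → ℝ)) (y := (y : Fin n → ℝ))
      (Set.infinite_range_of_injective (Nat.cast_injective (R := ℂ))) (by
        rintro _ ⟨q, rfl⟩
        have := congrFun h q
        simp only [monicValues] at this
        exact_mod_cast congrArg (fun t : ℝ => (t : ℂ)) this)
    exact Subtype.ext (eq_of_mem_orderedVectors x.2 y.2 hσ)

theorem HermitianMatrix.det_scalar_sub (A : HermitianMatrix n) (u : ℂ) :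
    (Matrix.scalar (Fin n) u - (A : Matrix (Fin n) (Fin n) ℂ)).det = ∏ i, (u - A.eigs i) :=
  IsHermitian.det_scalar_sub (M := (A : Matrix (Fin n) (Fin n) ℂ)) A.2 u

/-- The ordered eigenvalues of a Hermitian matrix. -/
noncomputable def orderedEigs (A : HermitianMatrix n) : orderedVectors n :=
  ⟨A.eigs, eigs_mem_orderedVectors A⟩

theorem measurable_orderedEigs : Measurable (orderedEigs (n := n)) := by
  refine measurableEmbedding_monicValues.measurable_comp_iff.1 (Continuous.measurable ?_)
  refine continuous_pi fun q => ?_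
  have h : ∀ A : HermitianMatrix n, monicValues A.eigs q =
      (Matrix.scalar (Fin n) (q : ℂ) - (A : Matrix (Fin n) (Fin n) ℂ)).det.re := fun A => by
    rw [HermitianMatrix.det_scalar_sub, monicValues, ← Complex.ofReal_re (∏ i, ((q : ℝ) - A.eigs i))]
    push_cast
    rfl
  simp only [Function.comp_apply, orderedEigs, h]
  exact Complex.continuous_re.comp
    (Continuous.matrix_det (continuous_const.sub continuous_subtype_val))

theorem measurable_eigs : Measurable (HermitianMatrix.eigs (n := n)) :=
  measurable_subtype_coe.comp measurable_orderedEigs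

/-- The real diagonal matrix with prescribed entries. -/
noncomputable def diagHermitian (x : Fin n → ℝ) : HermitianMatrix n :=
  ⟨Matrix.diagonal fun i => (x i : ℂ), by
    rw [selfAdjoint.mem_iff, Matrix.star_eq_conjTranspose, Matrix.diagonal_conjTranspose]
    congr 1
    ext i
    simp⟩

/-- Rearrange a vector in the order used by `Matrix.IsHermitian.eigenvalues`. -/
noncomputable def orderVector (x : Fin n → ℝ) : orderedVectors n := orderedEigs (diagHermitian x)

theorem measurable_orderVector : Measurable (orderVector (n := n)) := by
  refine measurable_orderedEigs.comp (Continuous.measurable ?_)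
  refine Continuous.subtype_mk ?_ _
  exact Continuous.matrix_diagonal (by fun_prop)

theorem exists_perm_orderVector (x : Fin n → ℝ) :
    ∃ σ : Equiv.Perm (Fin n), (orderVector x : Fin n → ℝ) = x ∘ σ := by
  refine exists_perm_of_prod_sub_eq (S := Set.univ) Set.infinite_univ fun u _ => ?_
  have h := HermitianMatrix.det_scalar_sub (diagHermitian x) u
  change _ = ∏ i, (u - (diagHermitian x).eigs i)
  rw [← h]
  simp [diagHermitian, Matrix.scalar_apply, Matrix.diagonal_sub]

theorem apply_orderVector {β : Type*} {F : (Fin n → ℝ) → β}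
    (hF : ∀ (σ : Equiv.Perm (Fin n)) x, F (x ∘ σ) = F x) (x : Fin n → ℝ) :
    F (orderVector x) = F x := by
  obtain ⟨σ, hσ⟩ := exists_perm_orderVector x
  rw [hσ, hF]

end Spectrum

/-! ### Cauchy products determine symmetric measures -/

section Symmetric

variable {n : ℕ}

theorem measurable_comp_perm (σ : Equiv.Perm (Fin n)) :
    Measurable fun x : Fin n → ℝ => x ∘ σ :=
  measurable_pi_lambda _ fun _ => measurable_pi_apply _

/-- Permutation-invariant measures are determined by the law of the ordered vector. -/
theorem measure_eq_of_map_orderVector_eq {μ ν : Measure (Fin n → ℝ)}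
    (hμ : ∀ σ : Equiv.Perm (Fin n), μ.map (fun x => x ∘ σ) = μ)
    (hν : ∀ σ : Equiv.Perm (Fin n), ν.map (fun x => x ∘ σ) = ν)
    (h : μ.map orderVector = ν.map orderVector) : μ = ν := by
  ext B hB
  -- The symmetrized indicator depends only on the ordered vector, and its integral against a
  -- permutation-invariant measure is `n!` times the measure of `B`.
  let Φ : (Fin n → ℝ) → ENNReal := fun x => ∑ σ : Equiv.Perm (Fin n), B.indicator 1 (x ∘ σ)
  have hΦm : Measurable Φ := Finset.measurable_sum _ fun σ _ =>
    ((measurable_one.indicator hB).comp (measurable_comp_perm σ))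
  have hΦs : ∀ (σ : Equiv.Perm (Fin n)) x, Φ (x ∘ σ) = Φ x := fun σ x =>
    Fintype.sum_equiv (Equiv.mulLeft σ) _ _ fun τ => rfl
  have key : ∀ ρ : Measure (Fin n → ℝ), (∀ σ : Equiv.Perm (Fin n), ρ.map (fun x => x ∘ σ) = ρ) →
      (Fintype.card (Equiv.Perm (Fin n)) : ENNReal) * ρ B =
        ∫⁻ c, Φ (c : Fin n → ℝ) ∂(ρ.map orderVector) := fun ρ hρ => by
    rw [lintegral_map (f := fun c : orderedVectors n => Φ c) (hΦm.comp measurable_subtype_coe)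
      measurable_orderVector]
    simp_rw [apply_orderVector hΦs]
    have hsum : ∫⁻ x, Φ x ∂ρ = ∑ σ : Equiv.Perm (Fin n), ∫⁻ x, B.indicator 1 (x ∘ σ) ∂ρ :=
      lintegral_finsetSum _ fun σ _ =>
        (measurable_one.indicator hB).comp (measurable_comp_perm σ)
    rw [hsum]
    have : ∀ σ : Equiv.Perm (Fin n), ∫⁻ x, B.indicator 1 (x ∘ σ) ∂ρ = ρ B := fun σ => by
      rw [← lintegral_map (f := B.indicator 1) (measurable_one.indicator hB) (measurable_comp_perm σ),
        hρ σ, lintegral_indicator_one hB]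
    simp [this]
  have h1 := key μ hμ
  rw [h, ← key ν hν] at h1
  exact (ENNReal.mul_right_inj (by simp [Fintype.card_ne_zero]) (ENNReal.natCast_ne_top _)).1 h1

theorem norm_cauchyProd_ofReal_le {N : ℕ} {C : ℝ} {z : Fin N → ℂ} (hz : ∀ k, (z k).im ≠ 0)
    (hC : ∀ k, |(z k).im|⁻¹ ≤ C) (x : Fin n → ℝ) :
    ‖cauchyProd z (fun i => (x i : ℂ))‖ ≤ ∏ _k : Fin N, ∏ _i : Fin n, C := by
  rw [cauchyProd, norm_prod]
  refine Finset.prod_le_prod (fun _ _ => norm_nonneg _) fun k _ => ?_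
  rw [norm_prod]
  exact Finset.prod_le_prod (fun _ _ => norm_nonneg _) fun i _ =>
    (norm_inv_sub_ofReal_le (hz k) _).trans (hC k)

theorem continuous_cauchyProd_ofReal {N : ℕ} {z : Fin N → ℂ} (hz : ∀ k, (z k).im ≠ 0) :
    Continuous fun x : Fin n → ℝ => cauchyProd z (fun i => (x i : ℂ)) := by
  unfold cauchyProd
  refine continuous_finsetProd _ fun k _ => continuous_finsetProd _ fun i _ => ?_
  exact Continuous.inv₀ (by fun_prop) fun x => sub_ofReal_ne_zero (hz k) _

theorem cauchyProd_comp_perm {N : ℕ} (z : Fin N → ℂ) (σ : Equiv.Perm (Fin n)) (x : Fin n → ℝ) :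
    cauchyProd z (fun i => ((x ∘ σ) i : ℂ)) = cauchyProd z (fun i => (x i : ℂ)) :=
  Finset.prod_congr rfl fun k _ => Equiv.prod_comp σ fun i => (z k - (x i : ℂ))⁻¹

/-- Equality of the integrals of Cauchy products extends from pairwise distinct to arbitrary
spectral parameters. -/
theorem integral_cauchyProd_eq_of_injective {N : ℕ} {μ ν : Measure (Fin n → ℝ)} [IsFiniteMeasure μ]
    [IsFiniteMeasure ν]
    (h : ∀ z : Fin N → ℂ, (∀ k, (z k).im ≠ 0) → z.Injective →
      ∫ x, cauchyProd z (fun i => (x i : ℂ)) ∂μ = ∫ x, cauchyProd z (fun i => (x i : ℂ)) ∂ν)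
    {z : Fin N → ℂ} (hz : ∀ k, (z k).im ≠ 0) :
    ∫ x, cauchyProd z (fun i => (x i : ℂ)) ∂μ = ∫ x, cauchyProd z (fun i => (x i : ℂ)) ∂ν := by
  -- Real shifts with distinct speeds: the imaginary parts are unchanged, so the Cauchy products
  -- stay uniformly bounded, while the parameters become distinct for small `t ≠ 0`.
  let Z : ℝ → Fin N → ℂ := fun t k => z k + t * (k : ℕ)
  have hZ0 : Z 0 = z := by ext; simp [Z]
  have hZim : ∀ t k, (Z t k).im = (z k).im := fun t k => by simp [Z]
  have hZ : ∀ t k, (Z t k).im ≠ 0 := fun t k => by rw [hZim]; exact hz k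
  obtain ⟨C, -, hC⟩ := exists_inv_im_bound z
  have hcont : ∀ ρ : Measure (Fin n → ℝ), IsFiniteMeasure ρ →
      Continuous fun t => ∫ x, cauchyProd (Z t) (fun i => (x i : ℂ)) ∂ρ := fun ρ _ => by
    refine continuous_of_dominated
      (fun t => (continuous_cauchyProd_ofReal (hZ t)).aestronglyMeasurable)
      (fun t => Filter.Eventually.of_forall fun x =>
        norm_cauchyProd_ofReal_le (C := C) (hZ t) (fun k => by rw [hZim]; exact hC k) x)
      (integrable_const _) (Filter.Eventually.of_forall fun x => ?_)
    unfold cauchyProd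
    refine continuous_finsetProd _ fun k _ => continuous_finsetProd _ fun i _ => ?_
    exact Continuous.inv₀ (by fun_prop) fun t => sub_ofReal_ne_zero (hZ t k) _
  have hev : ∀ᶠ t in nhdsWithin (0 : ℝ) {0}ᶜ, ∫ x, cauchyProd (Z t) (fun i => (x i : ℂ)) ∂μ =
      ∫ x, cauchyProd (Z t) (fun i => (x i : ℂ)) ∂ν := by
    filter_upwards [eventually_injective_add_mul z (fun k : Fin N => ((k : ℕ) : ℂ))
      (fun i j h => Fin.ext (by simpa using h))] with t ht
    exact h _ (hZ t) ht
  have := tendsto_nhds_unique_of_eventuallyEq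
    ((hcont μ inferInstance).continuousAt.tendsto.mono_left nhdsWithin_le_nhds)
    ((hcont ν inferInstance).continuousAt.tendsto.mono_left nhdsWithin_le_nhds) hev
  simpa only [hZ0] using this

open BoundedContinuousFunction in
/-- The function `x ↦ ∏ (u - x i)⁻¹` as a bounded continuous function of ordered vectors. -/
noncomputable def cauchyKernelBCF (n : ℕ) (u : {u : ℂ // u.im ≠ 0}) : orderedVectors n →ᵇ ℂ :=
  BoundedContinuousFunction.ofNormedAddCommGroup
    (fun c => cauchyProd (fun _ : Fin 1 => (u : ℂ)) (fun i => ((c : Fin n → ℝ) i : ℂ)))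
    ((continuous_cauchyProd_ofReal fun _ => u.2).comp continuous_subtype_val) _
    fun _ => norm_cauchyProd_ofReal_le (fun _ => u.2) (fun _ => le_rfl) _

theorem cauchyKernelBCF_apply (u : {u : ℂ // u.im ≠ 0}) (c : orderedVectors n) :
    cauchyKernelBCF n u c = ∏ i, ((u : ℂ) - ((c : Fin n → ℝ) i : ℂ))⁻¹ := by
  simp [cauchyKernelBCF, cauchyProd]

/-- Finite measures are determined, as far as the law of the ordered vector goes, by their
integrals against Cauchy products. -/
theorem map_orderVector_eq {μ ν : Measure (Fin n → ℝ)} [IsFiniteMeasure μ] [IsFiniteMeasure ν]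
    (h : ∀ (N : ℕ) (z : Fin N → ℂ), (∀ k, (z k).im ≠ 0) → z.Injective →
      ∫ x, cauchyProd z (fun i => (x i : ℂ)) ∂μ = ∫ x, cauchyProd z (fun i => (x i : ℂ)) ∂ν) :
    μ.map orderVector = ν.map orderVector := by
  have hstar : ∀ g ∈ Set.range (cauchyKernelBCF n), star g ∈ Set.range (cauchyKernelBCF n) := by
    rintro _ ⟨u, rfl⟩
    refine ⟨⟨star (u : ℂ), by simpa using u.2⟩, ?_⟩
    ext c
    simp [cauchyKernelBCF_apply, star_prod]
  have hunion : Set.range (cauchyKernelBCF n) ∪ star (Set.range (cauchyKernelBCF n)) =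
      Set.range (cauchyKernelBCF n) := by
    refine Set.union_eq_left.2 fun g hg => ?_
    simpa using hstar _ hg
  -- Stone–Weierstrass for the star algebra generated by the one-parameter kernels. It separates
  -- ordered vectors because the kernels determine the monic polynomial.
  refine ext_of_forall_mem_subalgebra_integral_eq_of_polish (𝕜 := ℂ)
    (A := StarAlgebra.adjoin ℂ (Set.range (cauchyKernelBCF n))) ?_ ?_
  · intro c c' hcc
    by_contra! hne
    refine hcc ?_
    have hu : ∀ u ∈ {u : ℂ | u.im ≠ 0}, ∏ i, (u - ((c : Fin n → ℝ) i : ℂ)) =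
        ∏ i, (u - ((c' : Fin n → ℝ) i : ℂ)) := fun u hu => by
      have := hne _ ⟨_, ⟨cauchyKernelBCF n ⟨u, hu⟩,
        StarAlgebra.subset_adjoin ℂ _ ⟨_, rfl⟩, rfl⟩, rfl⟩
      simp only [BoundedContinuousFunction.toContinuousMapStarₐ] at this
      change cauchyKernelBCF n ⟨u, hu⟩ c = cauchyKernelBCF n ⟨u, hu⟩ c' at this
      rw [cauchyKernelBCF_apply, cauchyKernelBCF_apply, Finset.prod_inv_distrib,
        Finset.prod_inv_distrib, inv_inj] at this
      exact this
    have hinf : {u : ℂ | u.im ≠ 0}.Infinite := by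
      refine Set.Infinite.mono ?_ (Set.infinite_range_of_injective
        (f := fun q : ℕ => (q : ℂ) + Complex.I) fun a b hab => by simpa using hab)
      rintro _ ⟨q, rfl⟩
      simp
    obtain ⟨σ, hσ⟩ := exists_perm_of_prod_sub_eq hinf hu
    exact Subtype.ext (eq_of_mem_orderedVectors c.2 c'.2 hσ)
  · intro g hg
    have hg' : g ∈ Submodule.span ℂ
        (Submonoid.closure (Set.range (cauchyKernelBCF n)) : Set (_)) := by
      rw [← Algebra.adjoin_eq_span]
      have : g ∈ (StarAlgebra.adjoin ℂ (Set.range (cauchyKernelBCF n))).toSubalgebra := hg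
      rwa [StarAlgebra.adjoin_toSubalgebra, hunion] at this
    -- A product of Cauchy products is the one with concatenated parameters. Parameters may repeat,
    -- so `integral_cauchyProd_eq_of_injective` is needed below.
    have hprod : ∀ g ∈ Submonoid.closure (Set.range (cauchyKernelBCF n)),
        ∃ (N : ℕ) (z : Fin N → ℂ), (∀ k, (z k).im ≠ 0) ∧
          ∀ c, g c = cauchyProd z (fun i => ((c : Fin n → ℝ) i : ℂ)) := by
      intro g hg
      induction hg using Submonoid.closure_induction with
      | mem g hg =>
        obtain ⟨u, rfl⟩ := hg
        exact ⟨1, fun _ => u, fun _ => u.2, fun c => rfl⟩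
      | one => exact ⟨0, Fin.elim0, fun k => k.elim0, fun c => by simp [cauchyProd]⟩
      | mul g g' _ _ ih ih' =>
        obtain ⟨N, z, hz, hg⟩ := ih
        obtain ⟨N', z', hz', hg'⟩ := ih'
        refine ⟨N + N', Fin.append z z', fun k => ?_, fun c => ?_⟩
        · refine Fin.addCases (fun i => ?_) (fun i => ?_) k
          · simpa using hz i
          · simpa using hz' i
        · simp [hg, hg', cauchyProd, Fin.prod_univ_add, mul_comm]
    have hint : ∀ (g : BoundedContinuousFunction (orderedVectors n) ℂ) (ρ : Measure (orderedVectors n))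
        [IsFiniteMeasure ρ], Integrable (fun c => g c) ρ := fun g ρ _ => g.integrable ρ
    have := Measure.isFiniteMeasure_map μ (orderVector (n := n))
    have := Measure.isFiniteMeasure_map ν (orderVector (n := n))
    clear hg
    induction hg' using Submodule.span_induction with
    | mem g hg =>
      obtain ⟨N, z, hz, hgz⟩ := hprod g hg
      have hmeas : ∀ ρ : Measure (Fin n → ℝ), ∫ c, g c ∂(ρ.map orderVector) =
          ∫ x, cauchyProd z (fun i => (x i : ℂ)) ∂ρ := fun ρ => by
        rw [integral_map measurable_orderVector.aemeasurable g.continuous.aestronglyMeasurable]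
        congr 1
        ext x
        rw [hgz]
        exact apply_orderVector (F := fun x => cauchyProd z (fun i => (x i : ℂ)))
          (fun σ x => cauchyProd_comp_perm z σ x) x
      rw [hmeas, hmeas]
      exact integral_cauchyProd_eq_of_injective (h N) hz
    | zero => simp
    | add g g' _ _ ih ih' =>
      simp only [BoundedContinuousFunction.add_apply]
      rw [integral_add (hint _ _) (hint _ _), integral_add (hint _ _) (hint _ _)]
      rw [ih, ih']
    | smul a g _ ih =>
      simp only [BoundedContinuousFunction.smul_apply, integral_smul, ih]

end Symmetric

/-! ### Finite moments of the weights -/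

section Moments

open Matrix

theorem Matrix.det_vandermonde_cons {R : Type*} [CommRing R] {m : ℕ} (t : R) (b : Fin m → R) :
    (vandermonde (Fin.cons t b : Fin (m + 1) → R)).det =
      (∏ j, (b j - t)) * (vandermonde b).det := by
  rw [det_vandermonde, Fin.prod_univ_succ, det_vandermonde]
  congr 1
  · simp [Fin.Ioi_zero_eq_map]
  · simp [-Fin.map_succEmb_Ioi, Fin.Ioi_succ]

theorem insertNth_eq_cons_comp {α : Type*} {m : ℕ} (i : Fin (m + 1)) (t : α) (b : Fin m → α) :
    (i.insertNth t b : Fin (m + 1) → α) = (Fin.cons t b : Fin (m + 1) → α) ∘ i.cycleRange := by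
  ext j
  refine Fin.succAboveCases i ?_ (fun k => ?_) j
  · simp [Fin.cycleRange_self]
  · simp [Fin.cycleRange_succAbove]

/-- Moving the row of `t` to the front is a cycle, which affects only the sign. -/
theorem Matrix.abs_det_vandermonde_insertNth {m : ℕ} (i : Fin (m + 1)) (t : ℝ) (b : Fin m → ℝ) :
    |(vandermonde (i.insertNth t b : Fin (m + 1) → ℝ)).det| =
      (∏ j, |b j - t|) * |(vandermonde b).det| := by
  rw [insertNth_eq_cons_comp]
  have : vandermonde ((Fin.cons t b : Fin (m + 1) → ℝ) ∘ i.cycleRange) =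
      (vandermonde (Fin.cons t b : Fin (m + 1) → ℝ)).submatrix i.cycleRange id := rfl
  rw [this, det_permute, abs_mul, det_vandermonde_cons, abs_mul, Finset.abs_prod]
  rcases Int.units_eq_one_or (Equiv.Perm.sign i.cycleRange) with h | h <;> simp [h]

variable {m : ℕ} {f : Fin (m + 1) → ℝ → ℝ}

/-- Fubini for coordinate `i`. Slices are indexed by full vectors whose `i`-th entry is forgotten,
so that one generic `a` serves all `i` at once. -/
theorem ae_integrable_insertNth {E : Type*} [NormedAddCommGroup E] {F : (Fin (m + 1) → ℝ) → E}
    (hF : Integrable F) (i : Fin (m + 1)) :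
    ∀ᵐ a : Fin (m + 1) → ℝ, Integrable fun t => F (i.insertNth t (i.removeNth a)) := by
  have hp := volume_preserving_piFinSuccAbove (fun _ : Fin (m + 1) => ℝ) i
  have h1 : Integrable fun p : ℝ × (Fin m → ℝ) => F (i.insertNth p.1 p.2) := by
    have := (hp.symm).integrable_comp_of_integrable hF
    exact this
  have h2 := (Measure.volume_eq_prod ℝ (Fin m → ℝ) ▸ h1).prod_left_ae
  have h3 : Measure.QuasiMeasurePreserving (fun a : Fin (m + 1) → ℝ => i.removeNth a) volume volume :=
    Measure.quasiMeasurePreserving_snd.comp hp.quasiMeasurePreserving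
  exact h3.ae h2

/-- Determinantal form of a row expansion: the row `f(t)` is recovered from the determinants in
which it replaces one of the rows `f(a i)`. -/
theorem mul_det_eq_sum_det_update {n : ℕ} (f : Fin n → ℝ → ℝ) (a : Fin n → ℝ) (t : ℝ) (k : Fin n) :
    f k t * (of fun j l => f l (a j)).det =
      ∑ i, f k (a i) * (of fun j l => f l (Function.update a i t j)).det := by
  have h : ∀ i, (of fun j l => f l (Function.update a i t j)) =
      (of fun j l => f l (a j)).updateRow i fun l => f l t := fun i => by
    ext j l
    by_cases hj : j = i
    · subst hj; simp
    · simp [hj]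
  simp_rw [h, det_updateRow_eq_sum, Finset.mul_sum]
  rw [Finset.sum_comm]
  have h2 : ∀ l, ∑ i, f k (a i) * (f l t * (of fun j l => f l (a j)).adjugate l i) =
      f l t * ((of fun j l => f l (a j)).adjugate * of fun j l => f l (a j)) l k := fun l => by
    rw [mul_apply, Finset.mul_sum]
    exact Finset.sum_congr rfl fun i _ => by simp; ring
  simp_rw [h2, adjugate_mul]
  simp [Matrix.one_apply]

theorem one_add_abs_mul_min_le (t b : ℝ) : (1 + |t|) * min 1 |t - b| ≤ (2 + |b|) * |b - t| := by
  rw [abs_sub_comm b t]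
  have h1 : |t| ≤ |t - b| + |b| := by simpa using abs_add_le (t - b) b
  have h0 := abs_nonneg (t - b)
  have hb := abs_nonneg b
  rcases le_total 1 |t - b| with h | h
  · rw [min_eq_left h]; nlinarith
  · rw [min_eq_right h]; nlinarith

/-- `mul_det_eq_sum_det_update` writes `f k t` as a combination of the determinants with `a i`
replaced by `t`. Each is integrable against its Vandermonde factor, a constant times `∏_{j ≠ i} |a j
- t|`. The weight with capped distances lies below a multiple of every one of these factors, so it
works for all `i` simultaneously. -/
theorem integrable_pow_mul_prod_min_mul (hf : ∀ k, AEMeasurable (f k)) {a : Fin (m + 1) → ℝ}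
    (ha : (vandermonde a).det * (of fun j k => f k (a j)).det ≠ 0)
    (hint : ∀ i : Fin (m + 1), Integrable fun t =>
      (vandermonde (i.insertNth t (i.removeNth a) : Fin (m + 1) → ℝ)).det *
      (of fun j k => f k ((i.insertNth t (i.removeNth a) : Fin (m + 1) → ℝ) j)).det)
    (k : Fin (m + 1)) :
    Integrable fun t => (1 + |t|) ^ m * (∏ j, min 1 |t - a j|) * f k t := by
  have hainj : Function.Injective a := det_vandermonde_ne_zero_iff.1 (left_ne_zero_of_mul ha)
  have hD := right_ne_zero_of_mul ha
  set D := (of fun j k => f k (a j)).det with hDdef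
  have hb : ∀ i : Fin (m + 1), (vandermonde (i.removeNth a)).det ≠ 0 := fun i =>
    det_vandermonde_ne_zero_iff.2 (hainj.comp Fin.succAbove_right_injective)
  have hbound : Integrable fun t => ∑ i : Fin (m + 1), (|f k (a i)| * (∏ j, (2 + |i.removeNth a j|)) /
      (|(vandermonde (i.removeNth a)).det| * |D|)) *
      ‖(vandermonde (i.insertNth t (i.removeNth a) : Fin (m + 1) → ℝ)).det *
      (of fun j k => f k ((i.insertNth t (i.removeNth a) : Fin (m + 1) → ℝ) j)).det‖ :=
    integrable_finsetSum _ fun i _ => (hint i).norm.const_mul _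
  refine hbound.mono' ?_ (Filter.Eventually.of_forall fun t => ?_)
  · refine AEStronglyMeasurable.mul (Continuous.aestronglyMeasurable (by fun_prop))
      (hf k).aestronglyMeasurable
  · have hk : f k t = (∑ i, f k (a i) * (of fun j l => f l (Function.update a i t j)).det) / D := by
      rw [← mul_det_eq_sum_det_update, mul_div_cancel_right₀ _ hD]
    rw [hk, norm_mul, norm_div, mul_div_assoc', div_le_iff₀ (norm_pos_iff.2 hD), Finset.sum_mul]
    refine (mul_le_mul_of_nonneg_left (norm_sum_le _ _) (norm_nonneg _)).trans ?_
    rw [Finset.mul_sum]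
    refine Finset.sum_le_sum fun i _ => ?_
    rw [Fin.insertNth_removeNth, norm_mul (f k (a i)), norm_mul (vandermonde _).det, ← Fin.insertNth_removeNth,
      Real.norm_eq_abs (vandermonde _).det, abs_det_vandermonde_insertNth]
    set Di := ‖(of fun j l => f l ((i.insertNth t (i.removeNth a) : Fin (m + 1) → ℝ) j)).det‖
    have h1 : ‖(1 + |t|) ^ m * ∏ j, min 1 |t - a j|‖ ≤
        (∏ j, (2 + |i.removeNth a j|)) * ∏ j, |i.removeNth a j - t| := by
      rw [Real.norm_of_nonneg (by positivity), Fin.prod_univ_succAbove _ i]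
      calc (1 + |t|) ^ m * (min 1 |t - a i| * ∏ j, min 1 |t - a (i.succAbove j)|)
          ≤ (1 + |t|) ^ m * (1 * ∏ j, min 1 |t - a (i.succAbove j)|) := by
            gcongr
            exact min_le_left _ _
        _ = ∏ j, ((1 + |t|) * min 1 |t - a (i.succAbove j)|) := by
            rw [Finset.prod_mul_distrib]; simp
        _ ≤ ∏ j, ((2 + |a (i.succAbove j)|) * |a (i.succAbove j) - t|) :=
            Finset.prod_le_prod (fun _ _ => by positivity) fun j _ => one_add_abs_mul_min_le _ _
        _ = _ := by rw [Finset.prod_mul_distrib]; rfl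
    have hv := abs_pos.2 (hb i)
    have hDp := abs_pos.2 hD
    calc _ ≤ ((∏ j, (2 + |i.removeNth a j|)) * ∏ j, |i.removeNth a j - t|) * (‖f k (a i)‖ * Di) :=
          mul_le_mul_of_nonneg_right h1 (by positivity)
      _ = _ := by
          simp only [Real.norm_eq_abs]
          field_simp

/-- The weights of an integrable polynomial ensemble have finite moments up to order `n - 1`. -/
theorem integrable_pow_mul_weight (hf : ∀ k, AEMeasurable (f k))
    (hint : Integrable fun x : Fin (m + 1) → ℝ =>
      (vandermonde x).det * (of fun j k => f k (x j)).det)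
    (hne : ¬ ∀ᵐ x : Fin (m + 1) → ℝ, (vandermonde x).det * (of fun j k => f k (x j)).det = 0)
    (k : Fin (m + 1)) :
    Integrable fun t => (1 + |t|) ^ m * f k t := by
  -- The weight attached to a point `a` degenerates only near the `a j`. A second admissible point
  -- `b` with disjoint coordinates covers those places.
  have hae := Filter.eventually_all.2 fun i => ae_integrable_insertNth hint i
  obtain ⟨a, ha0, ha⟩ := ((Filter.not_eventually.1 hne).and_eventually hae).exists
  have hdisj : ∀ᵐ b : Fin (m + 1) → ℝ, ∀ i j, b i ≠ a j :=
    Filter.eventually_all.2 fun i => Filter.eventually_all.2 fun j =>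
      Measure.ae_eval_ne (μ := fun _ : Fin (m + 1) => (volume : Measure ℝ)) i (a j)
  obtain ⟨b, hb0, hb, hab⟩ :=
    ((Filter.not_eventually.1 hne).and_eventually (hae.and hdisj)).exists
  have h1 := integrable_pow_mul_prod_min_mul hf ha0 ha k
  have h2 := integrable_pow_mul_prod_min_mul hf hb0 hb k
  -- The distance between the two sets of coordinates, capped at one to fit under `min 1`.
  obtain ⟨δ, hδ0, hδ1, hδ⟩ : ∃ δ : ℝ, 0 < δ ∧ δ ≤ 1 ∧ ∀ i j, δ ≤ |b i - a j| := by
    have hne : (Finset.univ : Finset (Fin (m + 1) × Fin (m + 1))).Nonempty := Finset.univ_nonempty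
    refine ⟨min 1 (Finset.univ.inf' hne fun p => |b p.1 - a p.2|), ?_, min_le_left _ _, fun i j => ?_⟩
    · refine lt_min one_pos ((Finset.lt_inf'_iff _).2 fun p _ => ?_)
      exact abs_pos.2 (sub_ne_zero.2 (hab _ _))
    · exact (min_le_right _ _).trans (Finset.inf'_le _ (Finset.mem_univ (i, j)))
  have hlow : ∀ (c : Fin (m + 1) → ℝ) (t : ℝ), (∀ j, δ / 2 ≤ |t - c j|) →
      (δ / 2) ^ (m + 1) ≤ ∏ j, min 1 |t - c j| := fun c t h => by
    have : (δ / 2) ^ (m + 1) = ∏ _j : Fin (m + 1), δ / 2 := by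
      rw [Finset.prod_const, Finset.card_univ, Fintype.card_fin]
    rw [this]
    exact Finset.prod_le_prod (fun _ _ => by positivity) fun j _ => le_min (by linarith) (h j)
  -- No `t` is within `δ / 2` of both some `a j` and some `b i`, so one of the two products is
  -- bounded below.
  have hq : ∀ t, (δ / 2) ^ (m + 1) ≤ (∏ j, min 1 |t - a j|) + ∏ j, min 1 |t - b j| := fun t => by
    have ha0 : 0 ≤ ∏ j, min 1 |t - a j| := by positivity
    have hb0 : 0 ≤ ∏ j, min 1 |t - b j| := by positivity
    by_cases h : ∀ j, δ / 2 ≤ |t - a j|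
    · linarith [hlow a t h]
    · push Not at h
      obtain ⟨j, hj⟩ := h
      have := hlow b t fun i => by
        have h3 := hδ i j
        have h4 : |b i - a j| ≤ |t - b i| + |t - a j| := by
          have := abs_sub_le (b i) t (a j)
          rwa [abs_sub_comm (b i) t] at this
        linarith
      linarith
  refine ((h1.norm.add h2.norm).const_mul ((δ / 2) ^ (m + 1))⁻¹).mono'
    (AEStronglyMeasurable.mul (Continuous.aestronglyMeasurable (by fun_prop))
      (hf k).aestronglyMeasurable) (Filter.Eventually.of_forall fun t => ?_)
  have hδp : 0 < (δ / 2) ^ (m + 1) := by positivity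
  have ha0 : 0 ≤ ∏ j, min 1 |t - a j| := by positivity
  have hb0 : 0 ≤ ∏ j, min 1 |t - b j| := by positivity
  rw [inv_mul_eq_div, le_div_iff₀ hδp]
  simp only [Pi.add_apply, norm_mul, Real.norm_of_nonneg ha0, Real.norm_of_nonneg hb0]
  calc _ ≤ ‖(1 + |t|) ^ m‖ * ‖f k t‖ * ((∏ j, min 1 |t - a j|) + ∏ j, min 1 |t - b j|) := by
        gcongr
        exact hq t
    _ = _ := by ring

end Moments

/-! ### The GUE in orthonormal coordinates -/

section GUE

open Matrix Complex

variable {n : ℕ}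

theorem HermitianMatrix.ofCoords_apply_lt (c : HermitianCoords n) {i j : Fin n} (h : i < j) :
    (HermitianMatrix.ofCoords c : Matrix (Fin n) (Fin n) ℂ) i j = c.2 ⟨(i, j), h⟩ := by
  simp [HermitianMatrix.ofCoords, h]

theorem HermitianMatrix.ofCoords_apply_gt (c : HermitianCoords n) {i j : Fin n} (h : j < i) :
    (HermitianMatrix.ofCoords c : Matrix (Fin n) (Fin n) ℂ) i j = star (c.2 ⟨(j, i), h⟩) := by
  simp [HermitianMatrix.ofCoords, h, h.not_gt]

theorem HermitianMatrix.ofCoords_apply_self (c : HermitianCoords n) (i : Fin n) :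
    (HermitianMatrix.ofCoords c : Matrix (Fin n) (Fin n) ℂ) i i = (c.1 i : ℂ) := by
  simp [HermitianMatrix.ofCoords]

/-- `hermParam` as a map to the space of Hermitian matrices. -/
noncomputable def hermitianOfParam (ξ : Fin n × Fin n → ℝ) : HermitianMatrix n :=
  ⟨hermParam ξ, hermParam_isHermitian ξ⟩

/-- The change of coordinates between the two parametrizations of Hermitian matrices. -/
noncomputable def paramEquivCoords (n : ℕ) : (Fin n × Fin n → ℝ) ≃ₗ[ℝ] HermitianCoords n where
  toFun ξ := (fun j => ξ (j, j), fun p => hermParam ξ p.1.1 p.1.2)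
  map_add' ξ η := by
    ext p
    · rfl
    · have := congrFun (congrFun (hermParam_add_smul ξ η 1) p.1.1) p.1.2
      simpa using this
  map_smul' t ξ := by
    ext p
    · rfl
    · simp [hermParam_apply]
      ring
  -- The real and imaginary parts of an entry are half the sum and half the difference of `ξ (j, k)`
  -- and `ξ (k, j)`, so together they add up to `ξ (j, k)`.
  invFun c p := ((HermitianMatrix.ofCoords c : Matrix (Fin n) (Fin n) ℂ) p.1 p.2).re +
    ((HermitianMatrix.ofCoords c : Matrix (Fin n) (Fin n) ℂ) p.1 p.2).im
  left_inv ξ := by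
    ext ⟨i, j⟩
    change ((HermitianMatrix.ofCoords (fun j => ξ (j, j), fun p => hermParam ξ p.1.1 p.1.2) :
        Matrix (Fin n) (Fin n) ℂ) i j).re +
      ((HermitianMatrix.ofCoords (fun j => ξ (j, j), fun p => hermParam ξ p.1.1 p.1.2) :
        Matrix (Fin n) (Fin n) ℂ) i j).im = ξ (i, j)
    rcases lt_trichotomy i j with h | h | h
    · rw [HermitianMatrix.ofCoords_apply_lt _ h]
      simp [hermParam_apply]
      ring
    · subst h
      rw [HermitianMatrix.ofCoords_apply_self]
      simp
    · rw [HermitianMatrix.ofCoords_apply_gt _ h]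
      simp [hermParam_apply]
      ring
  right_inv c := by
    ext p
    · simp [HermitianMatrix.ofCoords_apply_self]
    · obtain ⟨⟨i, j⟩, h⟩ := p
      simp only at h
      apply Complex.ext <;>
      simp [hermParam_apply, HermitianMatrix.ofCoords_apply_lt _ h, HermitianMatrix.ofCoords_apply_gt _ h] <;>
      ring

theorem ofCoords_paramEquivCoords (ξ : Fin n × Fin n → ℝ) :
    HermitianMatrix.ofCoords (paramEquivCoords n ξ) = hermitianOfParam ξ := by
  ext i j
  rcases lt_trichotomy i j with h | h | h
  · rw [HermitianMatrix.ofCoords_apply_lt _ h]; rfl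
  · subst h
    rw [HermitianMatrix.ofCoords_apply_self]
    simp [paramEquivCoords, hermitianOfParam, hermParam_apply]
    ring
  · rw [HermitianMatrix.ofCoords_apply_gt _ h]
    exact (hermParam_isHermitian ξ).apply i j

theorem continuous_hermitianOfParam : Continuous (hermitianOfParam (n := n)) := by
  refine Continuous.subtype_mk (continuous_matrix fun i j => ?_) _
  simp only [hermParam_apply]
  fun_prop

theorem continuous_ofCoords : Continuous (HermitianMatrix.ofCoords (n := n)) := by
  have h : (HermitianMatrix.ofCoords (n := n)) = hermitianOfParam ∘ (paramEquivCoords n).symm := by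
    ext1 c
    rw [Function.comp_apply, ← ofCoords_paramEquivCoords, LinearEquiv.apply_symm_apply]
  rw [h]
  exact continuous_hermitianOfParam.comp
    (paramEquivCoords n).toContinuousLinearEquiv.symm.continuous

/-- Uniqueness of Haar measure under a linear change of coordinates. The Jacobian `c` is left
implicit because normalization of the GUE determines its contribution. -/
theorem exists_lebesgue_eq_smul_map : ∃ c : NNReal, HermitianMatrix.lebesgue n =
    c • (volume : Measure (Fin n × Fin n → ℝ)).map hermitianOfParam := by
  let L := (paramEquivCoords n).toContinuousLinearEquiv
  have h1 : Measure.IsAddHaarMeasure ((volume : Measure (HermitianCoords n)).map L.symm) := by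
    have : (volume : Measure (HermitianCoords n)).IsAddHaarMeasure :=
      Measure.prod.instIsAddHaarMeasure _ _
    exact ContinuousLinearEquiv.isAddHaarMeasure_map L.symm volume
  refine ⟨Measure.addHaarScalarFactor ((volume : Measure (HermitianCoords n)).map L.symm) volume, ?_⟩
  have h2 := Measure.isAddLeftInvariant_eq_smul
    ((volume : Measure (HermitianCoords n)).map L.symm) volume
  have h3 : (HermitianMatrix.ofCoords (n := n)) ∘ L = hermitianOfParam :=
    funext ofCoords_paramEquivCoords
  rw [← h3, ← Measure.map_map continuous_ofCoords.measurable L.continuous.measurable,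
    ← Measure.map_smul, ← Measure.map_smul, ← h2, Measure.map_map L.continuous.measurable
    L.symm.continuous.measurable]
  have h4 : L ∘ L.symm = id := by ext1 x; simp
  rw [h4, Measure.map_id]
  rfl

theorem gueDensity_hermitianOfParam (ξ : Fin n × Fin n → ℝ) :
    gueDensity n (hermitianOfParam ξ) =
      ((2 : ℝ) ^ ((n : ℝ) / 2) * Real.pi ^ ((n : ℝ) ^ 2 / 2))⁻¹ * gaussWeight ξ := by
  have h : ((hermitianOfParam ξ : Matrix (Fin n) (Fin n) ℂ) *
      (hermitianOfParam ξ : Matrix (Fin n) (Fin n) ℂ)).trace = _ := trace_hermParam_sq ξ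
  rw [gueDensity, h, ofReal_re, gaussWeight]

theorem continuous_gueDensity : Continuous (gueDensity n) := by
  unfold gueDensity
  refine continuous_const.mul (Real.continuous_exp.comp (continuous_const.mul
    (Complex.continuous_re.comp (Continuous.matrix_trace ?_))))
  exact continuous_subtype_val.matrix_mul continuous_subtype_val

theorem gueDensity_nonneg (A : HermitianMatrix n) : 0 ≤ gueDensity n A := by
  unfold gueDensity; positivity

/-- Expectations with respect to the GUE as Gaussian integrals. -/
theorem integral_gueMeasure [IsProbabilityMeasure (gueMeasure n)] {F : HermitianMatrix n → ℂ}
    (hF : Continuous F) :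
    (∫ A, F A ∂(gueMeasure n)) * ∫ ξ : Fin n × Fin n → ℝ, (gaussWeight ξ : ℂ) =
      ∫ ξ : Fin n × Fin n → ℝ, F (hermitianOfParam ξ) * (gaussWeight ξ : ℂ) := by
  obtain ⟨c, hc⟩ := exists_lebesgue_eq_smul_map (n := n)
  set K : ℝ := ((2 : ℝ) ^ ((n : ℝ) / 2) * Real.pi ^ ((n : ℝ) ^ 2 / 2))⁻¹
  have key : ∀ G : HermitianMatrix n → ℂ, Continuous G → ∫ A, G A ∂(gueMeasure n) =
      (c : ℂ) * K * ∫ ξ : Fin n × Fin n → ℝ, G (hermitianOfParam ξ) * (gaussWeight ξ : ℂ) := by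
    intro G hG
    rw [gueMeasure, integral_withDensity_eq_integral_toReal_smul
      (continuous_gueDensity.measurable.ennreal_ofReal) (by simp), hc]
    simp_rw [ENNReal.toReal_ofReal (gueDensity_nonneg _)]
    rw [integral_smul_nnreal_measure, integral_map (f := fun A : HermitianMatrix n => gueDensity n A • G A)
      continuous_hermitianOfParam.aemeasurable
      (continuous_gueDensity.smul hG).aestronglyMeasurable]
    simp_rw [gueDensity_hermitianOfParam]
    rw [NNReal.smul_def, Complex.real_smul, mul_assoc]
    refine congrArg (((c : ℝ) : ℂ) * ·) (Eq.trans (integral_congr_ae (Filter.Eventually.of_forall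
      fun ξ => ?_)) (integral_const_mul (K : ℂ) _))
    change ((K * gaussWeight ξ : ℝ) : ℂ) * G (hermitianOfParam ξ) = _
    push_cast
    ring
  -- Total mass one fixes the product of `c`, `K` and the Gaussian integral.
  have h1 := key (fun _ => (1 : ℂ)) continuous_const
  simp only [integral_const, probReal_univ, one_smul, one_mul] at h1
  rw [key F hF]
  linear_combination (-∫ ξ : Fin n × Fin n → ℝ, F (hermitianOfParam ξ) * (gaussWeight ξ : ℂ)) * h1

/-- The expected product of reciprocal characteristic determinants of a deformed GUE matrix. -/
theorem vdm_eigs_mul_integral_gueMeasure [IsProbabilityMeasure (gueMeasure n)] {N : ℕ}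
    (B : HermitianMatrix n) {z : Fin N → ℂ} (hz : ∀ k, (z k).im ≠ 0) (hinj : z.Injective) :
    vdm (fun i => (B.eigs i : ℂ)) *
        (∫ A, cauchyProd z (fun i => ((B + A).eigs i : ℂ)) ∂(gueMeasure n)) *
        (∫ ζ : Fin n → ℝ, (gaussWeight ζ : ℂ)) =
      ∫ ζ : Fin n → ℝ, vdm (fun i => (B.eigs i : ℂ) + (ζ i : ℂ)) *
          cauchyProd z (fun i => (B.eigs i : ℂ) + (ζ i : ℂ)) * (gaussWeight ζ : ℂ) := by
  have h1 := vdm_eigenvalues_mul_integral_resProd (M := (B : Matrix (Fin n) (Fin n) ℂ)) B.2 hz hinj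
  have hres : ∀ A : HermitianMatrix n, cauchyProd z (fun i => (A.eigs i : ℂ)) =
      resProd z (A : Matrix (Fin n) (Fin n) ℂ) := fun A =>
    (IsHermitian.resProd_eq (M := (A : Matrix (Fin n) (Fin n) ℂ)) A.2 z).symm
  simp_rw [hres]
  have hcont : Continuous fun A : HermitianMatrix n =>
      resProd z ((B + A : HermitianMatrix n) : Matrix (Fin n) (Fin n) ℂ) := by
    refine continuous_finsetProd _ fun k _ => Continuous.inv₀ (Continuous.matrix_det
      (continuous_const.sub (continuous_subtype_val.comp (continuous_const.add continuous_id))))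
      fun A => IsHermitian.det_scalar_sub_ne_zero (B + A).2 (hz k)
  have h2 := integral_gueMeasure hcont
  have hc : (∫ ξ : Fin n × Fin n → ℝ, (gaussWeight ξ : ℂ)) ≠ 0 := by
    rw [integral_complex_ofReal]
    exact_mod_cast integral_gaussWeight_pos.ne'
  have h3 : ∀ ξ : Fin n × Fin n → ℝ, resProd z ((B + hermitianOfParam ξ : HermitianMatrix n) :
      Matrix (Fin n) (Fin n) ℂ) = resProd z ((B : Matrix (Fin n) (Fin n) ℂ) + hermParam ξ) :=
    fun ξ => rfl
  simp_rw [h3] at h2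
  rw [← h2] at h1
  refine mul_left_cancel₀ hc (Eq.trans ?_ h1)
  change _ = vdm (fun i => (B.eigs i : ℂ)) * _ * _
  ring

end GUE

/-! ### The determinant of the weights under permutations -/

section WeightDeterminant

open Matrix

/-- The determinant `det [w_k(x_j)]`. -/
noncomputable def weightDet {n : ℕ} (w : Fin n → ℝ → ℝ) (x : Fin n → ℝ) : ℝ :=
  (of fun j k => w k (x j)).det

variable {n : ℕ} {f : Fin n → ℝ → ℝ}

theorem weightDet_eq_sum (w : Fin n → ℝ → ℝ) (x : Fin n → ℝ) :
    weightDet w x = ∑ σ : Equiv.Perm (Fin n), (Equiv.Perm.sign σ : ℤ) * ∏ i, w (σ i) (x i) := by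
  rw [weightDet, ← det_transpose, det_apply']
  rfl

theorem weightDet_comp_perm (w : Fin n → ℝ → ℝ) (σ : Equiv.Perm (Fin n)) (x : Fin n → ℝ) :
    weightDet w (x ∘ σ) = ((Equiv.Perm.sign σ : ℤ) : ℝ) * weightDet w x :=
  det_permute σ (of fun j k => w k (x j))

theorem det_vandermonde_comp_perm (σ : Equiv.Perm (Fin n)) (x : Fin n → ℝ) :
    (vandermonde (x ∘ σ)).det = ((Equiv.Perm.sign σ : ℤ) : ℝ) * (vandermonde x).det :=
  det_permute σ (vandermonde x)

theorem vdm_ofReal (x : Fin n → ℝ) : vdm (fun i => (x i : ℂ)) = ((vandermonde x).det : ℂ) := by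
  rw [vdm, det_vandermonde, det_vandermonde]
  push_cast
  rfl

theorem continuous_det_vandermonde : Continuous fun x : Fin n → ℝ => (vandermonde x).det := by
  simp only [det_vandermonde]
  fun_prop

theorem sign_mul_self_real (σ : Equiv.Perm (Fin n)) :
    ((Equiv.Perm.sign σ : ℤ) : ℝ) * ((Equiv.Perm.sign σ : ℤ) : ℝ) = 1 := by
  rcases Int.units_eq_one_or (Equiv.Perm.sign σ) with h | h <;> simp [h]

theorem polynomialEnsembleDensity_comp_perm (w : Fin n → ℝ → ℝ) (Z : ℝ) (σ : Equiv.Perm (Fin n))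
    (x : Fin n → ℝ) :
    polynomialEnsembleDensity w Z (x ∘ σ) = polynomialEnsembleDensity w Z x := by
  change Z⁻¹ * (vandermonde (x ∘ σ)).det * weightDet w (x ∘ σ) =
    Z⁻¹ * (vandermonde x).det * weightDet w x
  rw [weightDet_comp_perm, det_vandermonde_comp_perm]
  linear_combination (Z⁻¹ * (vandermonde x).det * weightDet w x) * sign_mul_self_real σ

theorem aemeasurable_weightDet (hf : ∀ k, AEMeasurable (f k)) : AEMeasurable (weightDet f) := by
  have h : weightDet f = fun x =>
      ∑ σ : Equiv.Perm (Fin n), (Equiv.Perm.sign σ : ℤ) * ∏ i, f (σ i) (x i) :=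
    funext (weightDet_eq_sum f)
  rw [h]
  refine Finset.aemeasurable_fun_sum _ fun σ _ => AEMeasurable.const_mul ?_ _
  exact Finset.aemeasurable_fun_prod _ fun i _ => (hf (σ i)).comp_quasiMeasurePreserving
    (Measure.quasiMeasurePreserving_eval (fun _ : Fin n => (volume : Measure ℝ)) i)

theorem aemeasurable_polynomialEnsembleDensity (hf : ∀ k, AEMeasurable (f k)) (Z : ℝ) :
    AEMeasurable (polynomialEnsembleDensity f Z) :=
  ((continuous_const.mul continuous_det_vandermonde).aemeasurable).mul (aemeasurable_weightDet hf)

theorem continuous_weightDet (hf : ∀ k, Continuous (f k)) : Continuous (weightDet f) :=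
  Continuous.matrix_det (continuous_matrix fun i k => (hf k).comp (continuous_apply i))

theorem measurePreserving_comp_perm (σ : Equiv.Perm (Fin n)) :
    MeasurePreserving (fun x : Fin n → ℝ => x ∘ σ) := by
  have h := volume_measurePreserving_piCongrLeft (fun _ : Fin n => ℝ) σ.symm
  convert! h using 1
  ext x i
  have := MeasurableEquiv.piCongrLeft_apply_apply (β := fun _ : Fin n => ℝ) σ.symm x (σ i)
  simpa using this.symm

/-- Almost every vector has pairwise distinct coordinates. -/
theorem ae_det_vandermonde_ne_zero : ∀ᵐ x : Fin n → ℝ, (vandermonde x).det ≠ 0 := by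
  have h : ∀ i j : Fin n, ∀ᵐ x : Fin n → ℝ, i ≠ j → x i ≠ x j := fun i j => by
    by_cases hij : i = j
    · simp [hij]
    let S : Submodule ℝ (Fin n → ℝ) := LinearMap.ker (LinearMap.proj (R := ℝ) (φ := fun _ => ℝ) i -
      LinearMap.proj (R := ℝ) (φ := fun _ => ℝ) j)
    have hS : S ≠ ⊤ := fun hS => by
      have : Pi.single i (1 : ℝ) ∈ S := hS ▸ Submodule.mem_top
      simp [S, hij] at this
    refine measure_mono_null (fun x hx => ?_) (Measure.addHaar_submodule volume S hS)
    have hx' : x i = x j := by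
      by_contra hne
      exact hx fun _ => hne
    simp [S, hx']
  filter_upwards [ae_all_iff.2 fun i => ae_all_iff.2 (h i)] with x hx
  exact det_vandermonde_ne_zero_iff.2 fun i j hij => by_contra fun hne => hx i j hne hij

end WeightDeterminant

/-! ### Gaussian convolution of the weights and Fubini -/

section Convolution

open Matrix

theorem integrable_of_pow_mul {p : ℕ} {f : ℝ → ℝ} (hf : AEMeasurable f)
    (hint : Integrable fun t => (1 + |t|) ^ p * f t) : Integrable f := by
  refine hint.norm.mono' hf.aestronglyMeasurable (Filter.Eventually.of_forall fun t => ?_)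
  have h0 : (1 : ℝ) ≤ (1 + |t|) ^ p := one_le_pow₀ (by linarith [abs_nonneg t])
  rw [norm_mul, Real.norm_of_nonneg (zero_le_one.trans h0)]
  exact le_mul_of_one_le_left (norm_nonneg _) h0

theorem norm_exp_neg_sq_le (t : ℝ) : ‖Real.exp (-(1 / 2) * t ^ 2)‖ ≤ 1 := by
  rw [Real.norm_of_nonneg (Real.exp_pos _).le]
  exact Real.exp_le_one_iff.2 (by nlinarith [sq_nonneg t])

theorem integrable_exp_mul_comp_sub {f : ℝ → ℝ} (hf : Integrable f) (y : ℝ) :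
    Integrable fun x => Real.exp (-(1 / 2) * x ^ 2) * f (y - x) :=
  (hf.comp_sub_left y).bdd_mul (c := 1) (Continuous.aestronglyMeasurable (by fun_prop))
    (Filter.Eventually.of_forall norm_exp_neg_sq_le)

/-- A change of variables moves `y` into the Gaussian, so the integrand is continuous in `y`
although `f` need not be, with `|f|` as majorant. -/
theorem continuous_gaussianConvolution {f : ℝ → ℝ} (hf : Integrable f) :
    Continuous (gaussianConvolution f) := by
  have h : gaussianConvolution f = fun y => ∫ x, Real.exp (-(1 / 2) * (y - x) ^ 2) * f x := by
    ext y
    rw [gaussianConvolution,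
      ← integral_sub_left_eq_self (fun x => Real.exp (-(1 / 2) * (y - x) ^ 2) * f x) volume y]
    simp
  rw [h]
  refine continuous_of_dominated (bound := fun x => ‖f x‖) (fun y => ?_)
    (fun y => Filter.Eventually.of_forall fun x => ?_) hf.norm
    (Filter.Eventually.of_forall fun x => by fun_prop)
  · exact AEStronglyMeasurable.mul (Continuous.aestronglyMeasurable (by fun_prop)) hf.1
  · rw [norm_mul]
    exact mul_le_of_le_one_left (norm_nonneg _) (norm_exp_neg_sq_le _)

variable {n : ℕ} {f : Fin n → ℝ → ℝ}

/-- The determinant of the convolved weights is the convolution of the determinant. -/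
theorem weightDet_gaussianConvolution (hf : ∀ k, Integrable (f k)) (x : Fin n → ℝ) :
    weightDet (fun k => gaussianConvolution (f k)) x =
      ∫ y : Fin n → ℝ, weightDet f (x - y) * gaussWeight y := by
  have h1 : ∀ y : Fin n → ℝ, weightDet f (x - y) * gaussWeight y =
      ∑ σ : Equiv.Perm (Fin n), (Equiv.Perm.sign σ : ℤ) *
        ∏ i, (Real.exp (-(1 / 2) * y i ^ 2) * f (σ i) (x i - y i)) := fun y => by
    rw [weightDet_eq_sum, gaussWeight_eq_prod, Finset.sum_mul]
    refine Finset.sum_congr rfl fun σ _ => ?_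
    rw [Finset.prod_mul_distrib]
    simp only [Pi.sub_apply]
    ring
  simp_rw [h1]
  rw [integral_finsetSum _ fun σ _ => (Integrable.fintype_prod fun i =>
    integrable_exp_mul_comp_sub (hf (σ i)) (x i)).const_mul _, weightDet_eq_sum]
  refine Finset.sum_congr rfl fun σ _ => ?_
  rw [integral_const_mul, integral_fintype_prod_volume_eq_prod
    (fun i t => Real.exp (-(1 / 2) * t ^ 2) * f (σ i) (x i - t))]
  rfl

/-- Every Leibniz term has degree at most `n - 1` in each variable, which is the order of the
available moments. -/
theorem abs_det_vandermonde_le (x : Fin n → ℝ) :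
    |(vandermonde x).det| ≤ n.factorial * ∏ i, (1 + |x i|) ^ (n - 1) := by
  rw [det_apply']
  refine (Finset.abs_sum_le_sum_abs _ _).trans ?_
  have : ∀ σ : Equiv.Perm (Fin n), |((Equiv.Perm.sign σ : ℤ) : ℝ) * ∏ i, vandermonde x (σ i) i| ≤
      ∏ i, (1 + |x i|) ^ (n - 1) := fun σ => by
    have hs : |((Equiv.Perm.sign σ : ℤ) : ℝ)| = 1 := by
      rcases Int.units_eq_one_or (Equiv.Perm.sign σ) with h | h <;> simp [h]
    rw [abs_mul, hs, one_mul, Finset.abs_prod, ← Equiv.prod_comp σ fun i => (1 + |x i|) ^ (n - 1)]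
    refine Finset.prod_le_prod (fun _ _ => abs_nonneg _) fun i _ => ?_
    rw [vandermonde_apply, abs_pow]
    have h0 := abs_nonneg (x (σ i))
    exact (pow_le_pow_left₀ h0 (by linarith) _).trans
      (pow_le_pow_right₀ (by linarith) (by have := i.2; omega))
  refine (Finset.sum_le_sum fun σ _ => this σ).trans_eq ?_
  rw [Finset.sum_const, Finset.card_univ, Fintype.card_perm, Fintype.card_fin, nsmul_eq_mul]

/-- `1 + |x + y| ≤ (1 + |x|) (1 + |y|)` separates the variables for Fubini. -/
theorem abs_det_vandermonde_add_le (x y : Fin n → ℝ) :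
    |(vandermonde (x + y)).det| ≤ n.factorial *
      ((∏ i, (1 + |x i|) ^ (n - 1)) * ∏ i, (1 + |y i|) ^ (n - 1)) := by
  refine (abs_det_vandermonde_le _).trans ?_
  rw [← Finset.prod_mul_distrib]
  gcongr with i
  rw [← mul_pow]
  gcongr
  have := abs_add_le (x i) (y i)
  have := mul_nonneg (abs_nonneg (x i)) (abs_nonneg (y i))
  rw [Pi.add_apply]
  nlinarith

theorem integrable_prod_pow_mul_weightDet
    (hint : ∀ k, Integrable fun t => (1 + |t|) ^ (n - 1) * f k t) :
    Integrable fun x : Fin n → ℝ => (∏ i, (1 + |x i|) ^ (n - 1)) * weightDet f x := by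
  have h1 : ∀ x : Fin n → ℝ, (∏ i, (1 + |x i|) ^ (n - 1)) * weightDet f x =
      ∑ σ : Equiv.Perm (Fin n), (Equiv.Perm.sign σ : ℤ) *
        ∏ i, ((1 + |x i|) ^ (n - 1) * f (σ i) (x i)) := fun x => by
    rw [weightDet_eq_sum, Finset.mul_sum]
    refine Finset.sum_congr rfl fun σ _ => ?_
    rw [Finset.prod_mul_distrib]
    ring
  simp_rw [h1]
  exact integrable_finsetSum _ fun σ _ => (Integrable.fintype_prod fun i => hint (σ i)).const_mul _

theorem integrable_prod_pow_mul_gaussWeight (p : ℕ) :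
    Integrable fun y : Fin n → ℝ => (∏ i, (1 + |y i|) ^ p) * gaussWeight y := by
  have hc := continuous_gaussWeight (ι := Fin n)
  refine (integrable_pow_mul_gaussWeight (ι := Fin n) (p * n)).mono'
    (Continuous.aestronglyMeasurable (by fun_prop)) (Filter.Eventually.of_forall fun y => ?_)
  rw [Real.norm_of_nonneg (mul_nonneg (by positivity) (gaussWeight_pos y).le)]
  refine mul_le_mul_of_nonneg_right ?_ (gaussWeight_pos y).le
  calc ∏ i, (1 + |y i|) ^ p ≤ ∏ _i : Fin n, (1 + ‖y‖) ^ p := by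
        gcongr with i
        exact norm_le_pi_norm y i
    _ = _ := by rw [Finset.prod_const, Finset.card_univ, Fintype.card_fin, pow_mul]

/-- Joint integrability of the polynomial ensemble weight against a shifted test function. -/
theorem integrable_weightDet_mul_shift (hint : ∀ k, Integrable fun t => (1 + |t|) ^ (n - 1) * f k t)
    {φ : (Fin n → ℝ) → ℂ} (hφ : Continuous φ) {C : ℝ} (hC : ∀ x, ‖φ x‖ ≤ C) :
    Integrable fun p : (Fin n → ℝ) × (Fin n → ℝ) => (weightDet f p.1 : ℂ) *
      (((vandermonde (p.1 + p.2)).det : ℂ) * φ (p.1 + p.2) * (gaussWeight p.2 : ℂ)) := by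
  have h1 := ((integrable_prod_pow_mul_weightDet hint).ofReal (𝕜 := ℂ)).mul_prod
    ((integrable_prod_pow_mul_gaussWeight (n := n) (n - 1)).ofReal (𝕜 := ℂ))
  let W : (Fin n → ℝ) × (Fin n → ℝ) → ℝ := fun p =>
    (∏ i, (1 + |p.1 i|) ^ (n - 1)) * ∏ i, (1 + |p.2 i|) ^ (n - 1)
  have hW : ∀ p, 0 < W p := fun p => by positivity
  have hWc : Continuous W := by fun_prop
  have hΔ : Continuous fun p : (Fin n → ℝ) × (Fin n → ℝ) => (vandermonde (p.1 + p.2)).det :=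
    continuous_det_vandermonde.comp (continuous_fst.add continuous_snd)
  have hq : Continuous fun p : (Fin n → ℝ) × (Fin n → ℝ) =>
      (((vandermonde (p.1 + p.2)).det / W p : ℝ) : ℂ) * φ (p.1 + p.2) :=
    (Complex.continuous_ofReal.comp (hΔ.div hWc fun p => (hW p).ne')).mul
      (hφ.comp (continuous_fst.add continuous_snd))
  -- The Vandermonde factor divided by `W` is bounded, and `W` times the remaining weights is an
  -- integrable product function.
  refine (h1.mul_bdd (c := n.factorial * C) hq.aestronglyMeasurable
    (Filter.Eventually.of_forall fun p => ?_)).congr (Filter.Eventually.of_forall fun p => ?_)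
  · rw [norm_mul, Complex.norm_real, Real.norm_eq_abs, abs_div, abs_of_pos (hW p)]
    refine mul_le_mul ?_ (hC _) (norm_nonneg _) (by positivity)
    rw [div_le_iff₀ (hW p)]
    exact abs_det_vandermonde_add_le _ _
  · have h2 : (W p : ℂ) ≠ 0 := by exact_mod_cast (hW p).ne'
    have h3 : (W p : ℂ) = ((∏ i, (1 + |p.1 i|) ^ (n - 1) : ℝ) : ℂ) *
      ((∏ i, (1 + |p.2 i|) ^ (n - 1) : ℝ) : ℂ) := by push_cast [W]; rfl
    simp only [Complex.ofReal_div, RCLike.ofReal_mul]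
    change ((∏ i, (1 + |p.1 i|) ^ (n - 1) : ℝ) : ℂ) * (weightDet f p.1 : ℂ) *
      (((∏ i, (1 + |p.2 i|) ^ (n - 1) : ℝ) : ℂ) * (gaussWeight p.2 : ℂ)) * _ = _
    field_simp
    rw [h3]
    ring

/-- Fubini's theorem and the shear `(x, y) ↦ (x - y, y)`. -/
theorem integrable_and_integral_weightDet_mul_shift (hf : ∀ k, Integrable (f k))
    (hint : ∀ k, Integrable fun t => (1 + |t|) ^ (n - 1) * f k t)
    {φ : (Fin n → ℝ) → ℂ} (hφ : Continuous φ) {C : ℝ} (hC : ∀ x, ‖φ x‖ ≤ C) :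
    Integrable (fun x : Fin n → ℝ => ((vandermonde x).det : ℂ) * φ x *
      (weightDet (fun k => gaussianConvolution (f k)) x : ℂ)) ∧
    ∫ x : Fin n → ℝ, (weightDet f x : ℂ) * ∫ y : Fin n → ℝ,
      ((vandermonde (x + y)).det : ℂ) * φ (x + y) * (gaussWeight y : ℂ) =
    ∫ x : Fin n → ℝ, ((vandermonde x).det : ℂ) * φ x *
      (weightDet (fun k => gaussianConvolution (f k)) x : ℂ) := by
  have hK := integrable_weightDet_mul_shift hint hφ hC
  set K : (Fin n → ℝ) × (Fin n → ℝ) → ℂ := fun p => (weightDet f p.1 : ℂ) *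
      (((vandermonde (p.1 + p.2)).det : ℂ) * φ (p.1 + p.2) * (gaussWeight p.2 : ℂ)) with hKdef
  have hs := measurePreserving_sub_prod (volume : Measure (Fin n → ℝ)) (volume : Measure (Fin n → ℝ))
  have hKs : Integrable (fun p : (Fin n → ℝ) × (Fin n → ℝ) => K (p.1 - p.2, p.2)) :=
    hs.integrable_comp_of_integrable hK
  have hin : ∀ x : Fin n → ℝ, ∫ y : Fin n → ℝ, K (x - y, y) = ((vandermonde x).det : ℂ) * φ x *
      (weightDet (fun k => gaussianConvolution (f k)) x : ℂ) := fun x => by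
    rw [weightDet_gaussianConvolution hf, ← integral_complex_ofReal, ← integral_const_mul]
    refine integral_congr_ae (Filter.Eventually.of_forall fun y => ?_)
    simp only [hKdef, sub_add_cancel]
    push_cast
    ring
  have hK2 := hKs.integral_prod_left
  simp_rw [hin] at hK2
  refine ⟨hK2, ?_⟩
  have e1 := integral_prod K hK
  have e2 := integral_prod _ hKs
  have e3 : ∫ p : (Fin n → ℝ) × (Fin n → ℝ), K (p.1 - p.2, p.2) = ∫ p, K p := by
    have h4 : AEStronglyMeasurable K ((volume : Measure (Fin n → ℝ)).prod volume) := hK.1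
    rw [← hs.map_eq] at h4
    have h5 := integral_map hs.measurable.aemeasurable h4
    rw [hs.map_eq] at h5
    exact h5.symm
  simp_rw [hin] at e2
  rw [← e2]
  refine Eq.trans ?_ (e1.symm.trans e3.symm)
  simp only [hKdef, integral_const_mul]

end Convolution

/-! ### The law of the eigenvalues in random order -/

section EigenvalueLaw

open Matrix

variable {n : ℕ} {Ω : Type*} [MeasurableSpace Ω] {P : Measure Ω}

instance HermitianMatrix.secondCountableTopology (n : ℕ) :
    SecondCountableTopology (HermitianMatrix n) := by
  have : SecondCountableTopology (Matrix (Fin n) (Fin n) ℂ) :=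
    inferInstanceAs (SecondCountableTopology (Fin n → Fin n → ℂ))
  exact TopologicalSpace.Subtype.secondCountableTopology _

theorem aemeasurable_eigs_comp_perm {X : Ω → HermitianMatrix n} (hX : AEMeasurable X P)
    (σ : Equiv.Perm (Fin n)) : AEMeasurable (fun ω => (X ω).eigs ∘ σ) P :=
  (measurable_comp_perm σ).comp_aemeasurable (measurable_eigs.comp_aemeasurable hX)

theorem isProbabilityMeasure_eigenvalueLaw [IsProbabilityMeasure P] {X : Ω → HermitianMatrix n}
    (hX : AEMeasurable X P) : IsProbabilityMeasure (eigenvalueLaw P X) := by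
  constructor
  have h : ∀ σ : Equiv.Perm (Fin n), P.map (fun ω => (X ω).eigs ∘ σ) Set.univ = 1 := fun σ =>
    (Measure.isProbabilityMeasure_map (aemeasurable_eigs_comp_perm hX σ)).measure_univ
  rw [eigenvalueLaw, Measure.smul_apply, Measure.finsetSum_apply, Finset.sum_congr rfl fun σ _ => h σ,
    Finset.sum_const, Finset.card_univ, Fintype.card_perm, Fintype.card_fin, nsmul_one, smul_eq_mul]
  exact ENNReal.inv_mul_cancel (by exact_mod_cast n.factorial_ne_zero) (ENNReal.natCast_ne_top _)

theorem map_comp_perm_eigenvalueLaw {X : Ω → HermitianMatrix n} (hX : AEMeasurable X P)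
    (τ : Equiv.Perm (Fin n)) :
    (eigenvalueLaw P X).map (fun x => x ∘ τ) = eigenvalueLaw P X := by
  have hτ := measurable_comp_perm τ
  rw [eigenvalueLaw, Measure.map_smul, Measure.map_finset_sum hτ.aemeasurable]
  congr 1
  refine Fintype.sum_equiv (Equiv.mulRight τ) _ _ fun σ => ?_
  rw [AEMeasurable.map_map_of_aemeasurable hτ.aemeasurable (aemeasurable_eigs_comp_perm hX σ)]
  rfl

theorem integral_eigenvalueLaw {X : Ω → HermitianMatrix n} (hX : AEMeasurable X P)
    {F : (Fin n → ℝ) → ℂ} (hF : Measurable F)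
    (hsymm : ∀ (σ : Equiv.Perm (Fin n)) x, F (x ∘ σ) = F x)
    (hint : Integrable (fun ω => F (X ω).eigs) P) :
    ∫ x, F x ∂(eigenvalueLaw P X) = ∫ ω, F (X ω).eigs ∂P := by
  have hi : ∀ σ : Equiv.Perm (Fin n), Integrable F (P.map (fun ω => (X ω).eigs ∘ σ)) := fun σ => by
    rw [integrable_map_measure hF.aestronglyMeasurable (aemeasurable_eigs_comp_perm hX σ)]
    exact hint.congr (Filter.Eventually.of_forall fun ω => (hsymm σ _).symm)
  have he : ∀ σ : Equiv.Perm (Fin n), ∫ x, F x ∂(P.map (fun ω => (X ω).eigs ∘ σ)) =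
      ∫ ω, F (X ω).eigs ∂P := fun σ => by
    rw [integral_map (aemeasurable_eigs_comp_perm hX σ) hF.aestronglyMeasurable]
    simp_rw [hsymm σ]
  rw [eigenvalueLaw, integral_smul_measure, integral_finsetSum_measure fun σ _ => hi σ,
    Finset.sum_congr rfl fun σ _ => he σ, Finset.sum_const, Finset.card_univ, Fintype.card_perm,
    Fintype.card_fin, ENNReal.toReal_inv, ENNReal.toReal_natCast, ← Nat.cast_smul_eq_nsmul ℝ, smul_smul,
    inv_mul_cancel₀ (by exact_mod_cast n.factorial_ne_zero), one_smul]

/-- A null set of an average of laws is null for each of them; the identity permutation gives the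
claim. -/
theorem ae_eigs_of_ae_eigenvalueLaw {X : Ω → HermitianMatrix n} (hX : AEMeasurable X P)
    {p : (Fin n → ℝ) → Prop} (h : ∀ᵐ x ∂(eigenvalueLaw P X), p x) :
    ∀ᵐ ω ∂P, p (X ω).eigs := by
  have h0 : ∀ᵐ x ∂(P.map fun ω => (X ω).eigs ∘ (1 : Equiv.Perm (Fin n))), p x := by
    rw [ae_iff] at h ⊢
    rw [eigenvalueLaw, Measure.smul_apply, Measure.finsetSum_apply, smul_eq_mul, mul_eq_zero,
      Finset.sum_eq_zero_iff] at h
    exact (h.resolve_left (by simp)) 1 (Finset.mem_univ _)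
  exact ae_of_ae_map (aemeasurable_eigs_comp_perm hX 1) h0

end EigenvalueLaw

/-! ### Identifying a symmetric density of unknown sign -/

section Symmetrization

open Matrix

variable {n : ℕ}

theorem map_comp_perm_withDensity {ρ : (Fin n → ℝ) → ENNReal} (hρ : Measurable ρ)
    (hsymm : ∀ (σ : Equiv.Perm (Fin n)) x, ρ (x ∘ σ) = ρ x) (σ : Equiv.Perm (Fin n)) :
    (volume.withDensity ρ).map (fun x => x ∘ σ) = volume.withDensity ρ := by
  ext s hs
  rw [Measure.map_apply (measurable_comp_perm σ) hs, withDensity_apply _ hs,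
    withDensity_apply _ (measurable_comp_perm σ hs),
    ← (measurePreserving_comp_perm σ).setLIntegral_comp_preimage hs hρ]
  simp_rw [hsymm σ]

/-- A symmetric density is identified by the integrals of Cauchy products, and is then
automatically nonnegative. -/
theorem ae_nonneg_and_eq_withDensity {μ : Measure (Fin n → ℝ)} [IsFiniteMeasure μ]
    (hμ : ∀ σ : Equiv.Perm (Fin n), μ.map (fun x => x ∘ σ) = μ) {ρ : (Fin n → ℝ) → ℝ}
    (hρ : Measurable ρ) (hρi : Integrable ρ)
    (hsymm : ∀ (σ : Equiv.Perm (Fin n)) x, ρ (x ∘ σ) = ρ x)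
    (h : ∀ (N : ℕ) (z : Fin N → ℂ), (∀ k, (z k).im ≠ 0) → z.Injective →
      ∫ x, cauchyProd z (fun i => (x i : ℂ)) ∂μ =
        ∫ x : Fin n → ℝ, cauchyProd z (fun i => (x i : ℂ)) * (ρ x : ℂ)) :
    (∀ᵐ x, 0 ≤ ρ x) ∧ μ = volume.withDensity fun x => ENNReal.ofReal (ρ x) := by
  have hm1 : Measurable fun x => ENNReal.ofReal (ρ x) := hρ.ennreal_ofReal
  have hm2 : Measurable fun x => ENNReal.ofReal (-ρ x) := hρ.neg.ennreal_ofReal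
  set μ1 := volume.withDensity fun x => ENNReal.ofReal (ρ x) with hμ1
  set μ2 := volume.withDensity fun x => ENNReal.ofReal (-ρ x) with hμ2
  have hf1 : IsFiniteMeasure μ1 := isFiniteMeasure_withDensity_ofReal hρi.2
  have hf2 : IsFiniteMeasure μ2 := isFiniteMeasure_withDensity_ofReal hρi.neg.2
  have hs1 : ∀ σ : Equiv.Perm (Fin n), μ1.map (fun x => x ∘ σ) = μ1 :=
    map_comp_perm_withDensity hm1 fun σ x => by rw [hsymm]
  have hs2 : ∀ σ : Equiv.Perm (Fin n), μ2.map (fun x => x ∘ σ) = μ2 :=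
    map_comp_perm_withDensity hm2 fun σ x => by rw [hsymm]
  -- With the negative part moved to the left, both sides are finite symmetric positive measures, so
  -- Cauchy products determine them.
  have heq : μ + μ2 = μ1 := by
    refine measure_eq_of_map_orderVector_eq (fun σ => ?_) hs1 (map_orderVector_eq ?_)
    · rw [Measure.map_add _ _ (measurable_comp_perm σ), hμ, hs2]
    intro N z hz hinj
    obtain ⟨C, -, hC⟩ := exists_inv_im_bound z
    have hφ := continuous_cauchyProd_ofReal (n := n) hz
    have hφb := norm_cauchyProd_ofReal_le (n := n) hz hC
    have hφi : ∀ ν : Measure (Fin n → ℝ), IsFiniteMeasure ν →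
        Integrable (fun x : Fin n → ℝ => cauchyProd z (fun i => (x i : ℂ))) ν := fun ν _ =>
      Integrable.of_bound hφ.aestronglyMeasurable _ (Filter.Eventually.of_forall hφb)
    rw [integral_add_measure (hφi _ inferInstance) (hφi _ hf2), h N z hz hinj,
      integral_withDensity_eq_integral_toReal_smul hm1 (by simp),
      integral_withDensity_eq_integral_toReal_smul hm2 (by simp)]
    have hi : Integrable fun x : Fin n → ℝ => cauchyProd z (fun i => (x i : ℂ)) * (ρ x : ℂ) :=
      hρi.ofReal.bdd_mul hφ.aestronglyMeasurable (Filter.Eventually.of_forall hφb)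
    have hi2 : Integrable fun x : Fin n → ℝ =>
        (ENNReal.ofReal (-ρ x)).toReal • cauchyProd z (fun i => (x i : ℂ)) :=
      (integrable_withDensity_iff_integrable_smul' hm2 (by simp)).1 (hφi _ hf2)
    rw [← integral_add hi hi2]
    refine integral_congr_ae (Filter.Eventually.of_forall fun x => ?_)
    simp only [Complex.real_smul]
    rcases le_total 0 (ρ x) with h0 | h0
    · rw [ENNReal.toReal_ofReal h0, ENNReal.ofReal_of_nonpos (by linarith)]
      simp [mul_comm]
    · rw [ENNReal.toReal_ofReal (by linarith), ENNReal.ofReal_of_nonpos h0]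
      push_cast
      simp
      ring
  -- `μ1` does not charge the set where `ρ` is negative, and `μ2 ≤ μ1` is carried by that set; hence
  -- `μ2 = 0`.
  have h1 : μ1 {x | ρ x < 0} = 0 := by
    have hempty : {x | ENNReal.ofReal (ρ x) ≠ 0} ∩ {x | ρ x < 0} = ∅ := by
      ext x
      simp only [Set.mem_inter_iff, Set.mem_ofPred_eq, Set.mem_empty_iff_false, iff_false, not_and,
        not_lt, ne_eq, ENNReal.ofReal_eq_zero, not_le]
      exact fun h => h.le
    rw [hμ1, withDensity_apply_eq_zero hm1, hempty, measure_empty]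
  have h2 : μ2 {x | ρ x < 0} = 0 :=
    le_antisymm ((Measure.le_add_left le_rfl _).trans_eq (heq ▸ h1)) zero_le
  rw [hμ2, withDensity_apply_eq_zero hm2] at h2
  have hnn : ∀ᵐ x, 0 ≤ ρ x := by
    rw [ae_iff]
    convert h2 using 2
    ext x
    simp
  refine ⟨hnn, ?_⟩
  have h3 : μ2 = 0 := by
    rw [hμ2, ← withDensity_zero]
    refine withDensity_congr_ae ?_
    filter_upwards [hnn] with x hx
    simpa using hx
  rw [← heq, h3, add_zero]

end Symmetrization

/-! ### The polynomial ensemble of the sum -/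

section DeformedEnsemble

open Matrix

variable {n : ℕ} {Ω : Type*} [MeasurableSpace Ω] {P : Measure Ω} [IsProbabilityMeasure P]

theorem measurable_eigs_add :
    Measurable fun p : HermitianMatrix n × HermitianMatrix n => (p.1 + p.2).eigs :=
  measurable_eigs.comp (continuous_fst.add continuous_snd).measurable

/-- The expectation of a bounded function of the eigenvalues of a sum of independent matrices. -/
theorem integral_eigs_add {X Y : Ω → HermitianMatrix n} (hX : AEMeasurable X P)
    (hY : HasLaw Y (gueMeasure n) P) (hXY : IndepFun X Y P) {φ : (Fin n → ℝ) → ℂ}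
    (hφ : Continuous φ) {C : ℝ} (hC : ∀ x, ‖φ x‖ ≤ C) :
    ∫ ω, φ (X ω + Y ω).eigs ∂P = ∫ ω, ∫ A, φ (X ω + A).eigs ∂(gueMeasure n) ∂P := by
  have hg : IsProbabilityMeasure (gueMeasure n) := hY.isProbabilityMeasure_iff.1 inferInstance
  have hXm : IsProbabilityMeasure (P.map X) := Measure.isProbabilityMeasure_map hX
  have hm : StronglyMeasurable fun p : HermitianMatrix n × HermitianMatrix n => φ (p.1 + p.2).eigs :=
    (hφ.measurable.comp measurable_eigs_add).stronglyMeasurable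
  have hlaw : P.map (fun ω => (X ω, Y ω)) = (P.map X).prod (gueMeasure n) := by
    rw [(indepFun_iff_map_prod_eq_prod_map_map hX hY.aemeasurable).1 hXY, hY.map_eq]
  have h1 := integral_map (hX.prodMk hY.aemeasurable) hm.aestronglyMeasurable
  rw [← h1, hlaw, integral_prod _ (Integrable.of_bound hm.aestronglyMeasurable C
    (Filter.Eventually.of_forall fun p => hC _)),
    integral_map hX hm.integral_prod_right'.aestronglyMeasurable]

/-- The Gaussian smoothing of the Vandermonde determinant times a test function. -/
noncomputable def smoothedVandermonde (φ : (Fin n → ℝ) → ℂ) (x : Fin n → ℝ) : ℂ :=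
  ∫ y : Fin n → ℝ, ((vandermonde (x + y)).det : ℂ) * φ (x + y) * (gaussWeight y : ℂ)

theorem measurable_smoothedVandermonde {φ : (Fin n → ℝ) → ℂ} (hφ : Continuous φ) :
    Measurable (smoothedVandermonde φ) := by
  have hadd : Continuous fun p : (Fin n → ℝ) × (Fin n → ℝ) => p.1 + p.2 :=
    continuous_fst.add continuous_snd
  have h : Continuous fun p : (Fin n → ℝ) × (Fin n → ℝ) =>
      ((vandermonde (p.1 + p.2)).det : ℂ) * φ (p.1 + p.2) * (gaussWeight p.2 : ℂ) :=
    ((Complex.continuous_ofReal.comp (continuous_det_vandermonde.comp hadd)).mul (hφ.comp hadd)).mul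
      (Complex.continuous_ofReal.comp (continuous_gaussWeight.comp continuous_snd))
  exact (h.measurable.stronglyMeasurable.integral_prod_right').measurable

theorem gaussWeight_comp_perm (σ : Equiv.Perm (Fin n)) (x : Fin n → ℝ) :
    gaussWeight (x ∘ σ) = gaussWeight x := by
  rw [gaussWeight_eq_prod, gaussWeight_eq_prod]
  exact Equiv.prod_comp σ fun i => Real.exp (-(1 / 2) * x i ^ 2)

theorem smoothedVandermonde_comp_perm {φ : (Fin n → ℝ) → ℂ}
    (hφ : ∀ (σ : Equiv.Perm (Fin n)) x, φ (x ∘ σ) = φ x) (σ : Equiv.Perm (Fin n)) (x : Fin n → ℝ) :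
    smoothedVandermonde φ (x ∘ σ) = ((Equiv.Perm.sign σ : ℤ) : ℝ) * smoothedVandermonde φ x := by
  have hσ := measurePreserving_comp_perm σ
  have hemb : MeasurableEmbedding fun x : Fin n → ℝ => x ∘ σ := by
    refine MeasurableEquiv.measurableEmbedding (⟨⟨fun x => x ∘ σ, fun x => x ∘ σ.symm, fun x => ?_,
      fun x => ?_⟩, measurable_comp_perm σ, measurable_comp_perm σ.symm⟩ :
      (Fin n → ℝ) ≃ᵐ (Fin n → ℝ)) <;> ext <;> simp
  rw [smoothedVandermonde, ← hσ.integral_comp hemb, smoothedVandermonde, ← integral_const_mul]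
  refine integral_congr_ae (Filter.Eventually.of_forall fun y => ?_)
  have hadd : x ∘ σ + y ∘ σ = (x + y) ∘ σ := rfl
  simp only [hadd, hφ, det_vandermonde_comp_perm, gaussWeight_comp_perm]
  push_cast
  ring

/-- The expectation of a Cauchy product of the eigenvalues of `X + Y`. -/
theorem integral_cauchyProd_eigs_add {X Y : Ω → HermitianMatrix n} {f : Fin n → ℝ → ℝ} {Z : ℝ}
    (hX : AEMeasurable X P) (hf : ∀ k, AEMeasurable (f k))
    (hpos : ∀ᵐ x : Fin n → ℝ, 0 ≤ polynomialEnsembleDensity f Z x)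
    (hlaw : eigenvalueLaw P X = volume.withDensity
      fun x => ENNReal.ofReal (polynomialEnsembleDensity f Z x))
    (hint : ∀ k, Integrable fun t => (1 + |t|) ^ (n - 1) * f k t)
    (hY : HasLaw Y (gueMeasure n) P) (hXY : IndepFun X Y P) {N : ℕ} {z : Fin N → ℂ}
    (hz : ∀ k, (z k).im ≠ 0) (hinj : z.Injective) :
    ∫ x, cauchyProd z (fun i => (x i : ℂ)) ∂(eigenvalueLaw P fun ω => X ω + Y ω) =
      ∫ x : Fin n → ℝ, cauchyProd z (fun i => (x i : ℂ)) *
        (polynomialEnsembleDensity (fun k => gaussianConvolution (f k))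
          (Z * ∫ y : Fin n → ℝ, gaussWeight y) x : ℂ) := by
  have hg : IsProbabilityMeasure (gueMeasure n) := hY.isProbabilityMeasure_iff.1 inferInstance
  obtain ⟨C, -, hC⟩ := exists_inv_im_bound z
  set φ : (Fin n → ℝ) → ℂ := fun x => cauchyProd z (fun i => (x i : ℂ)) with hφdef
  have hφ : Continuous φ := continuous_cauchyProd_ofReal (n := n) hz
  have hφb := norm_cauchyProd_ofReal_le (n := n) hz hC
  have hφs : ∀ (σ : Equiv.Perm (Fin n)) x, φ (x ∘ σ) = φ x := cauchyProd_comp_perm z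
  set c : ℝ := ∫ y : Fin n → ℝ, gaussWeight y with hc
  have hc0 : (c : ℂ) ≠ 0 := by exact_mod_cast integral_gaussWeight_pos.ne'
  have hXYm : AEMeasurable (fun ω => X ω + Y ω) P :=
    (continuous_fst.add continuous_snd).measurable.comp_aemeasurable (hX.prodMk hY.aemeasurable)
  rw [integral_eigenvalueLaw hXYm hφ.measurable hφs (Integrable.of_bound
      (hφ.measurable.comp_aemeasurable
        (measurable_eigs.comp_aemeasurable hXYm)).aestronglyMeasurable _
      (Filter.Eventually.of_forall fun ω => hφb _)), integral_eigs_add hX hY hXY hφ hφb]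
  -- The GUE average of `φ` at the eigenvalues of `B + A`, as a function of the eigenvalues `x` of
  -- `B`. The formula is valid for distinct eigenvalues, which `X` has almost surely.
  set Q : (Fin n → ℝ) → ℂ := fun x => smoothedVandermonde φ x / ((vandermonde x).det * c) with hQ
  have hQm : Measurable Q := (measurable_smoothedVandermonde hφ).div
    ((Complex.continuous_ofReal.comp continuous_det_vandermonde).measurable.mul_const _)
  have hQs : ∀ (σ : Equiv.Perm (Fin n)) x, Q (x ∘ σ) = Q x := fun σ x => by
    have hs : (((Equiv.Perm.sign σ : ℤ) : ℝ) : ℂ) ≠ 0 := by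
      rcases Int.units_eq_one_or (Equiv.Perm.sign σ) with h | h <;> simp [h]
    simp only [hQ, smoothedVandermonde_comp_perm hφs, det_vandermonde_comp_perm, Complex.ofReal_mul,
      mul_assoc]
    exact mul_div_mul_left _ _ hs
  have hne : ∀ᵐ ω ∂P, (vandermonde (X ω).eigs).det ≠ 0 := by
    refine ae_eigs_of_ae_eigenvalueLaw (p := fun x => (vandermonde x).det ≠ 0) hX ?_
    rw [hlaw]
    exact (withDensity_absolutelyContinuous _ _).ae_le ae_det_vandermonde_ne_zero
  have hR : ∀ᵐ ω ∂P, ∫ A, φ (X ω + A).eigs ∂(gueMeasure n) = Q (X ω).eigs := by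
    filter_upwards [hne] with ω hω
    have h1 := vdm_eigs_mul_integral_gueMeasure (X ω) hz hinj
    rw [vdm_ofReal, integral_complex_ofReal] at h1
    have h2 : smoothedVandermonde φ (X ω).eigs = ((vandermonde (X ω).eigs).det : ℂ) *
        (∫ A, φ (X ω + A).eigs ∂(gueMeasure n)) * (c : ℂ) := by
      refine Eq.trans ?_ h1.symm
      refine integral_congr_ae (Filter.Eventually.of_forall fun y => ?_)
      have := vdm_ofReal ((X ω).eigs + y)
      simp only [Pi.add_apply, Complex.ofReal_add] at this
      simp only [hφdef, Pi.add_apply, Complex.ofReal_add]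
      rw [this]
    have h3 : ((vandermonde (X ω).eigs).det : ℂ) ≠ 0 := by exact_mod_cast hω
    rw [hQ]
    simp only
    rw [eq_div_iff (mul_ne_zero h3 hc0), h2]
    ring
  rw [integral_congr_ae hR]
  -- Boundedness comes from reading `Q` as an average of the bounded `φ`; the quotient does not show
  -- it near coinciding eigenvalues.
  have hQi : Integrable (fun ω => Q (X ω).eigs) P := by
    refine Integrable.of_bound (hQm.comp_aemeasurable
      (measurable_eigs.comp_aemeasurable hX)).aestronglyMeasurable
      (∏ _k : Fin N, ∏ _i : Fin n, C) ?_
    filter_upwards [hR] with ω hω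
    rw [← hω]
    refine (norm_integral_le_of_norm_le_const (Filter.Eventually.of_forall fun A => hφb _)).trans ?_
    simp
  rw [← integral_eigenvalueLaw hX hQm hQs hQi, hlaw, integral_withDensity_eq_integral_toReal_smul₀
    (aemeasurable_polynomialEnsembleDensity hf Z).ennreal_ofReal (by simp)]
  have hfi : ∀ k, Integrable (f k) := fun k => integrable_of_pow_mul (hf k) (hint k)
  have hF := (integrable_and_integral_weightDet_mul_shift hfi hint hφ hφb).2
  -- The Vandermonde factor of the density cancels the denominator of `Q`.
  have e1 : ∫ x : Fin n → ℝ, (ENNReal.ofReal (polynomialEnsembleDensity f Z x)).toReal • Q x =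
      ∫ x : Fin n → ℝ, ((Z * c : ℝ) : ℂ)⁻¹ * ((weightDet f x : ℂ) * smoothedVandermonde φ x) := by
    refine integral_congr_ae ?_
    filter_upwards [hpos, ae_det_vandermonde_ne_zero] with x hx hΔ
    have h3 : ((vandermonde x).det : ℂ) ≠ 0 := by exact_mod_cast hΔ
    rw [ENNReal.toReal_ofReal hx, Complex.real_smul]
    change ((Z⁻¹ * (vandermonde x).det * weightDet f x : ℝ) : ℂ) *
      (smoothedVandermonde φ x / ((vandermonde x).det * c)) = _
    push_cast
    rw [mul_inv]
    field_simp
  rw [e1, integral_const_mul]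
  refine (congrArg (((Z * c : ℝ) : ℂ)⁻¹ * ·) hF).trans ?_
  rw [← integral_const_mul]
  refine integral_congr_ae (Filter.Eventually.of_forall fun x => ?_)
  change _ = φ x * (((Z * c)⁻¹ * (vandermonde x).det *
    weightDet (fun k => gaussianConvolution (f k)) x : ℝ) : ℂ)
  push_cast
  ring

/-- The weights of a polynomial ensemble have finite moments up to order `n - 1`. -/
theorem integrable_pow_mul_weight_of_eigenvalueLaw {X : Ω → HermitianMatrix n} {f : Fin n → ℝ → ℝ}
    {Z : ℝ} (hZ : Z ≠ 0) (hX : AEMeasurable X P) (hf : ∀ k, AEMeasurable (f k))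
    (hpos : ∀ᵐ x : Fin n → ℝ, 0 ≤ polynomialEnsembleDensity f Z x)
    (hlaw : eigenvalueLaw P X = volume.withDensity
      fun x => ENNReal.ofReal (polynomialEnsembleDensity f Z x)) (k : Fin n) :
    Integrable fun t => (1 + |t|) ^ (n - 1) * f k t := by
  have hprob := isProbabilityMeasure_eigenvalueLaw hX
  have h1 : ∫⁻ x : Fin n → ℝ, ENNReal.ofReal (polynomialEnsembleDensity f Z x) = 1 := by
    rw [← setLIntegral_univ, ← withDensity_apply _ MeasurableSet.univ, ← hlaw]
    exact hprob.measure_univ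
  have hi : Integrable (polynomialEnsembleDensity f Z) :=
    ⟨(aemeasurable_polynomialEnsembleDensity hf Z).aestronglyMeasurable,
      (hasFiniteIntegral_iff_ofReal hpos).2 (by rw [h1]; exact ENNReal.one_lt_top)⟩
  have hρ : ∀ x, (vandermonde x).det * (of fun j k => f k (x j)).det =
      Z * polynomialEnsembleDensity f Z x := fun x => by
    rw [polynomialEnsembleDensity]
    field_simp
  cases n with
  | zero => exact k.elim0
  | succ m =>
    refine integrable_pow_mul_weight hf ?_ (fun h => ?_) k
    · simp_rw [hρ]
      exact hi.const_mul Z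
    -- A density vanishing almost everywhere would contradict total mass one.
    · have h0 : ∫⁻ x : Fin (m + 1) → ℝ, ENNReal.ofReal (polynomialEnsembleDensity f Z x) = 0 := by
        refine (lintegral_congr_ae ?_).trans lintegral_zero
        filter_upwards [h] with x hx
        rw [hρ, mul_eq_zero] at hx
        rw [hx.resolve_left hZ, ENNReal.ofReal_zero]
      exact zero_ne_one (h0.symm.trans h1)

end DeformedEnsemble

/-! ### The main theorem -/

theorem corollary3p1 {n : ℕ} {Ω : Type*} [MeasurableSpace Ω] {P : Measure Ω}
    [IsProbabilityMeasure P] {X Y : Ω → HermitianMatrix n} {f : Fin n → ℝ → ℝ}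
    (hX : IsPolynomialEnsemble P X f) (hinv : IsUnitarilyInvariant P X)
    (hY : HasLaw Y (gueMeasure n) P) (hXY : IndepFun X Y P) :
    (∀ (k : Fin n) (y : ℝ),
      Integrable (fun x : ℝ => Real.exp (-(1 / 2) * x ^ 2) * f k (y - x))) ∧
    IsPolynomialEnsemble P (fun ω => X ω + Y ω) (fun k => gaussianConvolution (f k)) := by
  obtain ⟨Z, hZ, hpos, hlaw⟩ := hX.exists_density
  have hf := hX.aemeasurable_weight
  have hint := integrable_pow_mul_weight_of_eigenvalueLaw hZ hX.aemeasurable hf hpos hlaw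
  have hfi : ∀ k, Integrable (f k) := fun k => integrable_of_pow_mul (hf k) (hint k)
  have hgc : ∀ k, Continuous (gaussianConvolution (f k)) := fun k =>
    continuous_gaussianConvolution (hfi k)
  have hXYm : AEMeasurable (fun ω => X ω + Y ω) P :=
    (continuous_fst.add continuous_snd).measurable.comp_aemeasurable
      (hX.aemeasurable.prodMk hY.aemeasurable)
  refine ⟨fun k => integrable_exp_mul_comp_sub (hfi k), hXYm, fun k => (hgc k).aemeasurable,
    -- The kernel in `gaussianConvolution` is not normalized, so the constant gains the mass of the
    -- `n`-dimensional Gaussian.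
    Z * ∫ y : Fin n → ℝ, gaussWeight y, mul_ne_zero hZ integral_gaussWeight_pos.ne', ?_⟩
  have hprob := isProbabilityMeasure_eigenvalueLaw hXYm
  have hρc : Continuous (polynomialEnsembleDensity (fun k => gaussianConvolution (f k))
      (Z * ∫ y : Fin n → ℝ, gaussWeight y)) :=
    (continuous_const.mul continuous_det_vandermonde).mul (continuous_weightDet hgc)
  have hρi : Integrable (polynomialEnsembleDensity (fun k => gaussianConvolution (f k))
      (Z * ∫ y : Fin n → ℝ, gaussWeight y)) := by
    -- The constant test function gives absolute integrability of the new density, before its sign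
    -- is known.
    have h := (integrable_and_integral_weightDet_mul_shift hfi hint (φ := fun _ => 1)
      continuous_const (C := 1) (fun _ => by simp)).1
    refine (h.re.const_mul (Z * ∫ y : Fin n → ℝ, gaussWeight y)⁻¹).congr
      (Filter.Eventually.of_forall fun x => ?_)
    simp only [mul_one, ← Complex.ofReal_mul]
    change _ = _ * _ * weightDet _ x
    rw [mul_assoc]
    rfl
  exact ae_nonneg_and_eq_withDensity (map_comp_perm_eigenvalueLaw hXYm) hρc.measurable hρi
    (polynomialEnsembleDensity_comp_perm _ _) fun N z hz hinj =>
      integral_cauchyProd_eigs_add hX.aemeasurable hf hpos hlaw hint hY hXY hz hinj
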